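/- Let $A$ be the operator $A\varphi=-\varphi''$ on $L^2((0,1),\mathbb{C})$ with domain $D(A)=H^2\cap H^1_0((0,1),\mathbb{C})$, with eigenvalues $\lambda_k=(k\pi)^2$ and orthonormal basis of eigenfunctions $\varphi_k(x)=\sqrt2\,\sin(k\pi x)$, $k\geq 1$. Write $\langle f,g\rangle=\int_0^1 f\,\overline g\,dx$, let $e^{-iAt}\varphi=\sum_{k\ge1}\langle\varphi,\varphi_k\rangle e^{-i\lambda_k t}\varphi_k$ for $\varphi\in L^2((0,1),\mathbb{C})$, and let $H^3_{(0)}:=D(A^{3/2})=\{\varphi\in L^2((0,1),\mathbb{C}) : \sum_{k\ge1}|k^3\langle\varphi,\varphi_k\rangle|^2<\infty\}$ with the norm $\|\varphi\|_{H^3_{(0)}}=\big(\sum_{k\ge1}|k^3\langle\varphi,\varphi_k\rangle|^2\big)^{1/2}$. The space $H^3\cap H^1_0=H^3\cap H^1_0((0,1),\mathbb{C})$ carries the norm of $H^3$. Let $T>0$ and $\mu\in H^3((0,1),\mathbb{R})$. (1) For every $\psi_0\in H^3_{(0)}$, $f\in L^2((0,T),H^3\cap H^1_0)$ and $u\in L^2((0,T),\mathbb{R})$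 there exists a unique weak solution of $$i\,\partial_t\psi=-\partial_x^2\psi-u(t)\mu(x)\psi-f(t,x),\qquad \psi(t,0)=\psi(t,1)=0,\qquad \psi(0,x)=\psi_0(x),$$ that is, a unique $\psi\in C^0([0,T],H^3_{(0)})$ such that for every $t\in[0,T]$ $$\psi(t)=e^{-iAt}\psi_0+i\int_0^t e^{-iA(t-\tau)}\big[u(\tau)\mu\psi(\tau)+f(\tau)\big]\,d\tau,$$ where the integral is a Bochner integral in $L^2((0,1),\mathbb{C})$. (2) For every $R>0$ there exists a constant $C=C(T,\mu,R)>0$ such that, for all $\psi_0,f,u$ as in (1) with $\|u\|_{L^2(0,T)}<R$, the weak solution satisfies $$\|\psi\|_{C^0([0,T],H^3_{(0)})}\leq C\big(\|\psi_0\|_{H^3_{(0)}}+\|f\|_{L^2((0,T),H^3\cap H^1_0)}\big).$$ (3) If $f=0$, then $\|\psi(t)\|_{L^2(0,1)}=\|\psi_0\|_{L^2(0,1)}$ for every $t\in[0,T]$. -/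

import Mathlib

open MeasureTheory Set
open scoped ENNReal ContDiff

noncomputable section

namespace Schrodinger

/-- Lebesgue measure on the interval `(0,1)`. -/
abbrev unitMeasure : Measure ℝ := volume.restrict (Ioo (0 : ℝ) 1)

/-- `L²((0,1), 𝕜)`, for `𝕜 = ℝ` or `𝕜 = ℂ`. -/
abbrev L2 (𝕜 : Type) [RCLike 𝕜] : Type := Lp 𝕜 2 unitMeasure

/-- Test functions: smooth functions with compact support contained in the open interval `(0,1)`. -/
structure IsTest {𝕜 : Type} [RCLike 𝕜] (η : ℝ → 𝕜) : Prop where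
  contDiff : ContDiff ℝ ∞ η
  hasCompactSupport : HasCompactSupport η
  tsupport_subset : tsupport η ⊆ Ioo (0 : ℝ) 1

/-- `g` is the weak derivative of order `j` of `f` on `(0,1)`. -/
def IsWeakDeriv {𝕜 : Type} [RCLike 𝕜] (j : ℕ) (f g : L2 𝕜) : Prop :=
  ∀ η : ℝ → ℝ, IsTest η →
    ∫ x in Ioo (0 : ℝ) 1, iteratedDeriv j η x • f x =
      (-1 : ℝ) ^ j • ∫ x in Ioo (0 : ℝ) 1, η x • g x

theorem integrable_smul_L2 {𝕜 : Type} [RCLike 𝕜] {η : ℝ → ℝ} (hη : IsTest η) (j : ℕ)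
    (f : L2 𝕜) : Integrable (fun x => iteratedDeriv j η x • f x) unitMeasure := by
  have hc : Continuous (iteratedDeriv j η) :=
    hη.contDiff.continuous_iteratedDeriv j (by exact_mod_cast le_top)
  obtain ⟨C, hC⟩ := (isCompact_Icc (a := (0 : ℝ)) (b := 1)).exists_bound_of_continuousOn
    hc.continuousOn
  refine Integrable.bdd_smul (C := C) ((Lp.memLp f).integrable (by norm_num))
    hc.aestronglyMeasurable ?_
  filter_upwards [ae_restrict_mem measurableSet_Ioo] with x hx
  exact hC x (Ioo_subset_Icc_self hx)

theorem IsWeakDeriv.zero {𝕜 : Type} [RCLike 𝕜] (j : ℕ) : IsWeakDeriv j (0 : L2 𝕜) 0 := by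
  intro η _
  have h : ∀ θ : ℝ → ℝ, ∫ x in Ioo (0 : ℝ) 1, θ x • (0 : L2 𝕜) x = 0 := by
    intro θ
    refine integral_eq_zero_of_ae ?_
    filter_upwards [Lp.coeFn_zero 𝕜 2 unitMeasure] with x hx
    rw [hx, Pi.zero_apply, smul_zero]
  rw [h, h, smul_zero]

theorem IsWeakDeriv.add {𝕜 : Type} [RCLike 𝕜] {j : ℕ} {f g f' g' : L2 𝕜}
    (h : IsWeakDeriv j f g) (h' : IsWeakDeriv j f' g') : IsWeakDeriv j (f + f') (g + g') := by
  intro η hη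
  have key : ∀ (i : ℕ) (a b : L2 𝕜), ∫ x in Ioo (0 : ℝ) 1, iteratedDeriv i η x • (a + b : L2 𝕜) x =
      (∫ x in Ioo (0 : ℝ) 1, iteratedDeriv i η x • a x) +
        ∫ x in Ioo (0 : ℝ) 1, iteratedDeriv i η x • b x := by
    intro i a b
    rw [← integral_add (integrable_smul_L2 hη i a) (integrable_smul_L2 hη i b)]
    refine integral_congr_ae ?_
    filter_upwards [Lp.coeFn_add a b] with x hx
    rw [hx, Pi.add_apply, smul_add]
  have k0 := key 0 g g'
  simp only [iteratedDeriv_zero] at k0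
  rw [key j, k0, h η hη, h' η hη, smul_add]

theorem IsWeakDeriv.smul {𝕜 : Type} [RCLike 𝕜] {j : ℕ} {f g : L2 𝕜} (c : 𝕜)
    (h : IsWeakDeriv j f g) : IsWeakDeriv j (c • f) (c • g) := by
  intro η hη
  have key : ∀ (θ : ℝ → ℝ) (a : L2 𝕜), ∫ x in Ioo (0 : ℝ) 1, θ x • (c • a : L2 𝕜) x =
      c • ∫ x in Ioo (0 : ℝ) 1, θ x • a x := by
    intro θ a
    rw [← integral_smul]
    refine integral_congr_ae ?_
    filter_upwards [Lp.coeFn_smul c a] with x hx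
    simp only [hx, Pi.smul_apply]
    exact smul_comm _ _ _
  rw [key, key, h η hη, smul_comm]

/-- The families `(f, f', …, f^(m))` of an `L²` function and its weak derivatives up to order `m`,
as a subspace of the Hilbert sum of `m + 1` copies of `L²`. -/
def sobolevSubmodule (𝕜 : Type) [RCLike 𝕜] (m : ℕ) :
    Submodule 𝕜 (PiLp 2 fun _ : Fin (m + 1) => L2 𝕜) where
  carrier := {F | ∀ j : Fin (m + 1), IsWeakDeriv (j : ℕ) (F 0) (F j)}
  zero_mem' := fun j => IsWeakDeriv.zero (j : ℕ)
  add_mem' := fun h h' j => (h j).add (h' j)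
  smul_mem' := fun c _ h j => (h j).smul c

/-- The Sobolev space `H^m((0,1), 𝕜)`. An element is a function `f ∈ L²` together with its weak
derivatives, which are determined by `f`; the norm inherited from the Hilbert sum is the usual
one, `(‖f‖² + ‖f'‖² + ⋯ + ‖f^(m)‖²)^{1/2}`. -/
def Sobolev (𝕜 : Type) [RCLike 𝕜] (m : ℕ) : Type := sobolevSubmodule 𝕜 m

instance (𝕜 : Type) [RCLike 𝕜] (m : ℕ) : NormedAddCommGroup (Sobolev 𝕜 m) :=
  inferInstanceAs (NormedAddCommGroup (sobolevSubmodule 𝕜 m))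

instance (𝕜 : Type) [RCLike 𝕜] (m : ℕ) : InnerProductSpace 𝕜 (Sobolev 𝕜 m) :=
  inferInstanceAs (InnerProductSpace 𝕜 (sobolevSubmodule 𝕜 m))

/-- The weak derivative of order `j` of an element of `H^m`, for `j = 0, …, m`. -/
def Sobolev.wderiv {𝕜 : Type} [RCLike 𝕜] {m : ℕ} (F : Sobolev 𝕜 m) (j : Fin (m + 1)) : L2 𝕜 :=
  (Subtype.val (p := (· ∈ sobolevSubmodule 𝕜 m)) F) j

/-- The function underlying an element of `H^m`, as an element of `L²`. -/
def Sobolev.toL2 (𝕜 : Type) [RCLike 𝕜] (m : ℕ) : Sobolev 𝕜 m →ₗ[𝕜] L2 𝕜 where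
  toFun F := F.wderiv 0
  map_add' _ _ := rfl
  map_smul' _ _ := rfl

theorem Sobolev.isWeakDeriv {𝕜 : Type} [RCLike 𝕜] {m : ℕ} (F : Sobolev 𝕜 m) (j : Fin (m + 1)) :
    IsWeakDeriv (j : ℕ) (Sobolev.toL2 𝕜 m F) (F.wderiv j) :=
  Subtype.prop (p := (· ∈ sobolevSubmodule 𝕜 m)) F j

theorem Sobolev.norm_eq {𝕜 : Type} [RCLike 𝕜] {m : ℕ} (F : Sobolev 𝕜 m) :
    ‖F‖ = Real.sqrt (∑ j, ‖F.wderiv j‖ ^ 2) :=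
  PiLp.norm_eq_of_L2 (Subtype.val (p := (· ∈ sobolevSubmodule 𝕜 m)) F)

/-- `H^1_0((0,1), 𝕜)`: the closure in `H^1` of the test functions. -/
def H10 (𝕜 : Type) [RCLike 𝕜] : Submodule 𝕜 (Sobolev 𝕜 1) :=
  (Submodule.span 𝕜 {F | ∃ η : ℝ → 𝕜, IsTest η ∧
    Sobolev.toL2 𝕜 1 F =ᵐ[unitMeasure] η}).topologicalClosure

/-- The subspace of `H^3((0,1), ℂ)` of the functions that belong to `H^1_0((0,1), ℂ)`. -/
def h3h10Submodule : Submodule ℂ (Sobolev ℂ 3) :=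
  ((H10 ℂ).map (Sobolev.toL2 ℂ 1)).comap (Sobolev.toL2 ℂ 3)

/-- `H^3 ∩ H^1_0((0,1), ℂ)`, with the norm of `H^3`. -/
def H3H10 : Type := h3h10Submodule

instance : NormedAddCommGroup H3H10 := inferInstanceAs (NormedAddCommGroup h3h10Submodule)

instance : InnerProductSpace ℂ H3H10 := inferInstanceAs (InnerProductSpace ℂ h3h10Submodule)

/-- The inclusion of `H^3 ∩ H^1_0` into `H^3`. -/
def H3H10.toSobolev (F : H3H10) : Sobolev ℂ 3 := Subtype.val (p := (· ∈ h3h10Submodule)) F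

/-- The eigenvalue `λ_k = (kπ)²` of the Dirichlet operator `A = -d²/dx²`. -/
def eigenvalue (k : ℕ+) : ℝ := ((k : ℝ) * Real.pi) ^ 2

theorem memLp_sine (k : ℕ+) :
    MemLp (fun x : ℝ => ((Real.sqrt 2 * Real.sin ((k : ℝ) * Real.pi * x) : ℝ) : ℂ)) 2
      unitMeasure := by
  refine MemLp.of_bound (Continuous.aestronglyMeasurable (by fun_prop)) (Real.sqrt 2)
    (Filter.Eventually.of_forall fun x => ?_)
  rw [Complex.norm_real, norm_mul, Real.norm_of_nonneg (Real.sqrt_nonneg 2)]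
  exact mul_le_of_le_one_right (Real.sqrt_nonneg 2) (Real.abs_sin_le_one _)

/-- The eigenfunction `φ_k(x) = √2 sin(kπx)`. -/
def eigenfunction (k : ℕ+) : L2 ℂ := (memLp_sine k).toLp _

/-- The coefficient `⟨φ, φ_k⟩ = ∫₀¹ φ(x) conj (φ_k(x)) dx`. -/
def coeff (k : ℕ+) (φ : L2 ℂ) : ℂ := inner ℂ (eigenfunction k) φ

/-- The group `e^{-iAt}` on `L²((0,1), ℂ)`: `e^{-iAt} φ = ∑_k ⟨φ, φ_k⟩ e^{-iλ_k t} φ_k`. -/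
def group (t : ℝ) (φ : L2 ℂ) : L2 ℂ :=
  ∑' k : ℕ+, (coeff k φ * Complex.exp (-Complex.I * eigenvalue k * t)) • eigenfunction k

/-- The domain of `A^{s/2}`, as a subspace of `L²`: since `λ_k^{s/2} = π^s k^s`, it consists of
the `φ` with `∑_k |k^s ⟨φ, φ_k⟩|² < ∞`. -/
def spectralDomain (s : ℕ) : Submodule ℂ (L2 ℂ) where
  carrier := {φ | Memℓp (fun k : ℕ+ => (k : ℂ) ^ s * coeff k φ) 2}
  zero_mem' := by
    have : (fun k : ℕ+ => (k : ℂ) ^ s * coeff k 0) = 0 := by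
      funext k; simp [coeff]
    simp only [mem_ofPred_eq, this]
    exact zero_memℓp
  add_mem' := by
    intro a b ha hb
    have : (fun k : ℕ+ => (k : ℂ) ^ s * coeff k (a + b)) =
        (fun k : ℕ+ => (k : ℂ) ^ s * coeff k a) + fun k : ℕ+ => (k : ℂ) ^ s * coeff k b := by
      funext k; simp [coeff, inner_add_right, mul_add]
    simp only [mem_ofPred_eq, this]
    exact Memℓp.add ha hb
  smul_mem' := by
    intro c a ha
    have : (fun k : ℕ+ => (k : ℂ) ^ s * coeff k (c • a)) =
        c • fun k : ℕ+ => (k : ℂ) ^ s * coeff k a := by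
      funext k; simp [coeff, inner_smul_right, mul_left_comm]
    simp only [mem_ofPred_eq, this]
    exact Memℓp.const_smul ha c

/-- The space `H^s_{(0)}((0,1), ℂ) = D(A^{s/2})`, as a type of its own, because its norm is not
the one inherited from `L²`. -/
def H0 (s : ℕ) : Type := spectralDomain s

instance (s : ℕ) : AddCommGroup (H0 s) := inferInstanceAs (AddCommGroup (spectralDomain s))

instance (s : ℕ) : Module ℂ (H0 s) := inferInstanceAs (Module ℂ (spectralDomain s))

/-- The inclusion of `H^s_{(0)}` into `L²`. -/
def H0.toL2 {s : ℕ} (φ : H0 s) : L2 ℂ := Subtype.val (p := (· ∈ spectralDomain s)) φ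

/-- The weighted coefficients `(k^s ⟨φ, φ_k⟩)_k`, as a square summable sequence. -/
def H0.weighted (s : ℕ) : H0 s →ₗ[ℂ] lp (fun _ : ℕ+ => ℂ) 2 where
  toFun φ := ⟨fun k => (k : ℂ) ^ s * coeff k φ.toL2, φ.2⟩
  map_add' a b := by
    ext k
    change (k : ℂ) ^ s * coeff k (a.toL2 + b.toL2) =
      (k : ℂ) ^ s * coeff k a.toL2 + (k : ℂ) ^ s * coeff k b.toL2
    simp [coeff, inner_add_right, mul_add]
  map_smul' c a := by
    ext k
    change (k : ℂ) ^ s * coeff k (c • a.toL2) = c * ((k : ℂ) ^ s * coeff k a.toL2)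
    simp [coeff, inner_smul_right, mul_left_comm]

/-- The norm of `H^s_{(0)}`, `‖φ‖ = (∑_k |k^s ⟨φ, φ_k⟩|²)^{1/2}`; see `H0.norm_eq`.
(It vanishes only at `0`, because `(φ_k)` is an orthonormal basis of `L²`.) -/
instance (s : ℕ) : SeminormedAddCommGroup (H0 s) :=
  SeminormedAddCommGroup.induced (H0 s) (lp (fun _ : ℕ+ => ℂ) 2) (H0.weighted s)

theorem H0.norm_eq {s : ℕ} (φ : H0 s) :
    ‖φ‖ = Real.sqrt (∑' k : ℕ+, ‖(k : ℂ) ^ s * coeff k φ.toL2‖ ^ 2) := by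
  change ‖H0.weighted s φ‖ = _
  rw [lp.norm_eq_tsum_rpow (by norm_num), Real.sqrt_eq_rpow]
  simp [H0.weighted]

open Classical in
/-- The product of a real function and a complex function on `(0,1)`, as an element of `L²`.
(If the product is not square integrable, the value is `0`; this does not happen for
`m ∈ H^3` and `φ ∈ L²`, as `H^3` functions are bounded.) -/
def mul (m : L2 ℝ) (φ : L2 ℂ) : L2 ℂ :=
  if h : MemLp (fun x => (m x : ℂ) * φ x) 2 unitMeasure then h.toLp _ else 0

/-- `L²((0,T), E)`. -/
abbrev L2Time (T : ℝ) (E : Type) [NormedAddCommGroup E] : Type :=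
  Lp E 2 (volume.restrict (Ioo (0 : ℝ) T))

/-- The integrand `e^{-iA(t-τ)} [u(τ) μ ψ(τ) + f(τ)]` of the Duhamel formula, for `τ ∈ [0,T]`. -/
def duhamelIntegrand {T : ℝ} (hT : 0 < T) (μ : Sobolev ℝ 3) (u : L2Time T ℝ)
    (f : L2Time T H3H10) (ψ : C(Icc (0 : ℝ) T, H0 3)) (t τ : ℝ) : L2 ℂ :=
  group (t - τ) (u τ • mul (Sobolev.toL2 ℝ 3 μ) (IccExtend hT.le ψ τ).toL2 +
    Sobolev.toL2 ℂ 3 (f τ).toSobolev)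

/-- `ψ ∈ C⁰([0,T], H^3_{(0)})` is a weak solution of
`i ψ_t = -ψ'' - u μ ψ - f`, `ψ(t,0) = ψ(t,1) = 0`, `ψ(0) = ψ₀`:
for every `t ∈ [0,T]`, `ψ(t) = e^{-iAt} ψ₀ + i ∫₀ᵗ e^{-iA(t-τ)} [u(τ) μ ψ(τ) + f(τ)] dτ`.
The integral is a Bochner integral in `L²`, since the integrand need not lie in `H^3_{(0)}`. -/
structure IsWeakSolution {T : ℝ} (hT : 0 < T) (μ : Sobolev ℝ 3) (ψ₀ : H0 3)
    (f : L2Time T H3H10) (u : L2Time T ℝ) (ψ : C(Icc (0 : ℝ) T, H0 3)) : Prop where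
  integrable : ∀ t : Icc (0 : ℝ) T,
    IntervalIntegrable (duhamelIntegrand hT μ u f ψ t) volume 0 t
  duhamel : ∀ t : Icc (0 : ℝ) T,
    (ψ t).toL2 = group t ψ₀.toL2 +
      Complex.I • ∫ τ in (0 : ℝ)..t, duhamelIntegrand hT μ u f ψ t τ

end Schrodinger

end

/-! The equation is solved for the weighted coefficients `x_k(t) = k³⟨ψ(t), φ_k⟩`. Since `(φ_k)` is
an orthonormal basis (`sineBasis`), `H^3_{(0)}` is isometric to `ℓ²` (`weightedEquiv`), and the
Duhamel formula, an identity in `L²`, is equivalent to a scalar identity for every `k`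
(`isWeakSolution_iff_isSeqSolution`).

The difficulty is that the source `g = uμψ + f` belongs to `H^3 ∩ H^1_0` but in general not to
`H^3_{(0)}`, because `g''` need not vanish at `0` and `1`. Three integrations by parts measure the
defect (`mul_coeff_of_hasTrace`): `(kπ)³⟨g, φ_k⟩ = √2((-1)^k g''(1) - g''(0)) - ∫ g''' √2 cos(kπx)
dx`. So `k³⟨g, φ_k⟩ = α + (-1)^k β + γ_k` with `γ ∈ ℓ²`: the type `Expansion` stores `(α, β, γ)`,
which depends linearly and continuously on `f` (`H3H10.expand`) and on `ψ` (`exists_mul_operator`).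

The constants `α` and `β` are not in `ℓ²`, but time integration repairs this. The `λ_k` are distinct
integer multiples of `π²`, so the functions `e^{-iλ_k t}` are orthogonal on intervals whose length
is a multiple of `2/π`. Bessel's inequality then bounds the `ℓ²` norm of `(∫ e^{iλ_k τ} α(τ) dτ)_k`
by the `L²` norm of `α` (`exists_bessel_phase`). Hence the Duhamel term is continuous in time with
values in `ℓ²`, controlled by the `L²` norm in time of the expansion (`exists_continuous_integral`).

For a weight `exp(c ∫₀ᵗ u²)` with `c` large the Duhamel map is a contraction with factor `1/2`,
whatever the size of `u`. This gives existence and uniqueness, and comparison with the image of `0`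
gives the estimate (`exists_seqSolution`).

For `f = 0`, the function `χ(t) = e^{iAt}ψ(t)` is absolutely continuous in `L²`, and almost
everywhere its derivative `i u e^{iAt} μψ` is orthogonal to `χ` for the real inner product, because
`uμ` is real. So `‖χ‖` is constant (`norm_add_integral_eq`). -/

noncomputable section

namespace Schrodinger

/-! ### The sine and cosine families -/

/-- The profile `√2 sin(kπx)`. -/
def sinFn (k : ℕ+) (x : ℝ) : ℝ := Real.sqrt 2 * Real.sin ((k : ℝ) * Real.pi * x)

/-- The profile `√2 cos(kπx)`. -/
def cosFn (k : ℕ+) (x : ℝ) : ℝ := Real.sqrt 2 * Real.cos ((k : ℝ) * Real.pi * x)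

theorem abs_sinFn_le (k : ℕ+) (x : ℝ) : |sinFn k x| ≤ Real.sqrt 2 := by
  rw [sinFn, abs_mul, abs_of_nonneg (Real.sqrt_nonneg 2)]
  exact mul_le_of_le_one_right (Real.sqrt_nonneg 2) (Real.abs_sin_le_one _)

theorem abs_cosFn_le (k : ℕ+) (x : ℝ) : |cosFn k x| ≤ Real.sqrt 2 := by
  rw [cosFn, abs_mul, abs_of_nonneg (Real.sqrt_nonneg 2)]
  exact mul_le_of_le_one_right (Real.sqrt_nonneg 2) (Real.abs_cos_le_one _)

theorem contDiff_sinFn (k : ℕ+) : ContDiff ℝ ∞ (sinFn k) := by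
  unfold sinFn; fun_prop

theorem contDiff_cosFn (k : ℕ+) : ContDiff ℝ ∞ (cosFn k) := by
  unfold cosFn; fun_prop

theorem continuous_sinFn (k : ℕ+) : Continuous (sinFn k) := (contDiff_sinFn k).continuous

theorem continuous_cosFn (k : ℕ+) : Continuous (cosFn k) := (contDiff_cosFn k).continuous

theorem hasDerivAt_sinFn (k : ℕ+) (x : ℝ) :
    HasDerivAt (sinFn k) (k * Real.pi * cosFn k x) x := by
  have h := ((hasDerivAt_id x).const_mul ((k : ℝ) * Real.pi)).sin.const_mul (Real.sqrt 2)
  refine h.congr_deriv ?_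
  simp only [cosFn, id]; ring

theorem hasDerivAt_cosFn (k : ℕ+) (x : ℝ) :
    HasDerivAt (cosFn k) (-(k * Real.pi * sinFn k x)) x := by
  have h := ((hasDerivAt_id x).const_mul ((k : ℝ) * Real.pi)).cos.const_mul (Real.sqrt 2)
  refine h.congr_deriv ?_
  simp only [sinFn, id]; ring

theorem deriv_sinFn (k : ℕ+) : deriv (sinFn k) = fun x => k * Real.pi * cosFn k x :=
  funext fun x => (hasDerivAt_sinFn k x).deriv

theorem deriv_cosFn (k : ℕ+) : deriv (cosFn k) = fun x => -(k * Real.pi * sinFn k x) :=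
  funext fun x => (hasDerivAt_cosFn k x).deriv

@[simp] theorem sinFn_zero (k : ℕ+) : sinFn k 0 = 0 := by simp [sinFn]

@[simp] theorem sinFn_one (k : ℕ+) : sinFn k 1 = 0 := by
  have := Real.sin_nat_mul_pi (k : ℕ)
  simp [sinFn, this]

@[simp] theorem cosFn_zero (k : ℕ+) : cosFn k 0 = Real.sqrt 2 := by simp [cosFn]

@[simp] theorem cosFn_one (k : ℕ+) : cosFn k 1 = Real.sqrt 2 * (-1) ^ (k : ℕ) := by
  have := Real.cos_nat_mul_pi (k : ℕ)
  simp [cosFn, this]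

theorem integral_cos_int_mul_pi {n : ℤ} (hn : n ≠ 0) :
    ∫ x in Ioo (0 : ℝ) 1, Real.cos ((n : ℝ) * Real.pi * x) = 0 := by
  have hc : (n : ℝ) * Real.pi ≠ 0 := mul_ne_zero (by exact_mod_cast hn) Real.pi_ne_zero
  rw [← integral_Ioc_eq_integral_Ioo, ← intervalIntegral.integral_of_le zero_le_one,
    intervalIntegral.integral_comp_mul_left (fun y => Real.cos y) hc, integral_cos]
  simp [Real.sin_int_mul_pi]

theorem integrable_unit_of_continuous {h : ℝ → ℝ} (hh : Continuous h) :
    Integrable h unitMeasure :=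
  (hh.integrableOn_Icc (a := 0) (b := 1)).mono_set Ioo_subset_Icc_self

/-- Product-to-sum form of both orthogonality relations: `σ = -1` gives the sines and `σ = 1` the
cosines. Only the frequency `j - k` can vanish. -/
theorem integral_cos_mul (j k : ℕ+) (σ : ℝ) :
    ∫ x in Ioo (0 : ℝ) 1, (Real.cos (((j : ℝ) - k) * Real.pi * x) +
      σ * Real.cos (((j : ℝ) + k) * Real.pi * x)) = if j = k then 1 else 0 := by
  have h2 := integral_cos_int_mul_pi (n := (j : ℤ) + k)
    (by have := j.pos; have := k.pos; omega)
  push_cast at h2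
  rw [integral_add (integrable_unit_of_continuous (by fun_prop))
    (integrable_unit_of_continuous (by fun_prop)), integral_const_mul, h2, mul_zero, add_zero]
  split_ifs with h
  · subst h; simp
  · have h1 := integral_cos_int_mul_pi (n := (j : ℤ) - k) (by
      intro h0
      exact h (PNat.coe_injective (by omega)))
    push_cast at h1
    exact h1

theorem integral_sinFn_mul (j k : ℕ+) :
    ∫ x in Ioo (0 : ℝ) 1, sinFn j x * sinFn k x = if j = k then 1 else 0 := by
  rw [← integral_cos_mul j k (-1)]
  congr 1; funext x
  have h2 : Real.sqrt 2 * Real.sqrt 2 = 2 := Real.mul_self_sqrt (by norm_num)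
  rw [sub_mul, sub_mul, add_mul, add_mul, Real.cos_sub, Real.cos_add, sinFn, sinFn]
  linear_combination Real.sin (j * Real.pi * x) * Real.sin (k * Real.pi * x) * h2

theorem integral_cosFn_mul (j k : ℕ+) :
    ∫ x in Ioo (0 : ℝ) 1, cosFn j x * cosFn k x = if j = k then 1 else 0 := by
  rw [← integral_cos_mul j k 1]
  congr 1; funext x
  have h2 : Real.sqrt 2 * Real.sqrt 2 = 2 := Real.mul_self_sqrt (by norm_num)
  rw [sub_mul, sub_mul, add_mul, add_mul, Real.cos_sub, Real.cos_add, cosFn, cosFn]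
  linear_combination Real.cos (j * Real.pi * x) * Real.cos (k * Real.pi * x) * h2

theorem memLp_ofReal_of_continuous {h : ℝ → ℝ} (hh : Continuous h) :
    MemLp (fun x => (h x : ℂ)) 2 unitMeasure := by
  obtain ⟨C, hC⟩ := (isCompact_Icc (a := (0 : ℝ)) (b := 1)).exists_bound_of_continuousOn
    hh.continuousOn
  refine MemLp.of_bound (Continuous.aestronglyMeasurable (by fun_prop)) C ?_
  filter_upwards [ae_restrict_mem measurableSet_Ioo] with x hx
  rw [Complex.norm_real]
  exact hC x (Ioo_subset_Icc_self hx)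

/-- A continuous real function as an element of `L²((0,1), ℂ)`. -/
def ofCont (h : ℝ → ℝ) (hh : Continuous h) : L2 ℂ := (memLp_ofReal_of_continuous hh).toLp _

theorem coeFn_ofCont (h : ℝ → ℝ) (hh : Continuous h) :
    ofCont h hh =ᵐ[unitMeasure] fun x => (h x : ℂ) := MemLp.coeFn_toLp _

theorem inner_ofCont (h : ℝ → ℝ) (hh : Continuous h) (φ : L2 ℂ) :
    inner ℂ (ofCont h hh) φ = ∫ x in Ioo (0 : ℝ) 1, (h x : ℂ) * φ x := by
  rw [L2.inner_def]
  refine integral_congr_ae ?_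
  filter_upwards [coeFn_ofCont h hh] with x hx
  rw [hx, RCLike.inner_apply, Complex.conj_ofReal, mul_comm]

theorem inner_ofCont_ofCont (h h' : ℝ → ℝ) (hh : Continuous h) (hh' : Continuous h') :
    inner ℂ (ofCont h hh) (ofCont h' hh') = ((∫ x in Ioo (0 : ℝ) 1, h x * h' x : ℝ) : ℂ) := by
  rw [inner_ofCont, ← integral_complex_ofReal]
  refine integral_congr_ae ?_
  filter_upwards [coeFn_ofCont h' hh'] with x hx
  rw [hx]; push_cast; rfl

theorem eigenfunction_eq (k : ℕ+) : eigenfunction k = ofCont (sinFn k) (continuous_sinFn k) := rfl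

theorem coeff_eq_integral (k : ℕ+) (φ : L2 ℂ) :
    coeff k φ = ∫ x in Ioo (0 : ℝ) 1, (sinFn k x : ℂ) * φ x := by
  rw [coeff, eigenfunction_eq, inner_ofCont]

theorem orthonormal_eigenfunction : Orthonormal ℂ eigenfunction := by
  classical
  rw [orthonormal_iff_ite]
  intro j k
  rw [eigenfunction_eq, eigenfunction_eq, inner_ofCont_ofCont, integral_sinFn_mul]
  split_ifs <;> simp

/-- The element `√2 cos(kπx)` of `L²`. -/
def cosine (k : ℕ+) : L2 ℂ := ofCont (cosFn k) (continuous_cosFn k)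

theorem orthonormal_cosine : Orthonormal ℂ cosine := by
  classical
  rw [orthonormal_iff_ite]
  intro j k
  rw [cosine, cosine, inner_ofCont_ofCont, integral_cosFn_mul]
  split_ifs <;> simp

/-- The reflection `x ↦ -x` moves antisymmetrization from one factor to the other. With `e` an
exponential, the Fourier coefficients of an odd extension become sine integrals. -/
theorem integral_odd_extension {F : ℝ → ℂ} (hF : Integrable F) {e : ℝ → ℂ} (he : Continuous e)
    {C : ℝ} (hb : ∀ x, ‖e x‖ ≤ C) :
    ∫ x, e x * (F x - F (-x)) = ∫ x, (e x - e (-x)) * F x := by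
  have h1 : Integrable fun x => e x * F x :=
    hF.bdd_mul he.aestronglyMeasurable (Filter.Eventually.of_forall hb)
  have h2 : Integrable fun x => e (-x) * F x :=
    hF.bdd_mul (he.comp continuous_neg).aestronglyMeasurable
      (Filter.Eventually.of_forall fun x => hb (-x))
  have h3 : ∫ x, e (-x) * F x = ∫ x, e x * F (-x) := by
    rw [← integral_neg_eq_self]; simp
  have h4 : Integrable fun x => e x * F (-x) := by
    simpa using h2.comp_neg
  simp only [mul_sub, sub_mul]
  rw [integral_sub h1 h4, integral_sub h1 h2, h3]

/-- Completeness of the sines follows from that of the exponentials of period `2`: the odd extension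
of `φ` to `(-1,1)` has only sine coefficients, all of which vanish, so Parseval makes it zero. -/
theorem eq_zero_of_coeff_eq_zero (φ : L2 ℂ) (h : ∀ k, coeff k φ = 0) : φ = 0 := by
  set F : ℝ → ℂ := (Ioo (0 : ℝ) 1).indicator φ with hF
  have hFL : MemLp F 2 volume :=
    (memLp_indicator_iff_restrict measurableSet_Ioo).2 (Lp.memLp φ)
  have hFi : Integrable F :=
    (integrable_indicator_iff measurableSet_Ioo).2 ((Lp.memLp φ).integrable (by norm_num))
  have hGL : MemLp (fun x => F x - F (-x)) 2 volume :=
    hFL.sub (hFL.comp_measurePreserving (Measure.measurePreserving_neg volume))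
  have hlt : (-1 : ℝ) < 1 := by norm_num
  have hsin : ∀ n : ℤ, ∫ x, (Real.sin (n * Real.pi * x) : ℂ) * F x = 0 := by
    have key : ∀ k : ℕ+, ∫ x, (Real.sin (k * Real.pi * x) : ℂ) * F x = 0 := by
      intro k
      have h0 := h k
      rw [coeff_eq_integral] at h0
      have : ∀ x, (sinFn k x : ℂ) * φ x
          = (Real.sqrt 2 : ℂ) * ((Real.sin (k * Real.pi * x) : ℂ) * φ x) := by
        intro x; rw [sinFn]; push_cast; ring
      simp only [this] at h0
      rw [integral_const_mul] at h0
      have h1 := (mul_eq_zero.1 h0).resolve_left (by simp)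
      rw [← h1, ← integral_indicator measurableSet_Ioo]
      congr 1; funext x
      by_cases hx : x ∈ Ioo (0 : ℝ) 1 <;> simp [hF, hx]
    intro n
    rcases lt_trichotomy n 0 with hn | rfl | hn
    · have := key ⟨n.natAbs, by omega⟩
      have e : ((n.natAbs : ℕ) : ℝ) = -(n : ℝ) := by
        rw [Nat.cast_natAbs, abs_of_neg hn]; push_cast; ring
      simp only [PNat.mk_coe, e, neg_mul, Real.sin_neg, Complex.ofReal_neg] at this
      rwa [integral_neg, neg_eq_zero] at this
    · simp
    · have := key ⟨n.natAbs, by omega⟩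
      have e : ((n.natAbs : ℕ) : ℝ) = (n : ℝ) := by
        rw [Nat.cast_natAbs, abs_of_pos hn]
      simpa only [PNat.mk_coe, e] using this
  have hcoef : ∀ n : ℤ, fourierCoeffOn hlt (fun x => F x - F (-x)) n = 0 := by
    intro n
    rw [fourierCoeffOn_eq_integral]
    have hset : ∫ x in (-1 : ℝ)..1, fourier (-n) (x : AddCircle ((1 : ℝ) - -1)) • (F x - F (-x))
        = ∫ x : ℝ, Complex.exp (-(n * Real.pi * x * Complex.I)) * (F x - F (-x)) := by
      rw [intervalIntegral.integral_of_le hlt.le, ← integral_indicator measurableSet_Ioc]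
      congr 1; funext x
      by_cases hx : x ∈ Ioc (-1 : ℝ) 1
      · rw [indicator_of_mem hx, fourier_coe_apply, smul_eq_mul]
        congr 2; push_cast; ring
      · rw [indicator_of_notMem hx]
        have h1 : x ∉ Ioo (0 : ℝ) 1 := fun h => hx ⟨by linarith [h.1], h.2.le⟩
        have h2 : -x ∉ Ioo (0 : ℝ) 1 := fun h => hx ⟨by linarith [h.2], by linarith [h.1]⟩
        simp [hF, h1, h2]
    have hodd := integral_odd_extension hFi (e := fun x : ℝ => Complex.exp (-(n * Real.pi * x * Complex.I)))
      (by fun_prop) (C := 1) (fun x => by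
        rw [Complex.norm_exp]; simp)
    rw [hset, hodd]
    have : ∀ x : ℝ, (Complex.exp (-(n * Real.pi * x * Complex.I)) -
        Complex.exp (-(n * Real.pi * (-x : ℝ) * Complex.I))) * F x
        = (-2 * Complex.I) * ((Real.sin (n * Real.pi * x) : ℂ) * F x) := by
      intro x
      push_cast
      rw [Complex.sin]
      have e1 : -((n : ℂ) * Real.pi * x * Complex.I) = -(n * Real.pi * x) * Complex.I := by ring
      have e2 : -((n : ℂ) * Real.pi * -x * Complex.I) = (n * Real.pi * x) * Complex.I := by ring
      rw [e1, e2]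
      linear_combination ((Complex.exp (-(n * Real.pi * x) * Complex.I) -
        Complex.exp ((n * Real.pi * x) * Complex.I)) * F x) * Complex.I_sq
    simp only [this]
    rw [integral_const_mul, hsin, mul_zero, smul_zero]
  -- Parseval: the integral of the squared norm over `(-1,1)` is a sum of zeros.
  have hP := hasSum_sq_fourierCoeffOn hlt (hGL.restrict (Ioc (-1) 1))
  simp only [hcoef, norm_zero, ne_eq, OfNat.ofNat_ne_zero, not_false_eq_true, zero_pow] at hP
  have hint := hP.unique hasSum_zero
  rw [smul_eq_zero, or_iff_right (by norm_num), intervalIntegral.integral_of_le hlt.le,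
    setIntegral_eq_zero_iff_of_nonneg_ae (Filter.Eventually.of_forall fun x => by positivity)
      (memLp_two_iff_integrable_sq_norm (hGL.restrict (Ioc (-1) 1)).1 |>.1 (hGL.restrict (Ioc (-1) 1)))] at hint
  rw [Lp.eq_zero_iff_ae_eq_zero]
  have hsub : unitMeasure ≤ volume.restrict (Ioc (-1 : ℝ) 1) :=
    Measure.restrict_mono_set _ fun x hx => ⟨by linarith [hx.1], hx.2.le⟩
  filter_upwards [hint.filter_mono (ae_mono hsub), ae_restrict_mem measurableSet_Ioo] with x hx hx'
  have h2 : -x ∉ Ioo (0 : ℝ) 1 := fun h => by linarith [h.1, hx'.1]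
  simpa [hF, hx', h2] using hx

/-- The orthonormal basis `(φ_k)` of `L²((0,1), ℂ)`. -/
def sineBasis : HilbertBasis ℕ+ ℂ (L2 ℂ) :=
  HilbertBasis.mkOfOrthogonalEqBot orthonormal_eigenfunction (by
    rw [Submodule.eq_bot_iff]
    intro φ hφ
    refine eq_zero_of_coeff_eq_zero φ fun k => ?_
    exact hφ _ (Submodule.subset_span ⟨k, rfl⟩))

theorem coe_sineBasis : ⇑sineBasis = eigenfunction := HilbertBasis.coe_mkOfOrthogonalEqBot _ _

theorem sineBasis_repr_apply (φ : L2 ℂ) (k : ℕ+) : sineBasis.repr φ k = coeff k φ := by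
  rw [HilbertBasis.repr_apply_apply, coe_sineBasis, coeff]

/-! ### Square summable sequences and the unitary group -/

/-- Square summable sequences indexed by `k ≥ 1`. -/
abbrev Seq2 : Type := lp (fun _ : ℕ+ => ℂ) 2

theorem memℓp_two_iff {x : ℕ+ → ℂ} : Memℓp x 2 ↔ Summable fun k => ‖x k‖ ^ 2 := by
  rw [memℓp_gen_iff (by norm_num)]
  simp

theorem Seq2.summable_sq (x : Seq2) : Summable fun k => ‖x k‖ ^ 2 := memℓp_two_iff.1 x.2

theorem Seq2.norm_sq_eq (x : Seq2) : ‖x‖ ^ 2 = ∑' k, ‖x k‖ ^ 2 := by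
  have := lp.norm_rpow_eq_tsum (p := 2) (by norm_num) x
  simpa using this

/-- The phase `e^{-iλ_k t}`. -/
def phase (k : ℕ+) (t : ℝ) : ℂ := Complex.exp (-Complex.I * eigenvalue k * t)

theorem phase_eq (k : ℕ+) (t : ℝ) :
    phase k t = Complex.exp ((-(eigenvalue k * t) : ℝ) * Complex.I) := by
  rw [phase]; push_cast; ring_nf

@[simp] theorem norm_phase (k : ℕ+) (t : ℝ) : ‖phase k t‖ = 1 := by
  rw [phase_eq, Complex.norm_exp_ofReal_mul_I]

@[simp] theorem phase_zero (k : ℕ+) : phase k 0 = 1 := by simp [phase]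

theorem phase_add (k : ℕ+) (s t : ℝ) : phase k (s + t) = phase k s * phase k t := by
  rw [phase, phase, phase, ← Complex.exp_add]; push_cast; ring_nf

@[fun_prop] theorem continuous_phase (k : ℕ+) : Continuous (phase k) := by
  unfold phase; fun_prop

/-- Multiplication of the coefficients by the phases `e^{-iλ_k t}`. -/
def phaseMap (t : ℝ) : Seq2 →ₗᵢ[ℂ] Seq2 where
  toFun x := ⟨fun k => phase k t * x k, memℓp_two_iff.2 (by simpa using x.summable_sq)⟩
  map_add' x y := by ext k; simp [mul_add]; rfl
  map_smul' c x := by ext k; simp [mul_left_comm]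
  norm_map' x := by
    rw [← sq_eq_sq₀ (norm_nonneg _) (norm_nonneg _), Seq2.norm_sq_eq, Seq2.norm_sq_eq]
    simp

@[simp] theorem phaseMap_apply (t : ℝ) (x : Seq2) (k : ℕ+) :
    phaseMap t x k = phase k t * x k := rfl

theorem phaseMap_add (s t : ℝ) (x : Seq2) : phaseMap (s + t) x = phaseMap s (phaseMap t x) := by
  ext k; simp [phase_add, mul_assoc]

@[simp] theorem phaseMap_zero (x : Seq2) : phaseMap 0 x = x := by ext k; simp

theorem continuous_phaseMap_apply (x : Seq2) : Continuous fun t => phaseMap t x := by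
  rw [continuous_iff_continuousAt]
  intro s
  rw [ContinuousAt, tendsto_iff_norm_sub_tendsto_zero]
  have h : Filter.Tendsto (fun t => ‖phaseMap t x - phaseMap s x‖ ^ 2) (nhds s) (nhds 0) := by
    simp only [Seq2.norm_sq_eq]
    have h0 : ∑' k : ℕ+, ‖phase k s * x k - phase k s * x k‖ ^ 2 = 0 := by simp
    rw [← h0]
    -- The phases are not equicontinuous in `k`, so only strong continuity holds. Two unimodular
    -- phases differ by at most `2`, whence the dominating factor `4`.
    refine tendsto_tsum_of_dominated_convergence (bound := fun k => 4 * ‖x k‖ ^ 2)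
      (x.summable_sq.mul_left 4) (fun k => ?_) (Filter.Eventually.of_forall fun t k => ?_)
    · refine Continuous.tendsto (f := fun t => ‖phase k t * x k - phase k s * x k‖ ^ 2) ?_ s
      fun_prop
    · have h1 : ‖phase k t * x k - phase k s * x k‖ ≤ 2 * ‖x k‖ := by
        refine (norm_sub_le _ _).trans ?_
        simp only [norm_mul, norm_phase]; linarith
      have h2 := pow_le_pow_left₀ (norm_nonneg _) h1 2
      simp only [lp.coeFn_sub, Pi.sub_apply, phaseMap_apply, norm_pow, norm_norm]
      linarith
  have := h.sqrt
  simpa [Real.sqrt_sq (norm_nonneg _)] using this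

/-- Strong continuity in `t` becomes joint continuity because the maps are uniformly `1`-Lipschitz
in `x`. -/
theorem continuous_phaseMap : Continuous fun p : ℝ × Seq2 => phaseMap p.1 p.2 :=
  continuous_prod_of_continuous_lipschitzWith' _ 1 (fun t => (phaseMap t).lipschitz)
    continuous_phaseMap_apply

theorem group_eq (t : ℝ) (φ : L2 ℂ) :
    group t φ = sineBasis.repr.symm (phaseMap t (sineBasis.repr φ)) := by
  rw [group, ← (sineBasis.hasSum_repr_symm (phaseMap t (sineBasis.repr φ))).tsum_eq]
  simp only [phaseMap_apply, sineBasis_repr_apply, coe_sineBasis, phase, mul_comm]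

theorem repr_group (t : ℝ) (φ : L2 ℂ) :
    sineBasis.repr (group t φ) = phaseMap t (sineBasis.repr φ) := by
  rw [group_eq, LinearIsometryEquiv.apply_symm_apply]

theorem coeff_group (k : ℕ+) (t : ℝ) (φ : L2 ℂ) : coeff k (group t φ) = phase k t * coeff k φ := by
  rw [← sineBasis_repr_apply, repr_group, phaseMap_apply, sineBasis_repr_apply]

@[simp] theorem norm_group (t : ℝ) (φ : L2 ℂ) : ‖group t φ‖ = ‖φ‖ := by
  rw [group_eq, LinearIsometryEquiv.norm_map, LinearIsometry.norm_map,
    LinearIsometryEquiv.norm_map]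

theorem group_add (s t : ℝ) (φ : L2 ℂ) : group (s + t) φ = group s (group t φ) := by
  rw [group_eq, group_eq s, repr_group, phaseMap_add]

@[simp] theorem group_zero (φ : L2 ℂ) : group 0 φ = φ := by simp [group_eq]

/-- The group `e^{-iAt}` as a linear isometry. -/
def groupₗᵢ (t : ℝ) : L2 ℂ →ₗᵢ[ℂ] L2 ℂ :=
  sineBasis.repr.symm.toLinearIsometry.comp ((phaseMap t).comp sineBasis.repr.toLinearIsometry)

theorem groupₗᵢ_apply (t : ℝ) (φ : L2 ℂ) : groupₗᵢ t φ = group t φ := (group_eq t φ).symm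

theorem continuous_group : Continuous fun p : ℝ × L2 ℂ => group p.1 p.2 := by
  simp only [group_eq]
  exact sineBasis.repr.symm.continuous.comp (continuous_phaseMap.comp
    (continuous_fst.prodMk (sineBasis.repr.continuous.comp continuous_snd)))

theorem coeff_ext {φ φ' : L2 ℂ} (h : ∀ k, coeff k φ = coeff k φ') : φ = φ' := by
  refine sineBasis.repr.injective ?_
  ext k
  simpa [sineBasis_repr_apply] using h k

/-- The coefficient `⟨·, φ_k⟩` as a continuous linear form. -/
def coeffL (k : ℕ+) : L2 ℂ →L[ℂ] ℂ := innerSL ℂ (eigenfunction k)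

@[simp] theorem coeffL_apply (k : ℕ+) (φ : L2 ℂ) : coeffL k φ = coeff k φ := rfl

/-! ### The space `H^s_{(0)}` as a space of sequences -/

theorem H0.toL2_injective {s : ℕ} : Function.Injective (H0.toL2 (s := s)) :=
  fun _ _ h => Subtype.ext h

theorem H0.weighted_apply {s : ℕ} (φ : H0 s) (k : ℕ+) :
    H0.weighted s φ k = (k : ℂ) ^ s * coeff k φ.toL2 := rfl

theorem natCast_pnat_pow_ne_zero (k : ℕ+) (s : ℕ) : ((k : ℕ) : ℂ) ^ s ≠ 0 :=
  pow_ne_zero _ (by exact_mod_cast k.pos.ne')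

theorem H0.weighted_injective (s : ℕ) : Function.Injective (H0.weighted s) := by
  intro φ φ' h
  refine H0.toL2_injective (coeff_ext fun k => ?_)
  have := congrArg (fun x : Seq2 => x k) h
  simp only [H0.weighted_apply] at this
  exact mul_left_cancel₀ (natCast_pnat_pow_ne_zero k s) this

theorem one_le_norm_natCast_pnat_pow (k : ℕ+) (s : ℕ) : 1 ≤ ‖((k : ℕ) : ℂ) ^ s‖ := by
  rw [norm_pow, Complex.norm_natCast]
  exact one_le_pow₀ (by exact_mod_cast k.pos)

/-- Division of the coefficients by `k^s`. -/
def unweight (s : ℕ) (x : Seq2) : Seq2 :=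
  ⟨fun k => x k / (k : ℂ) ^ s, memℓp_two_iff.2 <| by
    refine Summable.of_nonneg_of_le (fun _ => by positivity) (fun k => ?_) x.summable_sq
    rw [norm_div]
    exact pow_le_pow_left₀ (by positivity)
      (div_le_self (norm_nonneg _) (one_le_norm_natCast_pnat_pow k s)) 2⟩

theorem coeff_symm_unweight (s : ℕ) (x : Seq2) (k : ℕ+) :
    coeff k (sineBasis.repr.symm (unweight s x)) = x k / (k : ℂ) ^ s := by
  rw [← sineBasis_repr_apply, LinearIsometryEquiv.apply_symm_apply]; rfl

theorem H0.weighted_surjective (s : ℕ) : Function.Surjective (H0.weighted s) := by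
  intro x
  have hx : ∀ k : ℕ+, (k : ℂ) ^ s * coeff k (sineBasis.repr.symm (unweight s x)) = x k := by
    intro k
    rw [coeff_symm_unweight, mul_div_cancel₀ _ (natCast_pnat_pow_ne_zero k s)]
  refine ⟨⟨sineBasis.repr.symm (unweight s x), ?_⟩, ?_⟩
  · change Memℓp (fun k : ℕ+ => (k : ℂ) ^ s * coeff k _) 2
    simp only [hx]
    exact x.2
  · ext k
    exact hx k

/-- `H^s_{(0)}` is isometric to the space of square summable sequences. -/
def weightedEquiv (s : ℕ) : H0 s ≃ₗᵢ[ℂ] Seq2 where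
  toLinearEquiv := LinearEquiv.ofBijective (H0.weighted s)
    ⟨H0.weighted_injective s, H0.weighted_surjective s⟩
  norm_map' _ := rfl

theorem weightedEquiv_apply (s : ℕ) (φ : H0 s) (k : ℕ+) :
    weightedEquiv s φ k = (k : ℂ) ^ s * coeff k φ.toL2 := rfl

theorem mul_coeff_weightedEquiv_symm (s : ℕ) (x : Seq2) (k : ℕ+) :
    (k : ℂ) ^ s * coeff k ((weightedEquiv s).symm x).toL2 = x k := by
  rw [← weightedEquiv_apply, LinearIsometryEquiv.apply_symm_apply]

/-- The inclusion into `L²`, on the level of weighted coefficients. -/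
def seqToL2 (s : ℕ) : Seq2 →L[ℂ] L2 ℂ :=
  LinearMap.mkContinuous
    { toFun := fun x => ((weightedEquiv s).symm x).toL2
      map_add' := fun x y => by rw [map_add]; rfl
      map_smul' := fun c x => by rw [map_smul]; rfl } 1 (by
    intro x
    change ‖((weightedEquiv s).symm x).toL2‖ ≤ 1 * ‖x‖
    rw [one_mul, ← sineBasis.repr.norm_map,
      ← sq_le_sq₀ (norm_nonneg _) (norm_nonneg _), Seq2.norm_sq_eq, Seq2.norm_sq_eq]
    refine Summable.tsum_le_tsum (fun k => ?_) (Seq2.summable_sq _) (Seq2.summable_sq _)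
    rw [sineBasis_repr_apply, ← mul_coeff_weightedEquiv_symm s x k, norm_mul]
    exact pow_le_pow_left₀ (norm_nonneg _)
      (le_mul_of_one_le_left (norm_nonneg _) (one_le_norm_natCast_pnat_pow k s)) 2)

theorem seqToL2_apply (s : ℕ) (x : Seq2) : seqToL2 s x = ((weightedEquiv s).symm x).toL2 := rfl

theorem mul_coeff_seqToL2 (s : ℕ) (x : Seq2) (k : ℕ+) :
    (k : ℂ) ^ s * coeff k (seqToL2 s x) = x k := mul_coeff_weightedEquiv_symm s x k

theorem seqToL2_weightedEquiv (s : ℕ) (φ : H0 s) : seqToL2 s (weightedEquiv s φ) = φ.toL2 := by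
  rw [seqToL2_apply, LinearIsometryEquiv.symm_apply_apply]

/-- Synthesis with an absolutely square summable family. -/
theorem exists_clm_single {V : Type*} [NormedAddCommGroup V] [NormedSpace ℂ V] [CompleteSpace V]
    {v : ℕ+ → V} (hv : Summable fun k => ‖v k‖ ^ 2) :
    ∃ L : Seq2 →L[ℂ] V, ∀ j, L (lp.single 2 j 1) = v j := by
  -- Cauchy–Schwarz between `(x k)` and `(‖v k‖)`; no orthogonality of the `v k` is needed.
  have hs : ∀ x : Seq2, Summable fun k => ‖x k • v k‖ := fun x => by
    simp only [norm_smul]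
    exact (Real.summable_mul_of_Lp_Lq_of_nonneg (p := 2) (q := 2)
      (by rw [Real.holderConjugate_iff]; norm_num) (fun k => norm_nonneg _)
      (fun k => norm_nonneg _) (by simpa using x.summable_sq) (by simpa using hv))
  have hb : ∀ x : Seq2, ∑' k, ‖x k • v k‖ ≤ Real.sqrt (∑' k, ‖v k‖ ^ 2) * ‖x‖ := fun x => by
    simp only [norm_smul]
    have := Real.inner_le_Lp_mul_Lq_tsum_of_nonneg (p := 2) (q := 2)
      (by rw [Real.holderConjugate_iff]; norm_num) (f := fun k => ‖x k‖) (g := fun k => ‖v k‖)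
      (fun k => norm_nonneg _)
      (fun k => norm_nonneg _) (by simpa using x.summable_sq) (by simpa using hv)
    refine this.trans_eq ?_
    simp only [Real.rpow_two, ← Real.sqrt_eq_rpow]
    rw [← Seq2.norm_sq_eq, Real.sqrt_sq (norm_nonneg _), mul_comm]
  refine ⟨LinearMap.mkContinuous
    { toFun := fun x => ∑' k, x k • v k
      map_add' := fun x y => ?_
      map_smul' := fun c x => ?_ } (Real.sqrt (∑' k, ‖v k‖ ^ 2)) fun x => ?_, fun j => ?_⟩
  · rw [← (hs x).of_norm.tsum_add (hs y).of_norm]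
    simp [add_smul]
  · simp [mul_smul, (hs x).of_norm.tsum_const_smul]
  · exact (norm_tsum_le_tsum_norm (hs x)).trans (hb x)
  · change ∑' k, (lp.single (E := fun _ : ℕ+ => ℂ) 2 j (1 : ℂ)) k • v k = v j
    rw [tsum_eq_single j]
    · simp
    · intro k hk
      simp [lp.single_apply, hk]

/-- Continuous linear maps on sequences are determined by their values at the unit vectors. -/
theorem clm_ext_single {V : Type*} [NormedAddCommGroup V] [NormedSpace ℂ V]
    {L L' : Seq2 →L[ℂ] V} (h : ∀ j, L (lp.single 2 j 1) = L' (lp.single 2 j 1)) : L = L' := by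
  ext x
  have hx := lp.hasSum_single (p := 2) (by norm_num) x
  have h1 := hx.mapL L
  have h2 := hx.mapL L'
  have : ∀ j, L (lp.single 2 j (x j)) = L' (lp.single 2 j (x j)) := by
    intro j
    have e : lp.single (E := fun _ : ℕ+ => ℂ) 2 j (x j)
        = x j • lp.single (E := fun _ : ℕ+ => ℂ) 2 j 1 := by
      rw [← lp.single_smul]; simp
    rw [e, map_smul, map_smul, h j]
  simp only [this] at h1
  exact h1.unique h2

/-! ### Weak derivatives and boundary values -/

/-- `g` is the weak derivative of `f` on `(0,1)` and `a`, `b` are the boundary values of `f` at `0`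
and `1`, expressed through integration by parts against all smooth functions. -/
def HasTrace (f g : ℝ → ℂ) (a b : ℂ) : Prop :=
  ∀ θ : ℝ → ℝ, ContDiff ℝ ∞ θ →
    ∫ x in Ioo (0 : ℝ) 1, ((θ x : ℂ) * g x + ((deriv θ x : ℝ) : ℂ) * f x) = θ 1 * b - θ 0 * a

theorem integrable_ofReal_mul {θ : ℝ → ℝ} (hθ : Continuous θ) {f : ℝ → ℂ}
    (hf : Integrable f unitMeasure) : Integrable (fun x => (θ x : ℂ) * f x) unitMeasure := by
  obtain ⟨C, hC⟩ := (isCompact_Icc (a := (0 : ℝ)) (b := 1)).exists_bound_of_continuousOn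
    hθ.continuousOn
  refine hf.bdd_mul (c := C) (Continuous.aestronglyMeasurable (by fun_prop)) ?_
  filter_upwards [ae_restrict_mem measurableSet_Ioo] with x hx
  rw [Complex.norm_real]
  exact hC x (Ioo_subset_Icc_self hx)

theorem contDiff_deriv {θ : ℝ → ℝ} (hθ : ContDiff ℝ ∞ θ) : ContDiff ℝ ∞ (deriv θ) :=
  (contDiff_infty_iff_deriv.1 hθ).2

theorem continuous_deriv_of_smooth {θ : ℝ → ℝ} (hθ : ContDiff ℝ ∞ θ) : Continuous (deriv θ) :=
  (contDiff_deriv hθ).continuous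

theorem differentiable_of_smooth {θ : ℝ → ℝ} (hθ : ContDiff ℝ ∞ θ) : Differentiable ℝ θ :=
  (contDiff_infty_iff_deriv.1 hθ).1

theorem integrable_trace {f g : ℝ → ℂ} (hf : Integrable f unitMeasure)
    (hg : Integrable g unitMeasure) {θ : ℝ → ℝ} (hθ : ContDiff ℝ ∞ θ) :
    Integrable (fun x => (θ x : ℂ) * g x + ((deriv θ x : ℝ) : ℂ) * f x) unitMeasure :=
  (integrable_ofReal_mul hθ.continuous hg).add
    (integrable_ofReal_mul (continuous_deriv_of_smooth hθ) hf)

theorem HasTrace.congr_ae {f f' g g' : ℝ → ℂ} {a b : ℂ} (h : HasTrace f g a b)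
    (hf : f =ᵐ[unitMeasure] f') (hg : g =ᵐ[unitMeasure] g') : HasTrace f' g' a b := by
  intro θ hθ
  rw [← h θ hθ]
  refine integral_congr_ae ?_
  filter_upwards [hf, hg] with x h1 h2
  rw [h1, h2]

/-- Leibniz rule for the product with a smooth function. -/
theorem HasTrace.smooth_mul {f g : ℝ → ℂ} {a b : ℂ} (h : HasTrace f g a b) {p : ℝ → ℝ}
    (hp : ContDiff ℝ ∞ p) :
    HasTrace (fun x => (p x : ℂ) * f x) (fun x => (p x : ℂ) * g x + ((deriv p x : ℝ) : ℂ) * f x)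
      (p 0 * a) (p 1 * b) := by
  intro θ hθ
  have h1 := h (fun x => θ x * p x) (hθ.mul hp)
  have e : ((θ 1 : ℝ) : ℂ) * (p 1 * b) - θ 0 * (p 0 * a)
      = ((θ 1 * p 1 : ℝ) : ℂ) * b - ((θ 0 * p 0 : ℝ) : ℂ) * a := by push_cast; ring
  rw [e, ← h1]
  congr 1; funext x
  have hd : deriv (fun x => θ x * p x) x = deriv θ x * p x + θ x * deriv p x :=
    deriv_fun_mul (differentiable_of_smooth hθ x) (differentiable_of_smooth hp x)
  rw [hd]; push_cast; ring

/-- Each of the test functions `1 - x` and `x` sees only one endpoint. This makes the boundary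
values functions of `(f, g)`, continuous in `L²`. -/
theorem HasTrace.left_eq {f g : ℝ → ℂ} {a b : ℂ} (h : HasTrace f g a b) :
    ∫ x in Ioo (0 : ℝ) 1, (((1 - x : ℝ) : ℂ) * g x - f x) = -a := by
  have := h (fun x => 1 - x) (by fun_prop)
  have hd : deriv (fun x : ℝ => 1 - x) = fun _ => -1 := by
    funext x; simp
  simpa [hd, sub_eq_add_neg] using this

theorem HasTrace.right_eq {f g : ℝ → ℂ} {a b : ℂ} (h : HasTrace f g a b) :
    ∫ x in Ioo (0 : ℝ) 1, ((x : ℂ) * g x + f x) = b := by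
  have := h (fun x => x) (by fun_prop)
  simpa using this

/-- The derivative of a cutoff at scale `1/n` has size `n`. With `y = nx - 1` this bound reads `|n
S'(nx - 1)| |x| ≤ D`, where `S` is the transition function: the factor `n` is absorbed by the
distance to the boundary. -/
theorem deriv_smoothTransition_mul_le :
    ∃ D : ℝ, ∀ y, |deriv Real.smoothTransition y| * |y + 1| ≤ D := by
  have hc : Continuous (deriv Real.smoothTransition) :=
    continuous_deriv_of_smooth Real.smoothTransition.contDiff
  obtain ⟨D, hD⟩ := (isCompact_Icc (a := (0 : ℝ)) (b := 1)).exists_bound_of_continuousOn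
    hc.continuousOn
  have hD0 : 0 ≤ D := (norm_nonneg _).trans (hD 0 (by simp))
  refine ⟨D * 2, fun y => ?_⟩
  rcases lt_or_ge y 0 with hy | hy
  · have : Real.smoothTransition =ᶠ[nhds y] fun _ => 0 := by
      filter_upwards [Iio_mem_nhds hy] with z hz
      exact Real.smoothTransition.zero_of_nonpos (le_of_lt hz)
    rw [this.deriv_eq]; simp [hD0]
  rcases lt_or_ge 1 y with hy1 | hy1
  · have : Real.smoothTransition =ᶠ[nhds y] fun _ => 1 := by
      filter_upwards [Ioi_mem_nhds hy1] with z hz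
      exact Real.smoothTransition.one_of_one_le (le_of_lt hz)
    rw [this.deriv_eq]; simp [hD0]
  · have h1 := hD y ⟨hy, hy1⟩
    rw [Real.norm_eq_abs] at h1
    refine mul_le_mul h1 ?_ (abs_nonneg _) hD0
    rw [abs_le]; constructor <;> linarith

/-- A smooth cutoff, equal to `1` on `[2/n, 1-2/n]` and to `0` outside `[1/n, 1-1/n]`. -/
def cutoff (n : ℝ) (x : ℝ) : ℝ :=
  Real.smoothTransition (n * x - 1) * Real.smoothTransition (n * (1 - x) - 1)

theorem contDiff_cutoff (n : ℝ) : ContDiff ℝ ∞ (cutoff n) := by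
  have h : ContDiff ℝ ∞ Real.smoothTransition := Real.smoothTransition.contDiff
  exact (h.comp (by fun_prop : ContDiff ℝ ∞ fun x : ℝ => n * x - 1)).mul
    (h.comp (by fun_prop : ContDiff ℝ ∞ fun x : ℝ => n * (1 - x) - 1))

theorem abs_cutoff_le (n x : ℝ) : |cutoff n x| ≤ 1 := by
  rw [cutoff, abs_of_nonneg (mul_nonneg (Real.smoothTransition.nonneg _)
    (Real.smoothTransition.nonneg _))]
  exact mul_le_one₀ (Real.smoothTransition.le_one _) (Real.smoothTransition.nonneg _)
    (Real.smoothTransition.le_one _)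

theorem hasDerivAt_cutoff (n x : ℝ) : HasDerivAt (cutoff n)
    (deriv Real.smoothTransition (n * x - 1) * n * Real.smoothTransition (n * (1 - x) - 1) +
      Real.smoothTransition (n * x - 1) *
        (deriv Real.smoothTransition (n * (1 - x) - 1) * (-n))) x := by
  have hS : ∀ y, HasDerivAt Real.smoothTransition (deriv Real.smoothTransition y) y := fun y =>
    (differentiable_of_smooth Real.smoothTransition.contDiff y).hasDerivAt
  have h1 : HasDerivAt (fun x : ℝ => n * x - 1) n x := by
    simpa using ((hasDerivAt_id x).const_mul n).sub_const 1
  have h2 : HasDerivAt (fun x : ℝ => n * (1 - x) - 1) (-n) x := by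
    simpa using (((hasDerivAt_id x).const_sub 1).const_mul n).sub_const 1
  exact ((hS _).comp x h1).mul ((hS _).comp x h2)

theorem cutoff_eventuallyEq_one {x : ℝ} (hx : x ∈ Ioo (0 : ℝ) 1) :
    ∀ᶠ n : ℕ in Filter.atTop, cutoff ((n : ℝ) + 1) =ᶠ[nhds x] fun _ => 1 := by
  set δ := min x (1 - x) with hδ
  have hδ0 : 0 < δ := lt_min hx.1 (by linarith [hx.2])
  -- Points within `δ/2` of `x` are at distance at least `δ/2` from the boundary; multiplied by `n +
  -- 1 > 4/δ` this exceeds `2`, where both transitions equal `1`.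
  obtain ⟨N, hN⟩ := exists_nat_gt (4 / δ)
  filter_upwards [Filter.eventually_ge_atTop N] with n hn
  have hn' : 4 / δ < (n : ℝ) + 1 := by
    have : (N : ℝ) ≤ n := by exact_mod_cast hn
    linarith
  rw [div_lt_iff₀ hδ0] at hn'
  have hx1 : δ ≤ x := min_le_left _ _
  have hx2 : δ ≤ 1 - x := min_le_right _ _
  have hp : (0 : ℝ) < (n : ℝ) + 1 := by positivity
  filter_upwards [Ioo_mem_nhds (show x - δ / 2 < x by linarith) (show x < x + δ / 2 by linarith)]
    with z hz
  rw [cutoff, Real.smoothTransition.one_of_one_le, Real.smoothTransition.one_of_one_le, mul_one]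
  · nlinarith [mul_le_mul_of_nonneg_left (show δ / 2 ≤ 1 - z by linarith [hz.2]) hp.le]
  · nlinarith [mul_le_mul_of_nonneg_left (show δ / 2 ≤ z by linarith [hz.1]) hp.le]

theorem isTest_cutoff_mul {n : ℝ} (hn : 0 < n) {θ : ℝ → ℝ} (hθ : ContDiff ℝ ∞ θ) :
    IsTest fun x => cutoff n x * θ x := by
  have hsupp : Function.support (fun x => cutoff n x * θ x) ⊆ Icc (1 / n) (1 - 1 / n) := by
    intro x hx
    by_contra hx'
    refine hx ?_
    rw [mem_Icc, not_and_or, not_le, not_le] at hx'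
    have : cutoff n x = 0 := by
      rw [cutoff]
      rcases hx' with h | h
      · rw [Real.smoothTransition.zero_of_nonpos, zero_mul]
        rw [lt_div_iff₀ hn] at h; linarith
      · rw [Real.smoothTransition.zero_of_nonpos (x := n * (1 - x) - 1), mul_zero]
        have : 1 - x < 1 / n := by linarith
        rw [lt_div_iff₀ hn] at this; linarith
    simp [this]
  refine ⟨(contDiff_cutoff n).mul hθ, HasCompactSupport.of_support_subset_isCompact isCompact_Icc
    hsupp, (closure_minimal hsupp isClosed_Icc).trans ?_⟩
  intro x hx
  have : 0 < 1 / n := by positivity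
  exact ⟨by linarith [hx.1], by linarith [hx.2]⟩

theorem exists_abs_le_of_eq_zero {θ : ℝ → ℝ} (hθ : ContDiff ℝ ∞ θ) (h0 : θ 0 = 0) (h1 : θ 1 = 0) :
    ∃ C : ℝ, 0 ≤ C ∧ ∀ x ∈ Icc (0 : ℝ) 1, |θ x| ≤ C * |x| ∧ |θ x| ≤ C * |1 - x| ∧
      |deriv θ x| ≤ C := by
  obtain ⟨C, hC⟩ := (isCompact_Icc (a := (0 : ℝ)) (b := 1)).exists_bound_of_continuousOn
    (continuous_deriv_of_smooth hθ).continuousOn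
  have hmv : ∀ x ∈ Icc (0 : ℝ) 1, ∀ y ∈ Icc (0 : ℝ) 1, ‖θ y - θ x‖ ≤ C * ‖y - x‖ :=
    fun x hx y hy => (convex_Icc (0 : ℝ) 1).norm_image_sub_le_of_norm_deriv_le
      (fun z _ => differentiable_of_smooth hθ z) hC hx hy
  refine ⟨C, (norm_nonneg _).trans (hC 0 (by simp)), fun x hx => ⟨?_, ?_, hC x hx⟩⟩
  · simpa [h0] using hmv 0 (by simp) x hx
  · simpa [h1] using hmv x hx 1 (by simp)

/-- The weak derivative identity extends from compactly supported `η` to `θ` vanishing at the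
endpoints only. Test with `cutoff n · θ`: since `|θ|` is at most `C` times the distance to either
endpoint, `(cutoff n)' θ` stays bounded uniformly in `n`, and it tends to `0` pointwise. Dominated
convergence concludes. -/
theorem integral_trace_eq_zero {f g : ℝ → ℂ} (hf : Integrable f unitMeasure)
    (hg : Integrable g unitMeasure)
    (h : ∀ η : ℝ → ℝ, IsTest η →
      ∫ x in Ioo (0 : ℝ) 1, ((η x : ℂ) * g x + ((deriv η x : ℝ) : ℂ) * f x) = 0)
    {θ : ℝ → ℝ} (hθ : ContDiff ℝ ∞ θ) (h0 : θ 0 = 0) (h1 : θ 1 = 0) :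
    ∫ x in Ioo (0 : ℝ) 1, ((θ x : ℂ) * g x + ((deriv θ x : ℝ) : ℂ) * f x) = 0 := by
  obtain ⟨D, hD⟩ := deriv_smoothTransition_mul_le
  obtain ⟨C, hC0, hC⟩ := exists_abs_le_of_eq_zero hθ h0 h1
  have hder : ∀ (n : ℝ) (x : ℝ), deriv (fun x => cutoff n x * θ x) x
      = deriv (cutoff n) x * θ x + cutoff n x * deriv θ x := fun n x =>
    deriv_fun_mul (differentiable_of_smooth (contDiff_cutoff n) x) (differentiable_of_smooth hθ x)
  have hlim : Filter.Tendsto (fun n : ℕ => ∫ x in Ioo (0 : ℝ) 1,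
      (((cutoff ((n : ℝ) + 1) x * θ x : ℝ) : ℂ) * g x +
        ((deriv (fun x => cutoff ((n : ℝ) + 1) x * θ x) x : ℝ) : ℂ) * f x)) Filter.atTop
      (nhds (∫ x in Ioo (0 : ℝ) 1, ((θ x : ℂ) * g x + ((deriv θ x : ℝ) : ℂ) * f x))) := by
    refine tendsto_integral_of_dominated_convergence
      (fun x => C * ‖g x‖ + (2 * (D * C) + C) * ‖f x‖) (fun n => ?_) ?_ (fun n => ?_) ?_
    · exact (integrable_trace hf hg ((contDiff_cutoff _).mul hθ)).1
    · exact (hg.norm.const_mul _).add (hf.norm.const_mul _)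
    · filter_upwards [ae_restrict_mem measurableSet_Ioo] with x hx
      obtain ⟨b1, b2, b3⟩ := hC x (Ioo_subset_Icc_self hx)
      have hx1 : |x| ≤ 1 := abs_le.2 ⟨by linarith [hx.1], hx.2.le⟩
      set N : ℝ := (n : ℝ) + 1 with hN
      have hN0 : 0 < N := by positivity
      have hcut := abs_cutoff_le N x
      have e1 : |deriv Real.smoothTransition (N * x - 1) * N| * |θ x| ≤ D * C := by
        have h1 := hD (N * x - 1)
        rw [sub_add_cancel] at h1
        calc |deriv Real.smoothTransition (N * x - 1) * N| * |θ x|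
            ≤ |deriv Real.smoothTransition (N * x - 1) * N| * (C * |x|) := by gcongr
          _ = |deriv Real.smoothTransition (N * x - 1)| * |N * x| * C := by
              rw [abs_mul, abs_mul]; ring
          _ ≤ D * C := by gcongr
      have e2 : |deriv Real.smoothTransition (N * (1 - x) - 1) * (-N)| * |θ x| ≤ D * C := by
        have h1 := hD (N * (1 - x) - 1)
        rw [sub_add_cancel] at h1
        calc |deriv Real.smoothTransition (N * (1 - x) - 1) * (-N)| * |θ x|
            ≤ |deriv Real.smoothTransition (N * (1 - x) - 1) * (-N)| * (C * |1 - x|) := by gcongr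
          _ = |deriv Real.smoothTransition (N * (1 - x) - 1)| * |N * (1 - x)| * C := by
              rw [abs_mul, abs_mul, abs_neg]; ring
          _ ≤ D * C := by gcongr
      have hS : ∀ y, |Real.smoothTransition y| ≤ 1 := fun y => by
        rw [abs_of_nonneg (Real.smoothTransition.nonneg _)]
        exact Real.smoothTransition.le_one _
      have e3 : |deriv (cutoff N) x * θ x| ≤ 2 * (D * C) := by
        rw [(hasDerivAt_cutoff N x).deriv, add_mul]
        refine (abs_add_le _ _).trans ?_
        rw [two_mul]
        refine add_le_add ?_ ?_
        · rw [abs_mul, abs_mul]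
          calc _ = |deriv Real.smoothTransition (N * x - 1) * N| * |θ x| *
                |Real.smoothTransition (N * (1 - x) - 1)| := by ring
            _ ≤ |deriv Real.smoothTransition (N * x - 1) * N| * |θ x| * 1 := by
                gcongr; exact hS _
            _ ≤ D * C := by rw [mul_one]; exact e1
        · rw [abs_mul, abs_mul]
          calc _ = |deriv Real.smoothTransition (N * (1 - x) - 1) * (-N)| * |θ x| *
                |Real.smoothTransition (N * x - 1)| := by ring
            _ ≤ |deriv Real.smoothTransition (N * (1 - x) - 1) * (-N)| * |θ x| * 1 := by
                gcongr; exact hS _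
            _ ≤ D * C := by rw [mul_one]; exact e2
      refine (norm_add_le _ _).trans ?_
      rw [norm_mul, norm_mul, Complex.norm_real, Complex.norm_real, Real.norm_eq_abs,
        Real.norm_eq_abs, hder]
      have e4 : |cutoff N x * θ x| ≤ C := by
        rw [abs_mul]
        calc |cutoff N x| * |θ x| ≤ 1 * (C * 1) := by
              refine mul_le_mul hcut (b1.trans (by gcongr)) (abs_nonneg _) zero_le_one
          _ = C := by ring
      have e5 : |cutoff N x * deriv θ x| ≤ C := by
        rw [abs_mul]
        calc |cutoff N x| * |deriv θ x| ≤ 1 * C := by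
              refine mul_le_mul hcut b3 (abs_nonneg _) zero_le_one
          _ = C := by ring
      gcongr
      exact (abs_add_le _ _).trans (add_le_add e3 e5)
    · filter_upwards [ae_restrict_mem measurableSet_Ioo] with x hx
      refine tendsto_const_nhds.congr' ?_
      filter_upwards [cutoff_eventuallyEq_one hx] with n hn
      rw [hder, hn.deriv_eq, hn.self_of_nhds]
      simp
  refine tendsto_nhds_unique hlim ?_
  have : ∀ n : ℕ, ∫ x in Ioo (0 : ℝ) 1, (((cutoff ((n : ℝ) + 1) x * θ x : ℝ) : ℂ) * g x +
        ((deriv (fun x => cutoff ((n : ℝ) + 1) x * θ x) x : ℝ) : ℂ) * f x) = 0 := fun n =>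
    h _ (isTest_cutoff_mul (by positivity) hθ)
  simp only [this]
  exact tendsto_const_nhds

/-- A function with an integrable weak derivative has boundary values. -/
theorem exists_hasTrace {f g : ℝ → ℂ} (hf : Integrable f unitMeasure)
    (hg : Integrable g unitMeasure)
    (h : ∀ η : ℝ → ℝ, IsTest η →
      ∫ x in Ioo (0 : ℝ) 1, ((η x : ℂ) * g x + ((deriv η x : ℝ) : ℂ) * f x) = 0) :
    ∃ a b, HasTrace f g a b := by
  -- The boundary values are forced by the tests `1 - x` and `x`. A general `θ` minus its affine
  -- interpolant vanishes at both ends, where the previous lemma applies.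
  refine ⟨-∫ x in Ioo (0 : ℝ) 1, (((1 - x : ℝ) : ℂ) * g x - f x),
    ∫ x in Ioo (0 : ℝ) 1, ((x : ℂ) * g x + f x), fun θ hθ => ?_⟩
  have hz := integral_trace_eq_zero hf hg h
    (θ := fun x => θ x - (θ 0 * (1 - x) + θ 1 * x)) (hθ.sub (by fun_prop)) (by simp) (by simp)
  have hd : ∀ x, deriv (fun x => θ x - (θ 0 * (1 - x) + θ 1 * x)) x
      = deriv θ x - (-θ 0 + θ 1) := by
    intro x
    have h1 : HasDerivAt (fun x : ℝ => θ 0 * (1 - x) + θ 1 * x) (-θ 0 + θ 1) x := by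
      simpa using (((hasDerivAt_id x).const_sub 1).const_mul (θ 0)).fun_add
        ((hasDerivAt_id x).const_mul (θ 1))
    exact ((differentiable_of_smooth hθ x).hasDerivAt.sub h1).deriv
  simp only [hd] at hz
  have i1 : Integrable (fun x : ℝ => (((1 - x : ℝ) : ℂ) * g x - f x)) unitMeasure :=
    (integrable_ofReal_mul (θ := fun x => 1 - x) (by fun_prop) hg).sub hf
  have i2 : Integrable (fun x : ℝ => ((x : ℂ) * g x + f x)) unitMeasure :=
    (integrable_ofReal_mul (θ := fun x => x) (by fun_prop) hg).add hf
  have i3 : Integrable (fun x : ℝ => (θ 1 : ℂ) * ((x : ℂ) * g x + f x) +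
      (θ 0 : ℂ) * (((1 - x : ℝ) : ℂ) * g x - f x)) unitMeasure :=
    (i2.const_mul _).add (i1.const_mul _)
  rw [mul_neg, sub_neg_eq_add, ← integral_const_mul, ← integral_const_mul,
    ← integral_add (i2.const_mul _) (i1.const_mul _), ← sub_eq_zero,
    ← integral_sub (integrable_trace hf hg hθ) i3, ← hz]
  congr 1; funext x
  push_cast; ring

theorem setIntegral_eq_integral_of_tsupport {η : ℝ → ℝ} (hη : tsupport η ⊆ Ioo (0 : ℝ) 1)
    (h : ℝ → ℂ) : ∫ x in Ioo (0 : ℝ) 1, η x • h x = ∫ x, η x • h x := by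
  refine setIntegral_eq_integral_of_forall_compl_eq_zero fun x hx => ?_
  rw [image_eq_zero_of_notMem_tsupport fun h' => hx (hη h'), zero_smul]

theorem ae_eq_zero_of_forall_isTest {h : ℝ → ℂ} (hh : Integrable h unitMeasure)
    (hz : ∀ η : ℝ → ℝ, IsTest η → ∫ x in Ioo (0 : ℝ) 1, (η x : ℂ) * h x = 0) :
    h =ᵐ[unitMeasure] 0 := by
  have := isOpen_Ioo.ae_eq_zero_of_integral_contDiff_smul_eq_zero (μ := volume)
    (U := Ioo (0 : ℝ) 1) (f := h) (IntegrableOn.locallyIntegrableOn hh) (fun η h1 h2 h3 => by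
      rw [← setIntegral_eq_integral_of_tsupport h3]
      simpa only [Complex.real_smul] using hz η ⟨h1, h2, h3⟩)
  rw [Filter.EventuallyEq, ae_restrict_iff' measurableSet_Ioo]
  exact this

/-! ### Primitives, and boundedness of functions with an integrable weak derivative -/

theorem exists_smooth_primitive {η : ℝ → ℝ} (hη : ContDiff ℝ ∞ η) :
    ∃ θ : ℝ → ℝ, ContDiff ℝ ∞ θ ∧ deriv θ = η := by
  have hd : ∀ x, HasDerivAt (fun x => ∫ y in (0 : ℝ)..x, η y) (η x) x := fun x =>
    intervalIntegral.integral_hasDerivAt_right (hη.continuous.intervalIntegrable _ _)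
      (hη.continuous.stronglyMeasurableAtFilter _ _) hη.continuous.continuousAt
  have hd' : deriv (fun x => ∫ y in (0 : ℝ)..x, η y) = η := funext fun x => (hd x).deriv
  refine ⟨_, contDiff_infty_iff_deriv.2 ⟨fun x => (hd x).differentiableAt, ?_⟩, hd'⟩
  rw [hd']; exact hη

/-- Integration by parts for the primitive of an integrable function. -/
theorem integral_smooth_mul_eq {m : ℝ → ℝ} (hm : Integrable m unitMeasure) {θ : ℝ → ℝ}
    (hθ : ContDiff ℝ ∞ θ) :
    ∫ x in Ioo (0 : ℝ) 1, θ x * m x = θ 1 * (∫ y in (0 : ℝ)..1, m y) -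
      ∫ x in Ioo (0 : ℝ) 1, deriv θ x * ∫ y in (0 : ℝ)..x, m y := by
  have hmi : IntervalIntegrable m volume 0 1 := by
    rw [intervalIntegrable_iff_integrableOn_Ioo_of_le zero_le_one]; exact hm
  have hac := hmi.absolutelyContinuousOnInterval_intervalIntegral (c := 0) (by simp)
  have hθac : AbsolutelyContinuousOnInterval θ 0 1 :=
    ContDiffOn.absolutelyContinuousOnInterval ((hθ.of_le (by simp)).contDiffOn)
  have hibp := hθac.integral_mul_deriv_eq_deriv_mul hac
  have hde := hmi.ae_hasDerivAt_integral
  have hconv : ∀ h : ℝ → ℝ, ∫ x in Ioo (0 : ℝ) 1, h x = ∫ x in (0 : ℝ)..1, h x := fun h => by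
    rw [intervalIntegral.integral_of_le zero_le_one, integral_Ioc_eq_integral_Ioo]
  simp only [intervalIntegral.integral_same, mul_zero, sub_zero] at hibp
  rw [hconv fun x => deriv θ x * ∫ y in (0 : ℝ)..x, m y, ← hibp, ← hconv]
  refine integral_congr_ae ?_
  filter_upwards [ae_restrict_of_ae hde, ae_restrict_mem measurableSet_Ioo] with x hx hx'
  rw [(hx (by rw [uIcc_of_le zero_le_one]; exact Ioo_subset_Icc_self hx') 0 (by simp)).deriv]

/-- A real function with an integrable weak derivative is bounded. -/
theorem exists_bound_of_hasTrace {m m' : ℝ → ℝ} (hm : Integrable m unitMeasure)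
    (hm' : Integrable m' unitMeasure) {a b : ℂ}
    (h : HasTrace (fun x => (m x : ℂ)) (fun x => (m' x : ℂ)) a b) :
    ∃ C : ℝ, ∀ᵐ x ∂unitMeasure, |m x| ≤ C := by
  have hmi : IntervalIntegrable m' volume 0 1 := by
    rw [intervalIntegrable_iff_integrableOn_Ioo_of_le zero_le_one]; exact hm'
  have hmi' : IntegrableOn m' (uIcc 0 1) := by
    rw [uIcc_of_le zero_le_one, integrableOn_Icc_iff_integrableOn_Ioo]; exact hm'
  set G : ℝ → ℝ := fun x => ∫ y in (0 : ℝ)..x, m' y with hG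
  have hGc : ContinuousOn G (Icc 0 1) := by
    have := intervalIntegral.continuousOn_primitive_interval hmi'
    rwa [uIcc_of_le zero_le_one] at this
  have hGi : Integrable G unitMeasure :=
    (hGc.integrableOn_Icc).mono_set Ioo_subset_Icc_self
  have hreal : ∀ θ : ℝ → ℝ, ContDiff ℝ ∞ θ →
      ∫ x in Ioo (0 : ℝ) 1, (θ x * m' x + deriv θ x * m x) = θ 1 * b.re - θ 0 * a.re := by
    intro θ hθ
    have h1 := congrArg Complex.re (h θ hθ)
    have e : ∀ x, ((θ x : ℂ) * (m' x : ℂ) + ((deriv θ x : ℝ) : ℂ) * (m x : ℂ))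
        = ((θ x * m' x + deriv θ x * m x : ℝ) : ℂ) := fun x => by push_cast; ring
    simp only [e] at h1
    rw [integral_complex_ofReal] at h1
    simpa using h1
  have hmul : ∀ {θ q : ℝ → ℝ}, Continuous θ → Integrable q unitMeasure →
      Integrable (fun x => θ x * q x) unitMeasure := by
    intro θ q hθ hq
    have := (integrable_ofReal_mul hθ hq.ofReal).re
    simpa using this
  -- The weak derivative of `m - G` is zero, because `G` is the primitive of `m'`; the rest of the
  -- proof shows that `m - G` is the constant `a.re`.
  have hkey : ∀ θ : ℝ → ℝ, ContDiff ℝ ∞ θ →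
      ∫ x in Ioo (0 : ℝ) 1, deriv θ x * (m x - G x) = θ 1 * (b.re - G 1) - θ 0 * a.re := by
    intro θ hθ
    have h1 := hreal θ hθ
    have h2 := integral_smooth_mul_eq hm' hθ
    have i1 := hmul hθ.continuous hm'
    have i2 := hmul (continuous_deriv_of_smooth hθ) hm
    have i3 := hmul (continuous_deriv_of_smooth hθ) hGi
    rw [integral_add i1 i2] at h1
    simp only [mul_sub]
    rw [integral_sub i2 i3]
    linarith
  have hab : b.re - G 1 = a.re := by
    have := hkey (fun _ => 1) contDiff_const
    simp at this
    linarith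
  have hz : (fun x => ((m x - G x - a.re : ℝ) : ℂ)) =ᵐ[unitMeasure] 0 := by
    have hi : Integrable (fun x => m x - G x - a.re) unitMeasure :=
      (hm.sub hGi).sub (integrable_const _)
    refine ae_eq_zero_of_forall_isTest hi.ofReal fun η hη => ?_
    -- The primitive of a test function need not have compact support. It is admissible here because
    -- `hkey` allows boundary values, so no mean-zero condition on `η` is needed.
    obtain ⟨θ, hθ, rfl⟩ := exists_smooth_primitive hη.contDiff
    have h1 := hkey θ hθ
    have hFTC : ∫ x in Ioo (0 : ℝ) 1, deriv θ x = θ 1 - θ 0 := by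
      rw [← integral_Ioc_eq_integral_Ioo, ← intervalIntegral.integral_of_le zero_le_one]
      exact intervalIntegral.integral_deriv_eq_sub (fun x _ => differentiable_of_smooth hθ x)
        ((continuous_deriv_of_smooth hθ).intervalIntegrable _ _)
    have e : ∀ x, ((deriv θ x : ℝ) : ℂ) * ((m x - G x - a.re : ℝ) : ℂ)
        = ((deriv θ x * (m x - G x) - a.re * deriv θ x : ℝ) : ℂ) := fun x => by push_cast; ring
    simp only [e]
    have iθ : Integrable (deriv θ) unitMeasure :=
      integrable_unit_of_continuous (continuous_deriv_of_smooth hθ)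
    have iG : Integrable (fun x => deriv θ x * (m x - G x)) unitMeasure :=
      hmul (continuous_deriv_of_smooth hθ) (hm.sub hGi)
    rw [integral_complex_ofReal, integral_sub iG (iθ.const_mul _), integral_const_mul, h1, hFTC, hab]
    push_cast; ring
  obtain ⟨C, hC⟩ := isCompact_Icc.exists_bound_of_continuousOn hGc
  refine ⟨C + |a.re|, ?_⟩
  filter_upwards [hz, ae_restrict_mem measurableSet_Ioo] with x hx hx'
  have hx0 : m x - G x - a.re = 0 := Complex.ofReal_eq_zero.1 hx
  have : m x = G x + a.re := by linarith
  rw [this]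
  exact (abs_add_le _ _).trans (by gcongr; exact hC x (Ioo_subset_Icc_self hx'))

/-! ### From weak derivatives to boundary values -/

theorem IsTest.deriv {η : ℝ → ℝ} (hη : IsTest η) : IsTest (deriv η) :=
  ⟨contDiff_deriv hη.contDiff, hη.hasCompactSupport.deriv,
    (tsupport_deriv_subset).trans hη.tsupport_subset⟩

/-- Consecutive weak derivatives are weak derivatives of each other. -/
theorem IsWeakDeriv.succ {𝕜 : Type} [RCLike 𝕜] {j : ℕ} {f g g' : L2 𝕜} (h : IsWeakDeriv j f g)
    (h' : IsWeakDeriv (j + 1) f g') {η : ℝ → ℝ} (hη : IsTest η) :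
    ∫ x in Ioo (0 : ℝ) 1, (η x • g' x + deriv η x • g x) = 0 := by
  have h1 := h _ hη.deriv
  have h2 := h' _ hη
  rw [iteratedDeriv_succ', h1, pow_succ, mul_neg_one, neg_smul, ← smul_neg] at h2
  have h3 : ∫ x in Ioo (0 : ℝ) 1, deriv η x • g x = -∫ x in Ioo (0 : ℝ) 1, η x • g' x :=
    smul_right_injective 𝕜 (r := (-1 : ℝ) ^ j) (by simp) h2
  have i1 := integrable_smul_L2 hη 0 g'
  have i2 := integrable_smul_L2 hη.deriv 0 g
  simp only [iteratedDeriv_zero] at i1 i2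
  rw [integral_add i1 i2, h3, add_neg_cancel]

theorem integrable_L2 {𝕜 : Type} [RCLike 𝕜] (f : L2 𝕜) : Integrable f unitMeasure :=
  (Lp.memLp f).integrable (by norm_num)

theorem IsWeakDeriv.exists_hasTrace {j : ℕ} {f g g' : L2 ℂ} (h : IsWeakDeriv j f g)
    (h' : IsWeakDeriv (j + 1) f g') : ∃ a b, HasTrace g g' a b :=
  Schrodinger.exists_hasTrace (integrable_L2 g) (integrable_L2 g') fun η hη => by
    simpa only [Complex.real_smul] using h.succ h' hη

theorem IsWeakDeriv.exists_hasTrace_real {j : ℕ} {f g g' : L2 ℝ} (h : IsWeakDeriv j f g)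
    (h' : IsWeakDeriv (j + 1) f g') :
    ∃ a b, HasTrace (fun x => (g x : ℂ)) (fun x => (g' x : ℂ)) a b :=
  Schrodinger.exists_hasTrace (integrable_L2 g).ofReal (integrable_L2 g').ofReal fun η hη => by
    have := h.succ h' hη
    have e : ∀ x, ((η x : ℂ) * (g' x : ℂ) + ((_root_.deriv η x : ℝ) : ℂ) * (g x : ℂ))
        = ((η x • g' x + _root_.deriv η x • g x : ℝ) : ℂ) := fun x => by
      simp only [smul_eq_mul]; push_cast; ring
    simp only [e]
    rw [integral_complex_ofReal, this, Complex.ofReal_zero]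

/-- The weak derivative of an `L²` function is unique. -/
theorem IsWeakDeriv.unique {f g g' : L2 ℂ} (h : IsWeakDeriv 1 f g) (h' : IsWeakDeriv 1 f g') :
    g = g' := by
  rw [← sub_eq_zero, Lp.eq_zero_iff_ae_eq_zero]
  refine ae_eq_zero_of_forall_isTest (integrable_L2 _) fun η hη => ?_
  have h1 := (h η hη).symm.trans (h' η hη)
  have h2 : ∫ x in Ioo (0 : ℝ) 1, η x • g x = ∫ x in Ioo (0 : ℝ) 1, η x • g' x :=
    smul_right_injective ℂ (r := (-1 : ℝ) ^ 1) (by simp) h1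
  have i1 := integrable_smul_L2 hη 0 g
  have i2 := integrable_smul_L2 hη 0 g'
  simp only [iteratedDeriv_zero] at i1 i2
  rw [← sub_eq_zero, ← integral_sub i1 i2] at h2
  rw [← h2]
  refine integral_congr_ae ?_
  filter_upwards [Lp.coeFn_sub g g'] with x hx
  rw [hx, Pi.sub_apply, mul_sub, Complex.real_smul, Complex.real_smul]

/-- The weak derivatives as continuous linear maps. -/
def wderivL (m : ℕ) (j : Fin (m + 1)) : Sobolev ℂ m →L[ℂ] L2 ℂ :=
  LinearMap.mkContinuous
    { toFun := fun F => F.wderiv j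
      map_add' := fun _ _ => rfl
      map_smul' := fun _ _ => rfl } 1 (fun F => by
    change ‖F.wderiv j‖ ≤ 1 * ‖F‖
    rw [one_mul, Sobolev.norm_eq]
    refine Real.le_sqrt_of_sq_le ?_
    exact Finset.single_le_sum (f := fun j => ‖F.wderiv j‖ ^ 2) (fun i _ => by positivity)
      (Finset.mem_univ j))

@[simp] theorem wderivL_apply {m : ℕ} (j : Fin (m + 1)) (F : Sobolev ℂ m) :
    wderivL m j F = F.wderiv j := rfl

/-! ### Vanishing boundary values on `H^1_0`, and the coefficient formula -/

theorem integral_test_mul_eq_zero {η : ℝ → ℂ} (hη : IsTest η) {θ : ℝ → ℝ} (hθ : ContDiff ℝ ∞ θ) :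
    ∫ x in Ioo (0 : ℝ) 1, ((θ x : ℂ) * deriv η x + ((deriv θ x : ℝ) : ℂ) * η x) = 0 := by
  have hηd := contDiff_infty_iff_deriv.1 hη.contDiff
  have hd : ∀ x, HasDerivAt (fun x => (θ x : ℂ) * η x)
      ((θ x : ℂ) * deriv η x + ((deriv θ x : ℝ) : ℂ) * η x) x := by
    intro x
    have := ((differentiable_of_smooth hθ x).hasDerivAt.ofReal_comp).mul (hηd.1 x).hasDerivAt
    rw [add_comm]; exact this
  have hc1 := hηd.2.continuous
  have hc2 := continuous_deriv_of_smooth hθ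
  have hc3 := hη.contDiff.continuous
  have hc4 := hθ.continuous
  have h01 : ∀ x ∉ Ioo (0 : ℝ) 1, η x = 0 := fun x hx =>
    image_eq_zero_of_notMem_tsupport fun h' => hx (hη.tsupport_subset h')
  rw [← integral_Ioc_eq_integral_Ioo, ← intervalIntegral.integral_of_le zero_le_one,
    intervalIntegral.integral_eq_sub_of_hasDerivAt (fun x _ => hd x)
      (Continuous.intervalIntegrable (by fun_prop) _ _), h01 0 (by simp), h01 1 (by simp)]
  simp

/-- The weak derivative carried by `F` must agree almost everywhere with the classical `deriv η`,
and integration by parts against `η` has no boundary terms. -/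
theorem hasTrace_of_isTest {F : Sobolev ℂ 1} {η : ℝ → ℂ} (hη : IsTest η)
    (h : Sobolev.toL2 ℂ 1 F =ᵐ[unitMeasure] η) : HasTrace (F.wderiv 0) (F.wderiv 1) 0 0 := by
  have hηc : Continuous (deriv η) := (contDiff_infty_iff_deriv.1 hη.contDiff).2.continuous
  have hηi : Integrable (deriv η) unitMeasure :=
    (hηc.integrableOn_Icc (a := 0) (b := 1)).mono_set Ioo_subset_Icc_self
  have h1 : (fun x => F.wderiv 1 x - deriv η x) =ᵐ[unitMeasure] 0 := by
    refine ae_eq_zero_of_forall_isTest ((integrable_L2 _).sub hηi) fun ξ hξ => ?_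
    have hw := (F.isWeakDeriv 0).succ (F.isWeakDeriv 1) hξ
    have ht := integral_test_mul_eq_zero hη hξ.contDiff
    have e : ∫ x in Ioo (0 : ℝ) 1, (ξ x • F.wderiv 1 x + deriv ξ x • F.wderiv 0 x)
        = ∫ x in Ioo (0 : ℝ) 1, ((ξ x : ℂ) * F.wderiv 1 x + ((deriv ξ x : ℝ) : ℂ) * η x) := by
      refine integral_congr_ae ?_
      filter_upwards [h] with x hx
      rw [← hx, Complex.real_smul, Complex.real_smul]; rfl
    rw [e] at hw
    have hη0 : Integrable η unitMeasure := (integrable_L2 _).congr h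
    have hη0' := integrable_ofReal_mul (continuous_deriv_of_smooth hξ.contDiff) hη0
    have iF := integrable_ofReal_mul hξ.contDiff.continuous (integrable_L2 (F.wderiv 1))
    have iη := integrable_ofReal_mul hξ.contDiff.continuous hηi
    rw [integral_add iF hη0'] at hw
    rw [integral_add iη hη0'] at ht
    simp only [mul_sub]
    rw [integral_sub iF iη]
    linear_combination hw - ht
  have ht : HasTrace η (deriv η) 0 0 := fun θ hθ => by
    rw [integral_test_mul_eq_zero hη hθ]; simp
  refine ht.congr_ae (Filter.EventuallyEq.symm h) ?_
  filter_upwards [h1] with x hx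
  exact (sub_eq_zero.1 hx).symm

theorem inner_ofCont_add {θ θ' : ℝ → ℝ} (hθ : Continuous θ) (hθ' : Continuous θ') (f g : L2 ℂ) :
    inner ℂ (ofCont θ hθ) g + inner ℂ (ofCont θ' hθ') f =
      ∫ x in Ioo (0 : ℝ) 1, ((θ x : ℂ) * g x + (θ' x : ℂ) * f x) := by
  rw [inner_ofCont, inner_ofCont, integral_add (integrable_ofReal_mul hθ (integrable_L2 g))
    (integrable_ofReal_mul hθ' (integrable_L2 f))]

/-- The functions in `H^1_0` have vanishing boundary values. -/
theorem hasTrace_of_mem_H10 {F : Sobolev ℂ 1} (hF : F ∈ H10 ℂ) :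
    HasTrace (F.wderiv 0) (F.wderiv 1) 0 0 := by
  intro θ hθ
  -- For fixed `θ` the condition is the vanishing of a continuous form on `H^1`, so it passes from
  -- test functions to the closure.
  let ℓ : Sobolev ℂ 1 →L[ℂ] ℂ :=
    (innerSL ℂ (ofCont θ hθ.continuous)).comp (wderivL 1 1) +
      (innerSL ℂ (ofCont (deriv θ) (continuous_deriv_of_smooth hθ))).comp (wderivL 1 0)
  have hℓ : ∀ F, ℓ F = ∫ x in Ioo (0 : ℝ) 1,
      ((θ x : ℂ) * F.wderiv 1 x + ((deriv θ x : ℝ) : ℂ) * F.wderiv 0 x) := fun F =>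
    inner_ofCont_add _ _ _ _
  have hle : H10 ℂ ≤ ℓ.ker := by
    refine Submodule.topologicalClosure_minimal _ (Submodule.span_le.2 ?_) ℓ.isClosed_ker
    rintro G ⟨η, hη, hG⟩
    have := hasTrace_of_isTest hη hG θ hθ
    change ℓ G = 0
    rw [hℓ, this]; simp
  have : ℓ F = 0 := hle hF
  rw [← hℓ, this]; simp

/-- Membership in `H^1_0` supplies an element `G` of `H^1` with the same underlying function but its
own derivative; uniqueness of weak derivatives identifies the two. -/
theorem H3H10.hasTrace_zero (F : H3H10) :
    HasTrace (F.toSobolev.wderiv 0) (F.toSobolev.wderiv 1) 0 0 := by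
  obtain ⟨G, hG, hGF⟩ := Submodule.mem_map.1 (Submodule.mem_comap.1 F.2)
  have h0 : G.wderiv 0 = F.toSobolev.wderiv 0 := hGF
  have h1 : G.wderiv 1 = F.toSobolev.wderiv 1 := by
    refine IsWeakDeriv.unique (G.isWeakDeriv 1) ?_
    rw [hGF]
    exact F.toSobolev.isWeakDeriv 1
  rw [← h0, ← h1]
  exact hasTrace_of_mem_H10 hG

/-- Three integrations by parts, against cosine, sine and cosine. The first has no boundary term
because `g₀` vanishes at the ends, the second because the sine does. The third leaves the boundary
values of `g₂`, which is what separates `H^3 ∩ H^1_0` from `H^3_{(0)}`. -/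
theorem mul_coeff_of_hasTrace {g₀ g₁ g₂ g₃ : L2 ℂ} {a b c d : ℂ} (h₀ : HasTrace g₀ g₁ 0 0)
    (h₁ : HasTrace g₁ g₂ a b) (h₂ : HasTrace g₂ g₃ c d) (k : ℕ+) :
    ((k : ℂ) * Real.pi) ^ 3 * coeff k g₀ =
      Real.sqrt 2 * ((-1) ^ (k : ℕ) * d - c) - inner ℂ (cosine k) g₃ := by
  have hs : Continuous fun x => -((k : ℝ) * Real.pi * sinFn k x) :=
    (continuous_const.mul (continuous_sinFn k)).neg
  have hc : Continuous fun x => (k : ℝ) * Real.pi * cosFn k x :=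
    continuous_const.mul (continuous_cosFn k)
  have e1 : ∀ g : L2 ℂ, inner ℂ (ofCont _ hs) g = -((k : ℂ) * Real.pi * coeff k g) := fun g => by
    rw [inner_ofCont, coeff_eq_integral, ← integral_const_mul, ← integral_neg]
    congr 1; funext x; push_cast; ring
  have e2 : ∀ g : L2 ℂ, inner ℂ (ofCont _ hc) g = (k : ℂ) * Real.pi * inner ℂ (cosine k) g :=
    fun g => by
      rw [inner_ofCont, cosine, inner_ofCont, ← integral_const_mul]
      congr 1; funext x; push_cast; ring
  have t0 := h₀ (cosFn k) (contDiff_cosFn k)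
  have t1 := h₁ (sinFn k) (contDiff_sinFn k)
  have t2 := h₂ (cosFn k) (contDiff_cosFn k)
  rw [deriv_cosFn, ← inner_ofCont_add (continuous_cosFn k) hs, e1] at t0 t2
  rw [deriv_sinFn, ← inner_ofCont_add (continuous_sinFn k) hc, e2] at t1
  rw [← cosine] at t0 t2
  rw [← eigenfunction_eq, ← coeff] at t1
  simp only [sinFn_zero, sinFn_one, cosFn_zero, cosFn_one, Complex.ofReal_zero, zero_mul,
    mul_zero, sub_zero] at t0 t1 t2
  push_cast at t2
  linear_combination (-((k : ℂ) * Real.pi) ^ 2) * t0 + ((k : ℂ) * Real.pi) * t1 + t2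

/-! ### Coefficients of functions in `H^3 ∩ H^1_0` -/

/-- Synthesis with the cosine family. -/
def cosSynth : Seq2 →ₗᵢ[ℂ] L2 ℂ := orthonormal_cosine.orthogonalFamily.linearIsometry

theorem cosSynth_single (k : ℕ+) : cosSynth (lp.single 2 k 1) = cosine k := by
  rw [cosSynth, OrthogonalFamily.linearIsometry_apply_single]
  simp

/-- The sequence of the cosine coefficients. -/
def cosAnalysis : L2 ℂ →L[ℂ] Seq2 := ContinuousLinearMap.adjoint cosSynth.toContinuousLinearMap

theorem cosAnalysis_apply (g : L2 ℂ) (k : ℕ+) : cosAnalysis g k = inner ℂ (cosine k) g := by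
  have h := lp.inner_single_left (𝕜 := ℂ) k (1 : ℂ) (cosAnalysis g)
  rw [cosAnalysis, ContinuousLinearMap.adjoint_inner_right, ← cosAnalysis] at h
  change inner ℂ (cosSynth (lp.single 2 k 1)) g = _ at h
  rw [cosSynth_single] at h
  rw [h]; simp

/-- The data of the expansion of the coefficients of a function of `H^3 ∩ H^1_0`: two boundary
terms and a square summable remainder. -/
abbrev Expansion : Type := ℂ × ℂ × Seq2

/-- The `k`-th term `α + (-1)^k β + γ_k` of an expansion. -/
def term (k : ℕ+) : Expansion →L[ℂ] ℂ :=
  ContinuousLinearMap.fst ℂ ℂ (ℂ × Seq2) +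
    (((-1 : ℂ) ^ (k : ℕ)) • ContinuousLinearMap.fst ℂ ℂ Seq2 +
      (lp.evalCLM ℂ (fun _ : ℕ+ => ℂ) 2 k).comp (ContinuousLinearMap.snd ℂ ℂ Seq2)).comp
      (ContinuousLinearMap.snd ℂ ℂ (ℂ × Seq2))

theorem term_apply (k : ℕ+) (e : Expansion) :
    term k e = e.1 + ((-1 : ℂ) ^ (k : ℕ) * e.2.1 + e.2.2 k) := rfl

/-- The boundary value at `0` of `g₂`, where `g₃ = g₂'`. -/
def leftTrace : L2 ℂ × L2 ℂ →L[ℂ] ℂ :=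
  (innerSL ℂ (ofCont (fun _ => 1) continuous_const)).comp (ContinuousLinearMap.fst ℂ _ _) -
    (innerSL ℂ (ofCont (fun x => 1 - x) (by fun_prop))).comp (ContinuousLinearMap.snd ℂ _ _)

/-- The boundary value at `1` of `g₂`, where `g₃ = g₂'`. -/
def rightTrace : L2 ℂ × L2 ℂ →L[ℂ] ℂ :=
  (innerSL ℂ (ofCont (fun _ => 1) continuous_const)).comp (ContinuousLinearMap.fst ℂ _ _) +
    (innerSL ℂ (ofCont (fun x => x) (by fun_prop))).comp (ContinuousLinearMap.snd ℂ _ _)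

theorem HasTrace.leftTrace_eq {f g : L2 ℂ} {a b : ℂ} (h : HasTrace f g a b) :
    leftTrace (f, g) = a := by
  change inner ℂ (ofCont (fun _ => 1) continuous_const) f -
    inner ℂ (ofCont (fun x => 1 - x) (by fun_prop)) g = a
  rw [← neg_eq_iff_eq_neg.2 h.left_eq, inner_ofCont, inner_ofCont, integral_sub
    (integrable_ofReal_mul (θ := fun x => 1 - x) (by fun_prop) (integrable_L2 g)) (integrable_L2 f)]
  simp

theorem HasTrace.rightTrace_eq {f g : L2 ℂ} {a b : ℂ} (h : HasTrace f g a b) :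
    rightTrace (f, g) = b := by
  change inner ℂ (ofCont (fun _ => 1) continuous_const) f +
    inner ℂ (ofCont (fun x => x) (by fun_prop)) g = b
  rw [← h.right_eq, inner_ofCont, inner_ofCont, integral_add
    (integrable_ofReal_mul (θ := fun x => x) (by fun_prop) (integrable_L2 g)) (integrable_L2 f)]
  simp [add_comm]

/-- The expansion of the coefficients of a function with second derivative `g₂` and third
derivative `g₃`. -/
def expand : L2 ℂ × L2 ℂ →L[ℂ] Expansion :=
  (((Real.pi : ℂ) ^ 3)⁻¹) • ((-(Real.sqrt 2 : ℂ) • leftTrace).prod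
    (((Real.sqrt 2 : ℂ) • rightTrace).prod
      (-(cosAnalysis.comp (ContinuousLinearMap.snd ℂ _ _)))))

/-- The boundary values `c`, `d` are rewritten through the trace functionals, so that the expansion
is one bounded operator applied to `(g₂, g₃)`. -/
theorem mul_coeff_eq_term {g₀ g₁ g₂ g₃ : L2 ℂ} {a b c d : ℂ} (h₀ : HasTrace g₀ g₁ 0 0)
    (h₁ : HasTrace g₁ g₂ a b) (h₂ : HasTrace g₂ g₃ c d) (k : ℕ+) :
    (k : ℂ) ^ 3 * coeff k g₀ = term k (expand (g₂, g₃)) := by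
  have hπ : ((Real.pi : ℂ) ^ 3) ≠ 0 := pow_ne_zero _ (by exact_mod_cast Real.pi_ne_zero)
  have h := mul_coeff_of_hasTrace h₀ h₁ h₂ k
  have e : term k (expand (g₂, g₃)) = ((Real.pi : ℂ) ^ 3)⁻¹ *
      (Real.sqrt 2 * ((-1) ^ (k : ℕ) * d - c) - inner ℂ (cosine k) g₃) := by
    rw [expand, smul_apply, map_smul, term_apply, ← cosAnalysis_apply,
      ← h₂.leftTrace_eq, ← h₂.rightTrace_eq, smul_eq_mul]
    congr 1
    change -(Real.sqrt 2 : ℂ) * leftTrace (g₂, g₃) + ((-1) ^ (k : ℕ) *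
      ((Real.sqrt 2 : ℂ) * rightTrace (g₂, g₃)) + -(cosAnalysis g₃ k)) = _
    ring
  rw [e, ← h]
  field_simp

/-- The weak derivatives on `H^3 ∩ H^1_0`. -/
def H3H10.wderivL (j : Fin 4) : H3H10 →L[ℂ] L2 ℂ :=
  (Schrodinger.wderivL 3 j).comp (Submodule.subtypeL h3h10Submodule)

theorem H3H10.wderivL_apply (j : Fin 4) (F : H3H10) : H3H10.wderivL j F = F.toSobolev.wderiv j :=
  rfl

/-- The expansion of the coefficients of a function of `H^3 ∩ H^1_0`. -/
def H3H10.expand : H3H10 →L[ℂ] Expansion :=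
  Schrodinger.expand.comp ((H3H10.wderivL 2).prod (H3H10.wderivL 3))

theorem H3H10.mul_coeff_eq (F : H3H10) (k : ℕ+) :
    (k : ℂ) ^ 3 * coeff k (Sobolev.toL2 ℂ 3 F.toSobolev) = term k (H3H10.expand F) := by
  obtain ⟨a, b, h₁⟩ := (F.toSobolev.isWeakDeriv 1).exists_hasTrace (F.toSobolev.isWeakDeriv 2)
  obtain ⟨c, d, h₂⟩ := (F.toSobolev.isWeakDeriv 2).exists_hasTrace (F.toSobolev.isWeakDeriv 3)
  exact mul_coeff_eq_term F.hasTrace_zero h₁ h₂ k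

/-! ### Multiplication operators -/

theorem memLp_bdd_mul {q : ℝ → ℂ} (hq : AEStronglyMeasurable q unitMeasure) {C : ℝ}
    (hC : ∀ᵐ x ∂unitMeasure, ‖q x‖ ≤ C) (φ : L2 ℂ) :
    MemLp (fun x => q x * φ x) 2 unitMeasure :=
  (Lp.memLp φ).of_le_mul (c := C) (hq.mul (Lp.aestronglyMeasurable φ)) (by
    filter_upwards [hC] with x hx
    rw [norm_mul]; gcongr)

/-- Multiplication by a bounded function, as an operator on `L²`. -/
def bddMul (q : ℝ → ℂ) (hq : AEStronglyMeasurable q unitMeasure) (C : ℝ)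
    (hC : ∀ᵐ x ∂unitMeasure, ‖q x‖ ≤ C) : L2 ℂ →L[ℂ] L2 ℂ :=
  LinearMap.mkContinuous
    { toFun := fun φ => (memLp_bdd_mul hq hC φ).toLp _
      map_add' := fun φ φ' => by
        rw [← MemLp.toLp_add]
        refine MemLp.toLp_congr _ _ ?_
        filter_upwards [Lp.coeFn_add φ φ'] with x hx
        simp only [hx, Pi.add_apply, mul_add]
      map_smul' := fun c φ => by
        rw [RingHom.id_apply, ← MemLp.toLp_const_smul]
        refine MemLp.toLp_congr _ _ ?_
        filter_upwards [Lp.coeFn_smul c φ] with x hx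
        simp only [hx, Pi.smul_apply, smul_eq_mul]
        ring } C (fun φ => by
    refine Lp.norm_le_mul_norm_of_ae_le_mul ?_
    change ∀ᵐ x ∂unitMeasure, ‖(memLp_bdd_mul hq hC φ).toLp _ x‖ ≤ C * ‖φ x‖
    filter_upwards [(memLp_bdd_mul hq hC φ).coeFn_toLp, hC] with x hx hx'
    rw [hx, norm_mul]; gcongr)

theorem coeFn_bddMul {q : ℝ → ℂ} {hq : AEStronglyMeasurable q unitMeasure} {C : ℝ}
    {hC : ∀ᵐ x ∂unitMeasure, ‖q x‖ ≤ C} (φ : L2 ℂ) :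
    bddMul q hq C hC φ =ᵐ[unitMeasure] fun x => q x * φ x :=
  MemLp.coeFn_toLp (memLp_bdd_mul hq hC φ)

theorem norm_bddMul_le {q : ℝ → ℂ} {hq : AEStronglyMeasurable q unitMeasure} {C : ℝ} (h0 : 0 ≤ C)
    {hC : ∀ᵐ x ∂unitMeasure, ‖q x‖ ≤ C} (φ : L2 ℂ) : ‖bddMul q hq C hC φ‖ ≤ C * ‖φ‖ := by
  refine ContinuousLinearMap.le_of_opNorm_le _ ?_ φ
  rw [bddMul]
  exact LinearMap.mkContinuous_norm_le _ h0 _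

/-- Multiplication by `√2 sin(kπx)`. -/
def sinMul (k : ℕ+) : L2 ℂ →L[ℂ] L2 ℂ :=
  bddMul (fun x => (sinFn k x : ℂ))
    (Complex.continuous_ofReal.comp (continuous_sinFn k)).aestronglyMeasurable (Real.sqrt 2)
    (Filter.Eventually.of_forall fun x => by
      rw [Complex.norm_real]; exact abs_sinFn_le k x)

/-- Multiplication by `√2 cos(kπx)`. -/
def cosMul (k : ℕ+) : L2 ℂ →L[ℂ] L2 ℂ :=
  bddMul (fun x => (cosFn k x : ℂ))
    (Complex.continuous_ofReal.comp (continuous_cosFn k)).aestronglyMeasurable (Real.sqrt 2)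
    (Filter.Eventually.of_forall fun x => by
      rw [Complex.norm_real]; exact abs_cosFn_le k x)

theorem norm_sinMul_le (k : ℕ+) (φ : L2 ℂ) : ‖sinMul k φ‖ ≤ Real.sqrt 2 * ‖φ‖ :=
  norm_bddMul_le (Real.sqrt_nonneg 2) φ

theorem norm_cosMul_le (k : ℕ+) (φ : L2 ℂ) : ‖cosMul k φ‖ ≤ Real.sqrt 2 * ‖φ‖ :=
  norm_bddMul_le (Real.sqrt_nonneg 2) φ

theorem coeFn_sinMul (k : ℕ+) (φ : L2 ℂ) :
    sinMul k φ =ᵐ[unitMeasure] fun x => (sinFn k x : ℂ) * φ x := coeFn_bddMul φ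

theorem coeFn_cosMul (k : ℕ+) (φ : L2 ℂ) :
    cosMul k φ =ᵐ[unitMeasure] fun x => (cosFn k x : ℂ) * φ x := coeFn_bddMul φ

/-! ### Leibniz rules for products with sines and cosines -/

theorem hasTrace_add {f g f' g' : L2 ℂ} {a b a' b' : ℂ} (h : HasTrace f g a b)
    (h' : HasTrace f' g' a' b') :
    HasTrace (f + f' : L2 ℂ) (g + g' : L2 ℂ) (a + a') (b + b') := by
  intro θ hθ
  have e := inner_ofCont_add hθ.continuous (continuous_deriv_of_smooth hθ)
  have h1 := h θ hθ
  have h2 := h' θ hθ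
  rw [← e] at h1 h2 ⊢
  rw [inner_add_right, inner_add_right]
  linear_combination h1 + h2

theorem hasTrace_smul {f g : L2 ℂ} {a b : ℂ} (c : ℂ) (h : HasTrace f g a b) :
    HasTrace (c • f : L2 ℂ) (c • g : L2 ℂ) (c * a) (c * b) := by
  intro θ hθ
  have e := inner_ofCont_add hθ.continuous (continuous_deriv_of_smooth hθ)
  have h1 := h θ hθ
  rw [← e] at h1 ⊢
  rw [inner_smul_right, inner_smul_right]
  linear_combination c * h1

theorem hasTrace_sinMul {f g : L2 ℂ} {a b : ℂ} (h : HasTrace f g a b) (k : ℕ+) :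
    HasTrace (sinMul k f) (sinMul k g + ((k : ℂ) * Real.pi) • cosMul k f : L2 ℂ) 0 0 := by
  have h1 := h.smooth_mul (contDiff_sinFn k)
  simp only [sinFn_zero, sinFn_one, Complex.ofReal_zero, zero_mul] at h1
  refine h1.congr_ae (coeFn_bddMul f).symm ?_
  filter_upwards [Lp.coeFn_add (sinMul k g) (((k : ℂ) * Real.pi) • cosMul k f),
    Lp.coeFn_smul ((k : ℂ) * Real.pi) (cosMul k f),
    coeFn_sinMul k g,
    coeFn_cosMul k f] with x e1 e2 e3 e4
  rw [e1, Pi.add_apply, e2, Pi.smul_apply, e3, e4, deriv_sinFn, smul_eq_mul]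
  push_cast; ring

theorem hasTrace_cosMul {f g : L2 ℂ} {a b : ℂ} (h : HasTrace f g a b) (k : ℕ+) :
    HasTrace (cosMul k f) (cosMul k g + (-((k : ℂ) * Real.pi)) • sinMul k f : L2 ℂ)
      (cosFn k 0 * a) (cosFn k 1 * b) := by
  refine (h.smooth_mul (contDiff_cosFn k)).congr_ae (coeFn_bddMul f).symm ?_
  filter_upwards [Lp.coeFn_add (cosMul k g) ((-((k : ℂ) * Real.pi)) • sinMul k f),
    Lp.coeFn_smul (-((k : ℂ) * Real.pi)) (sinMul k f),
    coeFn_cosMul k g,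
    coeFn_sinMul k f] with x e1 e2 e3 e4
  rw [e1, Pi.add_apply, e2, Pi.smul_apply, e3, e4, deriv_cosFn, smul_eq_mul]
  push_cast; ring

/-- The expansion of the coefficients of `m φ_k`, for `m` with three weak derivatives. -/
theorem mul_coeff_sinMul {m₀ m₁ m₂ m₃ : L2 ℂ} (h₀ : ∃ a b, HasTrace m₀ m₁ a b)
    (h₁ : ∃ a b, HasTrace m₁ m₂ a b) (h₂ : ∃ a b, HasTrace m₂ m₃ a b) (j k : ℕ+) :
    (k : ℂ) ^ 3 * coeff k (sinMul j m₀) = term k (expand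
      (sinMul j m₂ + ((j : ℂ) * Real.pi) • cosMul j ((2 : ℂ) • m₁) +
          ((j : ℂ) * Real.pi) ^ 2 • sinMul j (-m₀),
        sinMul j m₃ + ((j : ℂ) * Real.pi) • cosMul j ((3 : ℂ) • m₂) +
          ((j : ℂ) * Real.pi) ^ 2 • sinMul j ((-3 : ℂ) • m₁) +
          (-(((j : ℂ) * Real.pi) ^ 3)) • cosMul j m₀)) := by
  obtain ⟨a₀, b₀, h₀⟩ := h₀
  obtain ⟨a₁, b₁, h₁⟩ := h₁
  obtain ⟨a₂, b₂, h₂⟩ := h₂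
  set w : ℂ := (j : ℂ) * Real.pi with hw
  have t0 := hasTrace_sinMul h₀ j
  have t1 := hasTrace_add (hasTrace_sinMul h₁ j) (hasTrace_smul w (hasTrace_cosMul h₀ j))
  have t2 := hasTrace_add (hasTrace_add (hasTrace_sinMul h₂ j)
    (hasTrace_smul (2 * w) (hasTrace_cosMul h₁ j))) (hasTrace_smul (-w ^ 2) (hasTrace_sinMul h₀ j))
  -- The second derivative of `m φ_j` arises in two shapes: as the derivative in `t1` and as the
  -- function in `t2`. Both are brought to one form, ordered by powers of `w = jπ`.
  have e1 : sinMul j m₂ + w • cosMul j m₁ + w • (cosMul j m₁ + (-w) • sinMul j m₀)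
      = sinMul j m₂ + w • cosMul j ((2 : ℂ) • m₁) + w ^ 2 • sinMul j (-m₀) := by
    simp only [map_smul, map_neg]; module
  have e2 : sinMul j m₂ + (2 * w) • cosMul j m₁ + (-w ^ 2) • sinMul j m₀
      = sinMul j m₂ + w • cosMul j ((2 : ℂ) • m₁) + w ^ 2 • sinMul j (-m₀) := by
    simp only [map_smul, map_neg]; module
  have e3 : sinMul j m₃ + w • cosMul j m₂ + (2 * w) • (cosMul j m₂ + (-w) • sinMul j m₁)
      + (-w ^ 2) • (sinMul j m₁ + w • cosMul j m₀)
      = sinMul j m₃ + w • cosMul j ((3 : ℂ) • m₂) + w ^ 2 • sinMul j ((-3 : ℂ) • m₁)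
        + (-(w ^ 3)) • cosMul j m₀ := by
    simp only [map_smul]; module
  rw [← hw] at t0 t1 t2
  rw [e1] at t1
  rw [e2, e3] at t2
  exact mul_coeff_eq_term t0 t1 t2 k

/-- The bracket grows at most like `j²`, so the quotient by `j³` is `O(1/j)`. A term of order `j³`
would not be covered. -/
theorem summable_sq_div_cube (a b c : L2 ℂ) : Summable fun j : ℕ+ =>
    ‖((j : ℂ) ^ 3)⁻¹ • (sinMul j a + ((j : ℂ) * Real.pi) • cosMul j b +
      ((j : ℂ) * Real.pi) ^ 2 • sinMul j c)‖ ^ 2 := by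
  set K : ℝ := Real.sqrt 2 * (‖a‖ + Real.pi * ‖b‖ + Real.pi ^ 2 * ‖c‖) with hK
  have hs : Summable fun j : ℕ+ => K ^ 2 * ((j : ℝ) ^ 2)⁻¹ :=
    ((Real.summable_nat_pow_inv.2 (by norm_num : 1 < 2)).comp_injective
      PNat.coe_injective).mul_left _
  refine Summable.of_nonneg_of_le (fun _ => by positivity) (fun j => ?_) hs
  have hj : (1 : ℝ) ≤ j := by exact_mod_cast j.pos
  have hj0 : (0 : ℝ) < j := by linarith
  have hπ := Real.pi_pos
  have n1 : ‖((j : ℂ) * Real.pi)‖ = j * Real.pi := by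
    rw [norm_mul, Complex.norm_natCast, Complex.norm_real, Real.norm_of_nonneg hπ.le]
  have hb : ‖sinMul j a + ((j : ℂ) * Real.pi) • cosMul j b +
      ((j : ℂ) * Real.pi) ^ 2 • sinMul j c‖ ≤ K * (j : ℝ) ^ 2 := by
    refine (norm_add₃_le).trans ?_
    rw [norm_smul, norm_smul, norm_pow, n1]
    have b1 := norm_sinMul_le j a
    have b2 := norm_cosMul_le j b
    have b3 := norm_sinMul_le j c
    have hj2 : (j : ℝ) ≤ (j : ℝ) ^ 2 := by nlinarith
    calc ‖sinMul j a‖ + j * Real.pi * ‖cosMul j b‖ + (j * Real.pi) ^ 2 * ‖sinMul j c‖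
        ≤ (j : ℝ) ^ 2 * (Real.sqrt 2 * ‖a‖) + (j : ℝ) ^ 2 * Real.pi * (Real.sqrt 2 * ‖b‖)
          + (j * Real.pi) ^ 2 * (Real.sqrt 2 * ‖c‖) := by
          gcongr
          exact b1.trans (le_mul_of_one_le_left (by positivity) (by nlinarith))
      _ = K * (j : ℝ) ^ 2 := by rw [hK]; ring
  rw [norm_smul, norm_inv, norm_pow, Complex.norm_natCast]
  calc (((j : ℝ) ^ 3)⁻¹ * _) ^ 2 ≤ (((j : ℝ) ^ 3)⁻¹ * (K * (j : ℝ) ^ 2)) ^ 2 := by gcongr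
    _ = K ^ 2 * ((j : ℝ) ^ 2)⁻¹ := by field_simp

theorem seqToL2_single (s : ℕ) (j : ℕ+) :
    seqToL2 s (lp.single 2 j 1) = ((j : ℂ) ^ s)⁻¹ • eigenfunction j := by
  refine coeff_ext fun k => ?_
  have h := mul_coeff_seqToL2 s (lp.single 2 j 1) k
  have ho := orthonormal_iff_ite.1 orthonormal_eigenfunction k j
  have hk := natCast_pnat_pow_ne_zero k s
  refine mul_left_cancel₀ hk ?_
  rw [h, coeff, inner_smul_right, ho]
  by_cases hkj : k = j
  · subst hkj; simp [hk]
  · simp [lp.single_apply, hkj]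

/-! ### Multiplication by a function of `H^3` -/

/-- A real `L²` function as a complex one. -/
def complexify (m : L2 ℝ) : L2 ℂ := (Lp.memLp m).ofReal.toLp _

theorem coeFn_complexify (m : L2 ℝ) : complexify m =ᵐ[unitMeasure] fun x => (m x : ℂ) :=
  MemLp.coeFn_toLp _

theorem IsWeakDeriv.exists_hasTrace_complexify {j : ℕ} {f g g' : L2 ℝ} (h : IsWeakDeriv j f g)
    (h' : IsWeakDeriv (j + 1) f g') : ∃ a b, HasTrace (complexify g) (complexify g') a b := by
  obtain ⟨a, b, h⟩ := h.exists_hasTrace_real h'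
  exact ⟨a, b, h.congr_ae (coeFn_complexify g).symm (coeFn_complexify g').symm⟩

theorem Sobolev.exists_bound (μ : Sobolev ℝ 3) :
    ∃ C : ℝ, ∀ᵐ x ∂unitMeasure, ‖(Sobolev.toL2 ℝ 3 μ x : ℂ)‖ ≤ C := by
  obtain ⟨a, b, h⟩ := (μ.isWeakDeriv 0).exists_hasTrace_real (μ.isWeakDeriv 1)
  obtain ⟨C, hC⟩ := exists_bound_of_hasTrace (integrable_L2 _) (integrable_L2 _) h
  refine ⟨C, ?_⟩
  filter_upwards [hC] with x hx
  rw [Complex.norm_real]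
  exact hx

/-- Multiplication by `μ ∈ H^3` is a bounded operator on `L²`, and the weighted coefficients of
`μ φ`, for `φ ∈ H^3_{(0)}`, have an expansion that depends continuously on `φ`. -/
theorem exists_mul_operator (μ : Sobolev ℝ 3) :
    ∃ (B : L2 ℂ →L[ℂ] L2 ℂ) (M : Seq2 →L[ℂ] Expansion),
      (∀ φ, mul (Sobolev.toL2 ℝ 3 μ) φ = B φ) ∧
      (∀ φ, B φ =ᵐ[unitMeasure] fun x => (Sobolev.toL2 ℝ 3 μ x : ℂ) * φ x) ∧
      ∀ (x : Seq2) (k : ℕ+), (k : ℂ) ^ 3 * coeff k (B (seqToL2 3 x)) = term k (M x) := by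
  obtain ⟨C, hC⟩ := μ.exists_bound
  have hmeas : AEStronglyMeasurable (fun x => (Sobolev.toL2 ℝ 3 μ x : ℂ)) unitMeasure :=
    (Lp.memLp (Sobolev.toL2 ℝ 3 μ)).ofReal.1
  have hBφ := fun φ => coeFn_bddMul (hq := hmeas) (hC := hC) φ
  set B := bddMul (fun x => (Sobolev.toL2 ℝ 3 μ x : ℂ)) hmeas C hC with hB
  set m₀ := complexify (μ.wderiv 0)
  set m₁ := complexify (μ.wderiv 1)
  set m₂ := complexify (μ.wderiv 2)
  set m₃ := complexify (μ.wderiv 3)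
  have h₀ : ∃ a b, HasTrace m₀ m₁ a b :=
    (μ.isWeakDeriv 0).exists_hasTrace_complexify (μ.isWeakDeriv 1)
  have h₁ : ∃ a b, HasTrace m₁ m₂ a b :=
    (μ.isWeakDeriv 1).exists_hasTrace_complexify (μ.isWeakDeriv 2)
  have h₂ : ∃ a b, HasTrace m₂ m₃ a b :=
    (μ.isWeakDeriv 2).exists_hasTrace_complexify (μ.isWeakDeriv 3)
  obtain ⟨V, hV⟩ := exists_clm_single (summable_sq_div_cube m₂ ((2 : ℂ) • m₁) (-m₀))
  obtain ⟨W, hW⟩ := exists_clm_single (summable_sq_div_cube m₃ ((3 : ℂ) • m₂) ((-3 : ℂ) • m₁))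
  have hBs : ∀ j, B (eigenfunction j) = sinMul j m₀ := fun j => by
    refine Lp.ext ?_
    filter_upwards [hBφ (eigenfunction j),
      coeFn_sinMul j m₀, coeFn_complexify (μ.wderiv 0),
      coeFn_ofCont (sinFn j) (continuous_sinFn j)] with x e1 e2 e3 e4
    rw [e1, e2, e3, eigenfunction_eq, e4, mul_comm]; rfl
  have hBc : ∀ j, B (cosine j) = cosMul j m₀ := fun j => by
    refine Lp.ext ?_
    filter_upwards [hBφ (cosine j),
      coeFn_cosMul j m₀, coeFn_complexify (μ.wderiv 0),
      coeFn_ofCont (cosFn j) (continuous_cosFn j)] with x e1 e2 e3 e4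
    rw [e1, e2, e3, cosine, e4, mul_comm]; rfl
  -- The third derivative of `μ φ_j` contains `-(jπ)³ μ √2 cos(jπx)`, which after division by `j³`
  -- is not square summable in norm. Its superposition is nevertheless bounded: it is `-π³ μ` times
  -- a cosine series, and the cosines are orthonormal.
  let W' : Seq2 →L[ℂ] L2 ℂ :=
    W + (-((Real.pi : ℂ) ^ 3)) • B.comp cosSynth.toContinuousLinearMap
  have hW' : ∀ j, W' (lp.single 2 j 1) = ((j : ℂ) ^ 3)⁻¹ •
      (sinMul j m₃ + ((j : ℂ) * Real.pi) • cosMul j ((3 : ℂ) • m₂) +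
          ((j : ℂ) * Real.pi) ^ 2 • sinMul j ((-3 : ℂ) • m₁) +
          (-(((j : ℂ) * Real.pi) ^ 3)) • cosMul j m₀) := fun j => by
    change W (lp.single 2 j 1) + (-((Real.pi : ℂ) ^ 3)) • B (cosSynth (lp.single 2 j 1)) = _
    rw [hW, cosSynth_single, hBc, smul_add (((j : ℂ) ^ 3)⁻¹) _ ((-(((j : ℂ) * Real.pi) ^ 3)) • _),
      smul_smul]
    congr 2
    have := natCast_pnat_pow_ne_zero j 3
    field_simp
  refine ⟨B, expand.comp (V.prod W'), fun φ => ?_, hBφ, fun x k => ?_⟩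
  · have hm : MemLp (fun x => (Sobolev.toL2 ℝ 3 μ x : ℂ) * φ x) 2 unitMeasure :=
      (memLp_congr_ae (hBφ φ)).1 (Lp.memLp (B φ))
    rw [mul, dif_pos hm]
    rfl
  -- Both sides are continuous and linear in `x`, so it suffices to compare them at the unit
  -- vectors, that is, at `φ_j / j³`.
  · have : ((k : ℂ) ^ 3) • ((coeffL k).comp (B.comp (seqToL2 3)))
        = (term k).comp (expand.comp (V.prod W')) := by
      refine clm_ext_single fun j => ?_
      change (k : ℂ) ^ 3 * coeff k (B (seqToL2 3 (lp.single 2 j 1)))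
        = term k (expand (V (lp.single 2 j 1), W' (lp.single 2 j 1)))
      rw [hV, hW', seqToL2_single, map_smul, hBs, ← Prod.smul_mk, map_smul, map_smul,
        ← mul_coeff_sinMul h₀ h₁ h₂, smul_eq_mul, coeff, inner_smul_right, ← coeff]
      ring
    exact congrArg (fun L : Seq2 →L[ℂ] ℂ => L x) this

/-! ### The estimate of the Duhamel term -/

theorem conj_phase (k : ℕ+) (t : ℝ) : (starRingEnd ℂ) (phase k t) = phase k (-t) := by
  rw [phase, phase, ← Complex.exp_conj]
  simp

/-- `λ_j - λ_k = (j² - k²)π²` is a nonzero integer multiple of `π²`, so the integrand is a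
nonconstant exponential with period `2/π`. -/
theorem integral_phase_mul {j k : ℕ+} (hjk : j ≠ k) (N : ℕ) :
    ∫ τ in (0 : ℝ)..(N * (2 / Real.pi)), phase j (-τ) * phase k τ = 0 := by
  have hπ : (Real.pi : ℂ) ≠ 0 := by exact_mod_cast Real.pi_ne_zero
  set c : ℂ := Complex.I * (eigenvalue j - eigenvalue k : ℝ) with hc
  have hne : ((j : ℤ) ^ 2 - (k : ℤ) ^ 2) ≠ 0 := by
    intro h
    have h1 : (j : ℤ) ^ 2 = (k : ℤ) ^ 2 := by linarith
    have h2 : (j : ℤ) = k := (pow_left_inj₀ (by positivity) (by positivity) two_ne_zero).1 h1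
    exact hjk (PNat.coe_injective (by exact_mod_cast h2))
  have hdiff : ((eigenvalue j - eigenvalue k : ℝ) : ℂ)
      = (((j : ℤ) ^ 2 - (k : ℤ) ^ 2 : ℤ) : ℂ) * (Real.pi : ℂ) ^ 2 := by
    rw [eigenvalue, eigenvalue]; push_cast; ring
  have hc0 : c ≠ 0 := by
    rw [hc, hdiff]
    exact mul_ne_zero Complex.I_ne_zero (mul_ne_zero (by exact_mod_cast hne) (pow_ne_zero _ hπ))
  have he : ∀ τ : ℝ, phase j (-τ) * phase k τ = Complex.exp (c * τ) := fun τ => by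
    rw [phase, phase, ← Complex.exp_add, hc]; congr 1; push_cast; ring
  simp only [he]
  rw [integral_exp_mul_complex hc0]
  have h1 : c * ((N * (2 / Real.pi) : ℝ) : ℂ)
      = ((((j : ℤ) ^ 2 - (k : ℤ) ^ 2) * N : ℤ) : ℂ) * (2 * Real.pi * Complex.I) := by
    rw [hc, hdiff]; push_cast; field_simp
  rw [h1, Complex.exp_int_mul_two_pi_mul_I]
  simp

theorem memLp_Ioc_of_memLp_Ioo {V : Type*} [NormedAddCommGroup V] {h : ℝ → V} {T a b : ℝ}
    (hh : MemLp h 2 (volume.restrict (Ioo 0 T))) (ha : 0 ≤ a) (hb : b ≤ T) :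
    MemLp h 2 (volume.restrict (Ioc a b)) := by
  rw [Measure.restrict_congr_set (Ioo_ae_eq_Ioc).symm]
  exact hh.mono_measure (Measure.restrict_mono_set _ (Ioo_subset_Ioo ha hb))

/-- Bessel's inequality for the family of the phases, on a time interval of any length. -/
theorem exists_bessel_phase (T : ℝ) : ∃ K : ℝ, 0 ≤ K ∧ ∀ h : ℝ → ℂ,
    MemLp h 2 (volume.restrict (Ioo 0 T)) → ∀ a b : ℝ, 0 ≤ a → a ≤ b → b ≤ T →
    ∃ y : Seq2, (∀ k, y k = ∫ τ in a..b, phase k (-τ) * h τ) ∧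
      ‖y‖ ≤ K * Real.sqrt (∫ τ in a..b, ‖h τ‖ ^ 2) := by
  -- The phases are orthogonal only over multiples of `2/π`, so `(0,T)` is enlarged to such an
  -- interval `(0,P]`; the maximum with `0` keeps `P` positive.
  obtain ⟨N, hN⟩ := exists_nat_gt (max 0 (T / (2 / Real.pi)))
  have hN0 : (0 : ℝ) < N := lt_of_le_of_lt (le_max_left _ _) hN
  have hπ := Real.pi_pos
  set P : ℝ := N * (2 / Real.pi) with hP
  have hP0 : 0 < P := by positivity
  have hTP : T ≤ P := by
    have : T / (2 / Real.pi) < N := lt_of_le_of_lt (le_max_right _ _) hN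
    rw [div_lt_iff₀ (by positivity)] at this
    exact this.le
  have hvm : ∀ k : ℕ+, MemLp (fun τ => ((Real.sqrt P)⁻¹ : ℂ) * phase k τ) 2
      (volume.restrict (Ioc 0 P)) := fun k => by
    refine MemLp.of_bound (Continuous.aestronglyMeasurable (by fun_prop)) (Real.sqrt P)⁻¹
      (Filter.Eventually.of_forall fun τ => ?_)
    rw [norm_mul, norm_phase, mul_one, norm_inv, Complex.norm_real,
      Real.norm_of_nonneg (Real.sqrt_nonneg _)]
  let v : ℕ+ → Lp ℂ 2 (volume.restrict (Ioc 0 P)) := fun k => (hvm k).toLp _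
  have hinner : ∀ k (g : Lp ℂ 2 (volume.restrict (Ioc 0 P))),
      inner ℂ (v k) g = ((Real.sqrt P)⁻¹ : ℂ) * ∫ τ in Ioc 0 P, phase k (-τ) * g τ := fun k g => by
    rw [L2.inner_def, ← integral_const_mul]
    refine integral_congr_ae ?_
    filter_upwards [(hvm k).coeFn_toLp] with τ hτ
    rw [RCLike.inner_apply, hτ, map_mul, conj_phase, map_inv₀, Complex.conj_ofReal]
    ring
  have hsq : (Real.sqrt P : ℂ) * Real.sqrt P = P := by
    rw [← Complex.ofReal_mul, Real.mul_self_sqrt hP0.le]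
  have hsq0 : (Real.sqrt P : ℂ) ≠ 0 := by
    exact_mod_cast (Real.sqrt_pos.2 hP0).ne'
  have hv : Orthonormal ℂ v := by
    rw [orthonormal_iff_ite]
    intro j k
    have e : ∫ τ in Ioc 0 P, phase j (-τ) * v k τ
        = ((Real.sqrt P)⁻¹ : ℂ) * ∫ τ in (0 : ℝ)..P, phase j (-τ) * phase k τ := by
      rw [intervalIntegral.integral_of_le hP0.le, ← integral_const_mul]
      refine integral_congr_ae ?_
      filter_upwards [(hvm k).coeFn_toLp] with τ hτ
      rw [hτ]; ring
    rw [hinner, e]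
    split_ifs with hjk
    · subst hjk
      have : ∀ τ, phase j (-τ) * phase j τ = 1 := fun τ => by
        rw [← phase_add, neg_add_cancel, phase_zero]
      simp only [this]
      rw [intervalIntegral.integral_const, sub_zero, Complex.real_smul, mul_one, ← hsq]
      field_simp
    · rw [integral_phase_mul hjk]; simp
  -- The factor `√P` undoes the normalization of the phases. It does not depend on `a` and `b`,
  -- because `h` is extended by zero from `(a,b]` to `(0,P]`.
  refine ⟨Real.sqrt P, Real.sqrt_nonneg _, fun h hh a b ha hab hbT => ?_⟩
  have hsub : Ioc a b ⊆ Ioc 0 P := fun x hx => ⟨lt_of_le_of_lt ha hx.1, hx.2.trans (hbT.trans hTP)⟩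
  have hh' := memLp_Ioc_of_memLp_Ioo hh ha hbT
  have hgm : MemLp ((Ioc a b).indicator h) 2 (volume.restrict (Ioc 0 P)) := by
    rw [memLp_indicator_iff_restrict measurableSet_Ioc,
      Measure.restrict_restrict measurableSet_Ioc, inter_eq_self_of_subset_left hsub]
    exact hh'
  set g : Lp ℂ 2 (volume.restrict (Ioc 0 P)) := hgm.toLp _ with hg
  have hcoef : ∀ k, ∫ τ in a..b, phase k (-τ) * h τ = (Real.sqrt P : ℂ) * inner ℂ (v k) g := by
    intro k
    rw [hinner, ← mul_assoc, mul_inv_cancel₀ hsq0, one_mul, intervalIntegral.integral_of_le hab]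
    have : ∫ τ in Ioc 0 P, phase k (-τ) * g τ
        = ∫ τ in Ioc 0 P, (Ioc a b).indicator (fun τ => phase k (-τ) * h τ) τ := by
      refine integral_congr_ae ?_
      filter_upwards [hgm.coeFn_toLp] with τ hτ
      rw [hτ]
      by_cases hx : τ ∈ Ioc a b <;> simp [hx]
    rw [this, setIntegral_indicator measurableSet_Ioc, inter_eq_self_of_subset_right hsub]
  have hnorm : ‖g‖ ^ 2 = ∫ τ in a..b, ‖h τ‖ ^ 2 := by
    have h1 : ((‖g‖ ^ 2 : ℝ) : ℂ) = inner ℂ g g := by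
      rw [inner_self_eq_norm_sq_to_K]; push_cast; rfl
    have h2 : inner ℂ g g = ((∫ τ in a..b, ‖h τ‖ ^ 2 : ℝ) : ℂ) := by
      rw [L2.inner_def, intervalIntegral.integral_of_le hab, ← integral_complex_ofReal]
      have : ∫ τ in Ioc 0 P, inner ℂ (g τ) (g τ)
          = ∫ τ in Ioc 0 P, (Ioc a b).indicator (fun τ => ((‖h τ‖ ^ 2 : ℝ) : ℂ)) τ := by
        refine integral_congr_ae ?_
        filter_upwards [hgm.coeFn_toLp] with τ hτ
        rw [hτ, inner_self_eq_norm_sq_to_K]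
        by_cases hx : τ ∈ Ioc a b <;> simp [hx]
      rw [this, setIntegral_indicator measurableSet_Ioc, inter_eq_self_of_subset_right hsub]
    exact_mod_cast h1.trans h2
  have hs := hv.inner_products_summable g
  have hn : ∀ k, ‖(Real.sqrt P : ℂ) * inner ℂ (v k) g‖ ^ 2 = P * ‖inner ℂ (v k) g‖ ^ 2 := fun k => by
    rw [norm_mul, mul_pow, Complex.norm_real, Real.norm_of_nonneg (Real.sqrt_nonneg _),
      Real.sq_sqrt hP0.le]
  refine ⟨⟨fun k => (Real.sqrt P : ℂ) * inner ℂ (v k) g, memℓp_two_iff.2 ?_⟩,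
    fun k => (hcoef k).symm, ?_⟩
  · simp only [hn]
    exact hs.mul_left P
  · rw [← hnorm, Real.sqrt_sq (norm_nonneg _), ← sq_le_sq₀ (norm_nonneg _) (by positivity),
      Seq2.norm_sq_eq, mul_pow, Real.sq_sqrt hP0.le]
    change ∑' k, ‖(Real.sqrt P : ℂ) * inner ℂ (v k) g‖ ^ 2 ≤ _
    simp only [hn]
    rw [tsum_mul_left]
    gcongr
    exact hv.tsum_inner_products_le g

theorem integral_norm_le_sqrt {V : Type*} [NormedAddCommGroup V] {h : ℝ → V} {a b : ℝ}
    (hab : a ≤ b) (hh : MemLp h 2 (volume.restrict (Ioc a b))) :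
    ∫ τ in a..b, ‖h τ‖ ≤ Real.sqrt (b - a) * Real.sqrt (∫ τ in a..b, ‖h τ‖ ^ 2) := by
  rw [intervalIntegral.integral_of_le hab, intervalIntegral.integral_of_le hab]
  have := integral_mul_norm_le_Lp_mul_Lq (μ := volume.restrict (Ioc a b)) (f := fun _ => (1 : ℝ))
    (g := fun τ => ‖h τ‖) (p := 2) (q := 2) (by rw [Real.holderConjugate_iff]; norm_num)
    (memLp_const 1) (by simpa using hh.norm)
  simp only [norm_one, one_mul, norm_norm, Real.rpow_two,
    ← Real.sqrt_eq_rpow] at this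
  refine this.trans_eq ?_
  simp [hab]

theorem sqrt_integral_mono {V W : Type*} [NormedAddCommGroup V] [NormedAddCommGroup W]
    {h : ℝ → V} {h' : ℝ → W} {a b : ℝ} (hab : a ≤ b)
    (hh : MemLp h 2 (volume.restrict (Ioc a b))) (hh' : MemLp h' 2 (volume.restrict (Ioc a b)))
    (hle : ∀ τ, ‖h τ‖ ≤ ‖h' τ‖) :
    Real.sqrt (∫ τ in a..b, ‖h τ‖ ^ 2) ≤ Real.sqrt (∫ τ in a..b, ‖h' τ‖ ^ 2) := by
  refine Real.sqrt_le_sqrt ?_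
  rw [intervalIntegral.integral_of_le hab, intervalIntegral.integral_of_le hab]
  refine integral_mono ((memLp_two_iff_integrable_sq_norm hh.1).1 hh)
    ((memLp_two_iff_integrable_sq_norm hh'.1).1 hh') fun τ => ?_
  exact pow_le_pow_left₀ (norm_nonneg _) (hle τ) 2

theorem intervalIntegrable_phaseMap {γ : ℝ → Seq2} {a b : ℝ} (hab : a ≤ b)
    (hγ : MemLp γ 2 (volume.restrict (Ioc a b))) :
    IntervalIntegrable (fun τ => phaseMap (-τ) (γ τ)) volume a b := by
  rw [intervalIntegrable_iff_integrableOn_Ioc_of_le hab]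
  refine Integrable.mono (hγ.integrable one_le_two)
    (Continuous.comp_aestronglyMeasurable₂ (g := fun (t : ℝ) (x : Seq2) => phaseMap t x)
      continuous_phaseMap continuous_neg.aestronglyMeasurable hγ.1) ?_
  filter_upwards with τ
  rw [LinearIsometry.norm_map]

/-- The smoothing estimate: for a square integrable family of expansions, the integrals of the
terms against the phases are square summable. -/
theorem exists_seq_integral (T : ℝ) : ∃ K : ℝ, 0 ≤ K ∧ ∀ e : ℝ → Expansion,
    MemLp e 2 (volume.restrict (Ioo 0 T)) → ∀ a b : ℝ, 0 ≤ a → a ≤ b → b ≤ T →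
    ∃ y : Seq2, (∀ k, y k = ∫ τ in a..b, phase k (-τ) * term k (e τ)) ∧
      ‖y‖ ≤ K * Real.sqrt (∫ τ in a..b, ‖e τ‖ ^ 2) := by
  obtain ⟨K, hK0, hK⟩ := exists_bessel_phase T
  -- One Bessel constant for each of the two boundary terms; `√T` comes from Cauchy–Schwarz in time
  -- for the `ℓ²`-valued remainder, which needs no smoothing.
  refine ⟨K + K + Real.sqrt T, by positivity, fun e he a b ha hab hbT => ?_⟩
  have he1 : MemLp (fun τ => (e τ).1) 2 (volume.restrict (Ioo 0 T)) :=
    he.of_le (continuous_fst.comp_aestronglyMeasurable he.1)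
      (Filter.Eventually.of_forall fun τ => norm_fst_le _)
  have he' : MemLp (fun τ => (e τ).2) 2 (volume.restrict (Ioo 0 T)) :=
    he.of_le (continuous_snd.comp_aestronglyMeasurable he.1)
      (Filter.Eventually.of_forall fun τ => norm_snd_le _)
  have he2 : MemLp (fun τ => (e τ).2.1) 2 (volume.restrict (Ioo 0 T)) :=
    he'.of_le (continuous_fst.comp_aestronglyMeasurable he'.1)
      (Filter.Eventually.of_forall fun τ => norm_fst_le _)
  have he3 : MemLp (fun τ => (e τ).2.2) 2 (volume.restrict (Ioo 0 T)) :=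
    he'.of_le (continuous_snd.comp_aestronglyMeasurable he'.1)
      (Filter.Eventually.of_forall fun τ => norm_snd_le _)
  obtain ⟨y1, hy1, hn1⟩ := hK _ he1 a b ha hab hbT
  obtain ⟨y2, hy2, hn2⟩ := hK _ he2 a b ha hab hbT
  have hI := memLp_Ioc_of_memLp_Ioo he ha hbT
  have hI1 := memLp_Ioc_of_memLp_Ioo he1 ha hbT
  have hI2 := memLp_Ioc_of_memLp_Ioo he2 ha hbT
  have hI3 := memLp_Ioc_of_memLp_Ioo he3 ha hbT
  let y2' : Seq2 := ⟨fun k => (-1) ^ (k : ℕ) * y2 k, memℓp_two_iff.2 (by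
    simpa using y2.summable_sq)⟩
  have hy2' : ‖y2'‖ = ‖y2‖ := by
    rw [← sq_eq_sq₀ (norm_nonneg _) (norm_nonneg _), Seq2.norm_sq_eq, Seq2.norm_sq_eq]
    simp [y2']
  have hint3 := intervalIntegrable_phaseMap hab hI3
  let y3 : Seq2 := ∫ τ in a..b, phaseMap (-τ) (e τ).2.2
  have hy3 : ∀ k, y3 k = ∫ τ in a..b, phase k (-τ) * (e τ).2.2 k := fun k =>
    ((lp.evalCLM ℂ (fun _ : ℕ+ => ℂ) 2 k).intervalIntegral_comp_comm hint3).symm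
  have hn3 : ‖y3‖ ≤ Real.sqrt T * Real.sqrt (∫ τ in a..b, ‖(e τ).2.2‖ ^ 2) := by
    refine (intervalIntegral.norm_integral_le_integral_norm hab).trans ?_
    simp only [LinearIsometry.norm_map]
    refine (integral_norm_le_sqrt hab hI3).trans ?_
    gcongr
    linarith
  refine ⟨y1 + (y2' + y3), fun k => ?_, ?_⟩
  · have i1 : IntervalIntegrable (fun τ => phase k (-τ) * (e τ).1) volume a b := by
      rw [intervalIntegrable_iff_integrableOn_Ioc_of_le hab]
      exact (hI1.integrable (by norm_num)).bdd_mul (c := 1)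
        (Continuous.aestronglyMeasurable (by fun_prop))
        (Filter.Eventually.of_forall fun τ => by simp)
    have i2 : IntervalIntegrable (fun τ => phase k (-τ) * (e τ).2.1) volume a b := by
      rw [intervalIntegrable_iff_integrableOn_Ioc_of_le hab]
      exact (hI2.integrable (by norm_num)).bdd_mul (c := 1)
        (Continuous.aestronglyMeasurable (by fun_prop))
        (Filter.Eventually.of_forall fun τ => by simp)
    have i3 : IntervalIntegrable (fun τ => phase k (-τ) * (e τ).2.2 k) volume a b := by
      rw [intervalIntegrable_iff_integrableOn_Ioc_of_le hab] at hint3 ⊢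
      exact (lp.evalCLM ℂ (fun _ : ℕ+ => ℂ) 2 k).integrable_comp hint3
    change y1 k + ((-1) ^ (k : ℕ) * y2 k + y3 k) = _
    rw [hy1, hy2, hy3, ← intervalIntegral.integral_const_mul,
      ← intervalIntegral.integral_add (i2.const_mul _) i3,
      ← intervalIntegral.integral_add i1 ((i2.const_mul _).add i3)]
    congr 1; funext τ
    rw [term_apply]; ring
  · have m1 := sqrt_integral_mono hab hI1 hI fun τ => norm_fst_le (e τ)
    have m2 := sqrt_integral_mono hab hI2 hI fun τ =>
      (norm_fst_le (e τ).2).trans (norm_snd_le (e τ))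
    have m3 := sqrt_integral_mono hab hI3 hI fun τ =>
      (norm_snd_le (e τ).2).trans (norm_snd_le (e τ))
    refine (norm_add_le _ _).trans ((add_le_add_right (norm_add_le _ _) _).trans ?_)
    rw [hy2']
    have s1 := hn1.trans (mul_le_mul_of_nonneg_left m1 hK0)
    have s2 := hn2.trans (mul_le_mul_of_nonneg_left m2 hK0)
    have s3 := hn3.trans (mul_le_mul_of_nonneg_left m3 (Real.sqrt_nonneg T))
    rw [add_mul, add_mul]
    linarith

theorem intervalIntegrable_phase_mul_term {T : ℝ} {e : ℝ → Expansion}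
    (he : MemLp e 2 (volume.restrict (Ioo 0 T))) {a b : ℝ} (ha : 0 ≤ a) (hab : a ≤ b)
    (hb : b ≤ T) (k : ℕ+) (s : ℝ) :
    IntervalIntegrable (fun τ => phase k (s - τ) * term k (e τ)) volume a b := by
  have hI := memLp_Ioc_of_memLp_Ioo he ha hb
  rw [intervalIntegrable_iff_integrableOn_Ioc_of_le hab]
  exact ((term k).integrable_comp (hI.integrable (by norm_num))).bdd_mul (c := 1)
    (Continuous.aestronglyMeasurable (by fun_prop))
    (Filter.Eventually.of_forall fun τ => by simp)

/-- The Duhamel term is a continuous function of the time with values in the sequence space. -/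
theorem exists_continuous_integral (T : ℝ) : ∃ K : ℝ, 0 ≤ K ∧ ∀ e : ℝ → Expansion,
    MemLp e 2 (volume.restrict (Ioo 0 T)) →
    ∃ Y : C(Icc (0 : ℝ) T, Seq2), ∀ t : Icc (0 : ℝ) T,
      (∀ k, Y t k = ∫ τ in (0 : ℝ)..t, phase k (-τ) * term k (e τ)) ∧
      ‖Y t‖ ≤ K * Real.sqrt (∫ τ in (0 : ℝ)..t, ‖e τ‖ ^ 2) := by
  obtain ⟨K, hK0, hK⟩ := exists_seq_integral T
  refine ⟨K, hK0, fun e he => ?_⟩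
  have hex : ∀ t : Icc (0 : ℝ) T, ∃ y : Seq2,
      (∀ k, y k = ∫ τ in (0 : ℝ)..t, phase k (-τ) * term k (e τ)) ∧
      ‖y‖ ≤ K * Real.sqrt (∫ τ in (0 : ℝ)..t, ‖e τ‖ ^ 2) := fun t =>
    hK e he 0 t le_rfl t.2.1 t.2.2
  choose Y hY using hex
  have hsq : ∀ s t : Icc (0 : ℝ) T, s ≤ t →
      IntervalIntegrable (fun τ => ‖e τ‖ ^ 2) volume s t := fun s t hst => by
    have hI := memLp_Ioc_of_memLp_Ioo he s.2.1 t.2.2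
    rw [intervalIntegrable_iff_integrableOn_Ioc_of_le hst]
    exact (memLp_two_iff_integrable_sq_norm hI.1).1 hI
  set V : Icc (0 : ℝ) T → ℝ := fun t => ∫ τ in (0 : ℝ)..t, ‖e τ‖ ^ 2 with hV
  have hVc : Continuous V := by
    -- The sign of `T` is not assumed here; for `T < 0` the time interval is empty.
    rcases isEmpty_or_nonempty (Icc (0 : ℝ) T) with h | ⟨⟨t₀, ht₀⟩⟩
    · exact continuous_of_discreteTopology
    have hT : 0 ≤ T := ht₀.1.trans ht₀.2
    have h1 := hsq ⟨0, by simp [hT]⟩ ⟨T, by simp [hT]⟩ hT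
    have h2 : IntegrableOn (fun τ => ‖e τ‖ ^ 2) (uIcc 0 T) := by
      rw [uIcc_of_le hT, integrableOn_Icc_iff_integrableOn_Ioc]
      exact (intervalIntegrable_iff_integrableOn_Ioc_of_le hT).1 h1
    have := intervalIntegral.continuousOn_primitive_interval h2
    rw [uIcc_of_le hT] at this
    exact continuousOn_iff_continuous_domRestrict.1 this
  -- The increment `Y t - Y s` is the same integral over `[s,t]`, so the uniform bound on
  -- subintervals yields a modulus of continuity in terms of the continuous `V`.
  have hle : ∀ s t : Icc (0 : ℝ) T, s ≤ t → ‖Y t - Y s‖ ≤ K * Real.sqrt (|V t - V s|) := by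
    intro s t hst
    obtain ⟨y, hy, hn⟩ := hK e he s t s.2.1 hst t.2.2
    have hzs : IntervalIntegrable (fun τ => ‖e τ‖ ^ 2) volume 0 s :=
      hsq ⟨0, le_rfl, s.2.1.trans s.2.2⟩ s s.2.1
    have e1 : Y t - Y s = y := by
      ext k
      have i1 := intervalIntegrable_phase_mul_term he le_rfl s.2.1 s.2.2 k 0
      have i2 := intervalIntegrable_phase_mul_term he s.2.1 hst t.2.2 k 0
      simp only [zero_sub] at i1 i2
      have := intervalIntegral.integral_add_adjacent_intervals i1 i2
      rw [lp.coeFn_sub, Pi.sub_apply, (hY t).1, (hY s).1, hy, ← this]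
      ring
    have e2 : V t - V s = ∫ τ in (s : ℝ)..t, ‖e τ‖ ^ 2 := by
      have := intervalIntegral.integral_add_adjacent_intervals hzs (hsq s t hst)
      simp only [hV]
      rw [← this]; ring
    rw [e1]
    refine hn.trans ?_
    rw [e2]
    gcongr
    exact le_abs_self _
  refine ⟨⟨Y, ?_⟩, hY⟩
  rw [continuous_iff_continuousAt]
  intro s
  rw [ContinuousAt, tendsto_iff_norm_sub_tendsto_zero]
  have hlim : Filter.Tendsto (fun t => K * Real.sqrt |V t - V s|) (nhds s) (nhds 0) := by
    have hc : Continuous fun t => K * Real.sqrt |V t - V s| := by fun_prop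
    simpa using hc.tendsto s
  refine squeeze_zero (fun t => norm_nonneg _) (fun t => ?_) hlim
  rcases le_total s t with h | h
  · exact hle s t h
  · rw [norm_sub_rev, abs_sub_comm]; exact hle t s h

/-! ### A weighted contraction -/

section Contraction

variable {X V : Type*} [TopologicalSpace X] [CompactSpace X] [NormedAddCommGroup V]
  [NormedSpace ℝ V]

/-- Multiplication of a function by a continuous weight. -/
def weightMul (w : C(X, ℝ)) (x : C(X, V)) : C(X, V) := ⟨fun t => w t • x t, by fun_prop⟩

/-- Conjugation with multiplication by `w` turns the weighted hypothesis into a contraction with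
factor `1/2` for the supremum norm. -/
theorem existsUnique_fixedPoint_of_weight [CompleteSpace V] (F : C(X, V) → C(X, V)) (w : C(X, ℝ))
    (hw : ∀ t, 0 < w t)
    (hF : ∀ x x' d, 0 ≤ d → (∀ t, ‖x t - x' t‖ ≤ d * w t) → ∀ t, ‖F x t - F x' t‖ ≤ d / 2 * w t) :
    ∃! x, F x = x := by
  let w' : C(X, ℝ) := ⟨fun t => (w t)⁻¹, w.continuous.inv₀ fun t => (hw t).ne'⟩
  have h1 : ∀ x : C(X, V), weightMul w (weightMul w' x) = x := fun x => by
    ext t; simp [weightMul, w', (hw t).ne']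
  have h2 : ∀ x : C(X, V), weightMul w' (weightMul w x) = x := fun x => by
    ext t; simp [weightMul, w', (hw t).ne']
  have hc : ContractingWith (1 / 2) fun z => weightMul w' (F (weightMul w z)) := by
    refine ⟨by norm_num, LipschitzWith.of_dist_le_mul fun z z' => ?_⟩
    rw [ContinuousMap.dist_le (by positivity)]
    intro t
    have hd : ∀ t, ‖weightMul w z t - weightMul w z' t‖ ≤ dist z z' * w t := fun t => by
      change ‖w t • z t - w t • z' t‖ ≤ _
      rw [← smul_sub, norm_smul, Real.norm_of_nonneg (hw t).le, mul_comm, ← dist_eq_norm]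
      exact mul_le_mul_of_nonneg_right (ContinuousMap.dist_apply_le_dist t) (hw t).le
    have := hF _ _ _ dist_nonneg hd t
    change dist ((w t)⁻¹ • F (weightMul w z) t) ((w t)⁻¹ • F (weightMul w z') t) ≤ _
    rw [dist_eq_norm, ← smul_sub, norm_smul, norm_inv, Real.norm_of_nonneg (hw t).le,
      inv_mul_le_iff₀ (hw t)]
    refine this.trans_eq ?_
    push_cast; ring
  refine ⟨weightMul w (ContractingWith.fixedPoint _ hc), ?_, fun x hx => ?_⟩
  · have := hc.fixedPoint_isFixedPt
    have h3 := congrArg (weightMul w) this.eq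
    simpa only [h1] using h3
  · have : Function.IsFixedPt (fun z => weightMul w' (F (weightMul w z))) (weightMul w' x) := by
      change weightMul w' (F (weightMul w (weightMul w' x))) = _
      rw [h1, hx]
    rw [← hc.fixedPoint_unique this, h1]

/-- With `z = x / w`, comparing `x = F x` with `F 0` gives `‖z‖ ≤ ‖z‖ / 2 + A`, that is, `‖z‖ ≤ 2A`.
-/
theorem norm_fixedPoint_le_of_weight (F : C(X, V) → C(X, V)) (w : C(X, ℝ)) (hw : ∀ t, 1 ≤ w t)
    (hF : ∀ x x' d, 0 ≤ d → (∀ t, ‖x t - x' t‖ ≤ d * w t) → ∀ t, ‖F x t - F x' t‖ ≤ d / 2 * w t)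
    {x : C(X, V)} (hx : F x = x) {A : ℝ} (hA0 : 0 ≤ A) (hA : ∀ t, ‖F 0 t‖ ≤ A) (t : X) :
    ‖x t‖ ≤ 2 * A * w t := by
  have hw0 : ∀ t, 0 < w t := fun t => zero_lt_one.trans_le (hw t)
  let z : C(X, V) :=
    weightMul ⟨fun t => (w t)⁻¹, w.continuous.inv₀ fun t => (hw0 t).ne'⟩ x
  have hz : ∀ t, ‖z t‖ = (w t)⁻¹ * ‖x t‖ := fun t => by
    change ‖(w t)⁻¹ • x t‖ = _
    rw [norm_smul, norm_inv, Real.norm_of_nonneg (hw0 t).le]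
  have hxz : ∀ t, ‖x t‖ ≤ ‖z‖ * w t := fun t => by
    have := z.norm_coe_le_norm t
    rw [hz, inv_mul_le_iff₀ (hw0 t)] at this
    linarith
  have hle : ‖z‖ ≤ ‖z‖ / 2 + A := by
    refine (ContinuousMap.norm_le _ (by positivity)).2 fun t => ?_
    have h1 := hF x 0 ‖z‖ (norm_nonneg _) (by simpa using hxz) t
    rw [hx] at h1
    rw [hz, inv_mul_le_iff₀ (hw0 t)]
    have h2 : ‖x t‖ ≤ ‖x t - F 0 t‖ + ‖F 0 t‖ := by
      simpa using norm_add_le (x t - F 0 t) (F 0 t)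
    have h3 : A ≤ w t * A := le_mul_of_one_le_left hA0 (hw t)
    have := hA t
    nlinarith
  refine (hxz t).trans (mul_le_mul_of_nonneg_right (by linarith) (hw0 t).le)

end Contraction

/-- The weight `e^{cV}`, where `V` is the primitive of `v ≥ 0`, satisfies `∫ v e^{cV} ≤ e^{cV}/c`. -/
theorem integral_mul_exp_primitive_le {v : ℝ → ℝ} {t c : ℝ} (ht : 0 ≤ t) (hc : 0 < c)
    (hv : IntervalIntegrable v volume 0 t) (hv0 : ∀ τ, 0 ≤ v τ) :
    IntervalIntegrable (fun τ => v τ * Real.exp (c * ∫ σ in (0 : ℝ)..τ, v σ)) volume 0 t ∧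
    ∫ τ in (0 : ℝ)..t, v τ * Real.exp (c * ∫ σ in (0 : ℝ)..τ, v σ) ≤
      Real.exp (c * ∫ σ in (0 : ℝ)..t, v σ) / c := by
  set V : ℝ → ℝ := fun τ => ∫ σ in (0 : ℝ)..τ, v σ with hV
  have hVmono : MonotoneOn V (uIcc 0 t) := by
    rw [uIcc_of_le ht]
    intro a ha b hb hab
    have i1 : IntervalIntegrable v volume 0 a := hv.mono_set (by
      rw [uIcc_of_le ht, uIcc_of_le ha.1]; exact Icc_subset_Icc_right ha.2)
    have i2 : IntervalIntegrable v volume a b := hv.mono_set (by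
      rw [uIcc_of_le ht, uIcc_of_le hab]; exact Icc_subset_Icc ha.1 hb.2)
    have := intervalIntegral.integral_add_adjacent_intervals i1 i2
    have h0 : 0 ≤ ∫ σ in a..b, v σ := intervalIntegral.integral_nonneg hab fun σ _ => hv0 σ
    simp only [hV]; linarith
  have hmono : MonotoneOn (fun τ => Real.exp (c * V τ)) (uIcc 0 t) := fun a ha b hb hab =>
    Real.exp_le_exp.2 (mul_le_mul_of_nonneg_left (hVmono ha hb hab) hc.le)
  have hder : ∀ᵐ τ, τ ∈ uIcc 0 t →
      deriv (fun τ => Real.exp (c * V τ)) τ = c * (v τ * Real.exp (c * V τ)) := by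
    filter_upwards [hv.ae_hasDerivAt_integral] with τ hτ hτ'
    have h1 := ((hτ hτ' 0 (by simp)).const_mul c).exp
    rw [h1.deriv]; simp only [hV]; ring
  -- Monotonicity already gives that the integral of the almost everywhere derivative is at most the
  -- increment; only this inequality is needed.
  have hmem := hmono.intervalIntegral_deriv_mem_uIcc
  have hint := hmono.intervalIntegrable_deriv
  have e1 : ∫ τ in (0 : ℝ)..t, deriv (fun τ => Real.exp (c * V τ)) τ
      = ∫ τ in (0 : ℝ)..t, c * (v τ * Real.exp (c * V τ)) := by
    refine intervalIntegral.integral_congr_ae ?_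
    filter_upwards [hder] with τ hτ hτ'
    exact hτ (uIoc_subset_uIcc hτ')
  have hint' : IntervalIntegrable (fun τ => c * (v τ * Real.exp (c * V τ))) volume 0 t := by
    refine hint.congr_ae ?_
    rw [Filter.EventuallyEq, ae_restrict_iff' measurableSet_uIoc]
    filter_upwards [hder] with τ hτ hτ'
    exact hτ (uIoc_subset_uIcc hτ')
  constructor
  · have := hint'.const_mul c⁻¹
    refine this.congr (fun τ _ => ?_)
    field_simp
    rfl
  · have hle : Real.exp (c * V 0) ≤ Real.exp (c * V t) := hmono (by simp) (by simp) ht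
    rw [uIcc_of_le (by linarith), e1, intervalIntegral.integral_const_mul] at hmem
    rw [le_div_iff₀ hc, mul_comm]
    have := hmem.2
    have := Real.exp_pos (c * V 0)
    linarith

/-! ### The equation for the weighted coefficients -/

theorem continuous_phaseMap_comp {X : Type*} [TopologicalSpace X] {f : X → ℝ} {g : X → Seq2}
    (hf : Continuous f) (hg : Continuous g) : Continuous fun t => phaseMap (f t) (g t) :=
  Continuous.comp₂ (g := fun p : ℝ × Seq2 => phaseMap p.1 p.2) continuous_phaseMap hf hg

/-- The forcing term of the equation, as an expansion. -/
def force {T : ℝ} (hT : 0 < T) (M : Seq2 →L[ℂ] Expansion) (u : ℝ → ℝ) (g : ℝ → Expansion)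
    (x : C(Icc (0 : ℝ) T, Seq2)) (τ : ℝ) : Expansion :=
  (u τ : ℂ) • M (IccExtend hT.le x τ) + g τ

theorem memLp_force {T : ℝ} (hT : 0 < T) (M : Seq2 →L[ℂ] Expansion) {u : ℝ → ℝ}
    {g : ℝ → Expansion} (hu : MemLp u 2 (volume.restrict (Ioo 0 T)))
    (hg : MemLp g 2 (volume.restrict (Ioo 0 T))) (x : C(Icc (0 : ℝ) T, Seq2)) :
    MemLp (force hT M u g x) 2 (volume.restrict (Ioo 0 T)) := by
  have hc : Continuous fun τ => M (IccExtend hT.le x τ) :=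
    M.continuous.comp x.continuous.Icc_extend'
  have h1 : MemLp (fun τ => (u τ : ℂ) • M (IccExtend hT.le x τ)) 2
      (volume.restrict (Ioo 0 T)) := by
    refine hu.of_le_mul (c := ‖M‖ * ‖x‖)
      ((Complex.continuous_ofReal.comp_aestronglyMeasurable hu.1).smul
        hc.aestronglyMeasurable) (Filter.Eventually.of_forall fun τ => ?_)
    rw [norm_smul, Complex.norm_real, mul_comm]
    gcongr
    exact M.le_of_opNorm_le_of_le le_rfl (x.norm_coe_le_norm _)
  exact h1.add hg

/-- The equation satisfied by the weighted coefficients of the weak solution. -/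
def IsSeqSolution {T : ℝ} (hT : 0 < T) (M : Seq2 →L[ℂ] Expansion) (u : ℝ → ℝ)
    (g : ℝ → Expansion) (x₀ : Seq2) (x : C(Icc (0 : ℝ) T, Seq2)) : Prop :=
  ∀ (t : Icc (0 : ℝ) T) (k : ℕ+), x t k = phase k t *
    (x₀ k + Complex.I * ∫ τ in (0 : ℝ)..t, phase k (-τ) * term k (force hT M u g x τ))

/-- The constants `K` and `c` depend only on `T` and `M`. The size of `u` enters only through the
weight, so neither a smallness assumption nor a subdivision of `[0,T]` is needed. -/
theorem exists_seqSolution {T : ℝ} (hT : 0 < T) (M : Seq2 →L[ℂ] Expansion) :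
    ∃ K c : ℝ, 0 ≤ K ∧ 0 < c ∧ ∀ (u : ℝ → ℝ) (g : ℝ → Expansion) (x₀ : Seq2),
      MemLp u 2 (volume.restrict (Ioo 0 T)) → MemLp g 2 (volume.restrict (Ioo 0 T)) →
      (∃! x, IsSeqSolution hT M u g x₀ x) ∧
      ∀ x, IsSeqSolution hT M u g x₀ x → ∀ t, ‖x t‖ ≤
        2 * (‖x₀‖ + K * Real.sqrt (∫ τ in (0 : ℝ)..T, ‖g τ‖ ^ 2)) *
          Real.exp (c * ∫ τ in (0 : ℝ)..T, u τ ^ 2) := by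
  obtain ⟨K, hK0, hK⟩ := exists_continuous_integral T
  -- Chosen so that `K²‖M‖² / (2c) ≤ 1/4`, the square of the contraction factor; the `+ 1` keeps `c`
  -- positive.
  set c : ℝ := 2 * K ^ 2 * ‖M‖ ^ 2 + 1 with hc
  have hc0 : 0 < c := by positivity
  refine ⟨K, c, hK0, hc0, fun u g x₀ hu hg => ?_⟩
  have hforce := memLp_force hT M hu hg
  choose Y hY using fun x => hK _ (hforce x)
  let F : C(Icc (0 : ℝ) T, Seq2) → C(Icc (0 : ℝ) T, Seq2) := fun x =>
    ⟨fun t => phaseMap t (x₀ + Complex.I • Y x t), continuous_phaseMap_comp continuous_subtype_val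
      (continuous_const.add ((Y x).continuous.fun_const_smul _))⟩
  have hFsol : ∀ x, IsSeqSolution hT M u g x₀ x ↔ F x = x := by
    intro x
    rw [eq_comm, ContinuousMap.ext_iff]
    refine forall_congr' fun t => ?_
    rw [lp.ext_iff, funext_iff]
    refine forall_congr' fun k => ?_
    rw [← ((hY x) t).1 k]
    rfl
  have hu2 : IntervalIntegrable (fun τ => u τ ^ 2) volume 0 T := by
    rw [intervalIntegrable_iff_integrableOn_Ioo_of_le hT.le]
    exact hu.integrable_sq
  have hu2' : ∀ t : Icc (0 : ℝ) T, IntervalIntegrable (fun τ => u τ ^ 2) volume 0 t := fun t =>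
    hu2.mono_set (by rw [uIcc_of_le hT.le, uIcc_of_le t.2.1]; exact Icc_subset_Icc_right t.2.2)
  have hUc : Continuous fun t : Icc (0 : ℝ) T => ∫ τ in (0 : ℝ)..t, u τ ^ 2 := by
    have h2 : IntegrableOn (fun τ => u τ ^ 2) (uIcc 0 T) := by
      rw [uIcc_of_le hT.le, integrableOn_Icc_iff_integrableOn_Ioc]
      exact (intervalIntegrable_iff_integrableOn_Ioc_of_le hT.le).1 hu2
    have := intervalIntegral.continuousOn_primitive_interval h2
    rw [uIcc_of_le hT.le] at this
    exact continuousOn_iff_continuous_domRestrict.1 this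
  let w : C(Icc (0 : ℝ) T, ℝ) := ⟨fun t => Real.exp (c * ∫ τ in (0 : ℝ)..t, u τ ^ 2), by fun_prop⟩
  have hw1 : ∀ t, 1 ≤ w t := fun t => Real.one_le_exp (mul_nonneg hc0.le
    (intervalIntegral.integral_nonneg t.2.1 fun τ _ => sq_nonneg _))
  have hFc : ∀ x x' d, 0 ≤ d → (∀ t, ‖x t - x' t‖ ≤ d * w t) →
      ∀ t, ‖F x t - F x' t‖ ≤ d / 2 * w t := by
    intro x x' d hd hxx t
    have e1 : ‖F x t - F x' t‖ = ‖Y x t - Y x' t‖ := by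
      change ‖phaseMap t _ - phaseMap t _‖ = _
      rw [← map_sub, LinearIsometry.norm_map, add_sub_add_left_eq_sub, ← smul_sub, norm_smul]
      simp
    -- `Y` comes from a choice, so its additivity is recovered coefficientwise: `D`, built from the
    -- difference of the forces, equals `Y x - Y x'` at every `t`.
    have hdm := (hforce x).sub (hforce x')
    obtain ⟨D, hD⟩ := hK _ hdm
    have e2 : Y x t - Y x' t = D t := by
      ext k
      have i1 := intervalIntegrable_phase_mul_term (hforce x) le_rfl t.2.1 t.2.2 k 0
      have i2 := intervalIntegrable_phase_mul_term (hforce x') le_rfl t.2.1 t.2.2 k 0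
      simp only [zero_sub] at i1 i2
      rw [lp.coeFn_sub, Pi.sub_apply, (hY x t).1, (hY x' t).1, (hD t).1,
        ← intervalIntegral.integral_sub i1 i2]
      congr 1; funext τ
      rw [Pi.sub_apply, map_sub, mul_sub]
    -- The exponent is doubled because the smoothing estimate involves the square of the weight.
    obtain ⟨hwi, hwl⟩ := integral_mul_exp_primitive_le (c := 2 * c) t.2.1 (by positivity)
      (hu2' t) fun τ => sq_nonneg (u τ)
    have hsq : ∫ τ in (0 : ℝ)..t, ‖(force hT M u g x - force hT M u g x') τ‖ ^ 2
        ≤ ‖M‖ ^ 2 * d ^ 2 * (Real.exp (2 * c * ∫ τ in (0 : ℝ)..t, u τ ^ 2) / (2 * c)) := by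
      refine le_trans ?_ (mul_le_mul_of_nonneg_left hwl (by positivity))
      rw [← intervalIntegral.integral_const_mul]
      have hI := memLp_Ioc_of_memLp_Ioo hdm le_rfl t.2.2
      refine intervalIntegral.integral_mono_on t.2.1 ?_ (hwi.const_mul _) fun τ hτ => ?_
      · rw [intervalIntegrable_iff_integrableOn_Ioc_of_le t.2.1]
        exact (memLp_two_iff_integrable_sq_norm hI.1).1 hI
      have hτT : τ ∈ Icc 0 T := ⟨hτ.1, hτ.2.trans t.2.2⟩
      have e3 : (force hT M u g x - force hT M u g x') τ
          = (u τ : ℂ) • M (x ⟨τ, hτT⟩ - x' ⟨τ, hτT⟩) := by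
        rw [Pi.sub_apply, force, force, IccExtend_of_mem _ _ hτT, IccExtend_of_mem _ _ hτT,
          map_sub, smul_sub]
        abel
      have b1 : ‖M (x ⟨τ, hτT⟩ - x' ⟨τ, hτT⟩)‖ ≤
          ‖M‖ * (d * Real.exp (c * ∫ τ in (0 : ℝ)..τ, u τ ^ 2)) :=
        M.le_of_opNorm_le_of_le le_rfl (hxx ⟨τ, hτT⟩)
      rw [e3, norm_smul, Complex.norm_real, mul_pow, Real.norm_eq_abs, sq_abs]
      have e4 : Real.exp (2 * c * ∫ τ in (0 : ℝ)..τ, u τ ^ 2)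
          = Real.exp (c * ∫ τ in (0 : ℝ)..τ, u τ ^ 2) ^ 2 := by
        rw [← Real.exp_nat_mul]; congr 1; push_cast; ring
      rw [e4]
      calc u τ ^ 2 * ‖M (x ⟨τ, hτT⟩ - x' ⟨τ, hτT⟩)‖ ^ 2
          ≤ u τ ^ 2 * (‖M‖ * (d * Real.exp (c * ∫ τ in (0 : ℝ)..τ, u τ ^ 2))) ^ 2 := by gcongr
        _ = _ := by ring
    rw [e1, e2]
    refine (hD t).2.trans ?_
    have hwt : 0 < w t := zero_lt_one.trans_le (hw1 t)
    have e5 : Real.exp (2 * c * ∫ τ in (0 : ℝ)..t, u τ ^ 2) = w t ^ 2 := by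
      change _ = Real.exp (c * ∫ τ in (0 : ℝ)..t, u τ ^ 2) ^ 2
      rw [← Real.exp_nat_mul]; congr 1; push_cast; ring
    rw [e5] at hsq
    refine abs_le_of_sq_le_sq' ?_ (by positivity) |>.2
    rw [mul_pow, Real.sq_sqrt (intervalIntegral.integral_nonneg t.2.1 fun τ _ => sq_nonneg _)]
    calc K ^ 2 * _ ≤ K ^ 2 * (‖M‖ ^ 2 * d ^ 2 * (w t ^ 2 / (2 * c))) := by gcongr
      _ = (K ^ 2 * ‖M‖ ^ 2 / (2 * c)) * (d ^ 2 * w t ^ 2) := by ring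
      _ ≤ (1 / 4) * (d ^ 2 * w t ^ 2) := by
          refine mul_le_mul_of_nonneg_right ?_ (by positivity)
          rw [div_le_div_iff₀ (by positivity) (by norm_num), hc]
          nlinarith
      _ = (d / 2 * w t) ^ 2 := by ring
  constructor
  · simp only [hFsol]
    exact existsUnique_fixedPoint_of_weight F w (fun t => zero_lt_one.trans_le (hw1 t)) hFc
  · intro x hx t
    rw [hFsol] at hx
    set A : ℝ := ‖x₀‖ + K * Real.sqrt (∫ τ in (0 : ℝ)..T, ‖g τ‖ ^ 2) with hA
    have hA0 : 0 ≤ A := by positivity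
    have hgi : IntervalIntegrable (fun τ => ‖g τ‖ ^ 2) volume 0 T := by
      rw [intervalIntegrable_iff_integrableOn_Ioo_of_le hT.le]
      exact (memLp_two_iff_integrable_sq_norm hg.1).1 hg
    have hF0 : ∀ t, ‖F 0 t‖ ≤ A := fun t => by
      change ‖phaseMap t (x₀ + Complex.I • Y 0 t)‖ ≤ A
      rw [LinearIsometry.norm_map]
      refine (norm_add_le _ _).trans (add_le_add le_rfl ?_)
      rw [norm_smul, Complex.norm_I, one_mul]
      refine (hY 0 t).2.trans ?_
      have e0 : force hT M u g 0 = g := by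
        funext τ
        have : IccExtend hT.le (⇑(0 : C(Icc (0 : ℝ) T, Seq2))) τ = 0 := rfl
        rw [force, this, map_zero, smul_zero, zero_add]
      rw [e0]
      gcongr
      exact intervalIntegral.integral_mono_interval le_rfl t.2.1 t.2.2
        (Filter.Eventually.of_forall fun τ => sq_nonneg _) hgi
    refine (norm_fixedPoint_le_of_weight F w hw1 hFc hx hA0 hF0 t).trans ?_
    change 2 * A * Real.exp (c * ∫ τ in (0 : ℝ)..t, u τ ^ 2) ≤ _
    gcongr
    exact intervalIntegral.integral_mono_interval le_rfl t.2.1 t.2.2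
      (Filter.Eventually.of_forall fun τ => sq_nonneg _) hu2

/-! ### From weak solutions to sequences -/

/-- The source term `u(τ) μ ψ(τ) + f(τ)` in `L²`. -/
def source {T : ℝ} (hT : 0 < T) (μ : Sobolev ℝ 3) (u : L2Time T ℝ) (f : L2Time T H3H10)
    (ψ : C(Icc (0 : ℝ) T, H0 3)) (τ : ℝ) : L2 ℂ :=
  u τ • mul (Sobolev.toL2 ℝ 3 μ) (IccExtend hT.le ψ τ).toL2 + Sobolev.toL2 ℂ 3 (f τ).toSobolev

/-- The group law takes the dependence on `t` out of the integral; what remains is a primitive in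
`t`. -/
theorem duhamelIntegrand_eq {T : ℝ} (hT : 0 < T) (μ : Sobolev ℝ 3) (u : L2Time T ℝ)
    (f : L2Time T H3H10) (ψ : C(Icc (0 : ℝ) T, H0 3)) (t τ : ℝ) :
    duhamelIntegrand hT μ u f ψ t τ = group t (group (-τ) (source hT μ u f ψ τ)) := by
  rw [← group_add, ← sub_eq_add_neg]; rfl

theorem continuous_toL2 : Continuous (H0.toL2 (s := 3)) := by
  have h : H0.toL2 (s := 3) = fun φ => seqToL2 3 (weightedEquiv 3 φ) :=
    funext fun φ => (seqToL2_weightedEquiv 3 φ).symm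
  rw [h]
  exact (seqToL2 3).continuous.comp (weightedEquiv 3).continuous

theorem memLp_source {T : ℝ} (hT : 0 < T) (μ : Sobolev ℝ 3) (u : L2Time T ℝ)
    (f : L2Time T H3H10) (ψ : C(Icc (0 : ℝ) T, H0 3)) :
    MemLp (source hT μ u f ψ) 2 (volume.restrict (Ioo 0 T)) := by
  obtain ⟨B, M, hB, -, -⟩ := exists_mul_operator μ
  have h2 : MemLp (fun τ => Sobolev.toL2 ℂ 3 (f τ).toSobolev) 2 (volume.restrict (Ioo 0 T)) :=
    (H3H10.wderivL 0).comp_memLp' (Lp.memLp f)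
  have hc : Continuous fun t => B (ψ t).toL2 :=
    B.continuous.comp (continuous_toL2.comp ψ.continuous)
  obtain ⟨C, hC⟩ := isCompact_univ.exists_bound_of_continuousOn hc.continuousOn
  have hc' : Continuous fun τ => B (IccExtend hT.le ψ τ).toL2 :=
    B.continuous.comp (continuous_toL2.comp ψ.continuous.Icc_extend')
  have h1 : MemLp (fun τ => u τ • mul (Sobolev.toL2 ℝ 3 μ) (IccExtend hT.le ψ τ).toL2) 2
      (volume.restrict (Ioo 0 T)) := by
    simp only [hB]
    refine (Lp.memLp u).of_le_mul (c := C) ((Lp.aestronglyMeasurable u).smul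
      hc'.aestronglyMeasurable) (Filter.Eventually.of_forall fun τ => ?_)
    rw [norm_smul, mul_comm]
    gcongr
    exact hC _ (mem_univ _)
  exact h1.add h2

theorem intervalIntegrable_group_source {T : ℝ} (hT : 0 < T) (μ : Sobolev ℝ 3) (u : L2Time T ℝ)
    (f : L2Time T H3H10) (ψ : C(Icc (0 : ℝ) T, H0 3)) (t : Icc (0 : ℝ) T) :
    IntervalIntegrable (fun τ => group (-τ) (source hT μ u f ψ τ)) volume 0 t := by
  have hI := memLp_Ioc_of_memLp_Ioo (memLp_source hT μ u f ψ) le_rfl t.2.2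
  rw [intervalIntegrable_iff_integrableOn_Ioc_of_le t.2.1]
  refine Integrable.mono (hI.integrable one_le_two)
    (Continuous.comp_aestronglyMeasurable₂ (g := fun (t : ℝ) (x : L2 ℂ) => group t x)
      continuous_group continuous_neg.aestronglyMeasurable hI.1) ?_
  filter_upwards with τ
  rw [norm_group]

theorem intervalIntegrable_duhamelIntegrand {T : ℝ} (hT : 0 < T) (μ : Sobolev ℝ 3)
    (u : L2Time T ℝ) (f : L2Time T H3H10) (ψ : C(Icc (0 : ℝ) T, H0 3)) (t : Icc (0 : ℝ) T) :
    IntervalIntegrable (duhamelIntegrand hT μ u f ψ t) volume 0 t := by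
  have h := intervalIntegrable_group_source hT μ u f ψ t
  have e : duhamelIntegrand hT μ u f ψ t =
      fun τ => (groupₗᵢ t).toContinuousLinearMap (group (-τ) (source hT μ u f ψ τ)) := by
    funext τ
    rw [duhamelIntegrand_eq]
    exact (groupₗᵢ_apply _ _).symm
  rw [intervalIntegrable_iff_integrableOn_Ioc_of_le t.2.1] at h ⊢
  rw [e]
  exact (groupₗᵢ (t : ℝ)).toContinuousLinearMap.integrable_comp h

theorem integral_duhamelIntegrand {T : ℝ} (hT : 0 < T) (μ : Sobolev ℝ 3)
    (u : L2Time T ℝ) (f : L2Time T H3H10) (ψ : C(Icc (0 : ℝ) T, H0 3)) (t : Icc (0 : ℝ) T) :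
    ∫ τ in (0 : ℝ)..t, duhamelIntegrand hT μ u f ψ t τ =
      group t (∫ τ in (0 : ℝ)..t, group (-τ) (source hT μ u f ψ τ)) := by
  have h := (groupₗᵢ (t : ℝ)).toContinuousLinearMap.intervalIntegral_comp_comm
    (intervalIntegrable_group_source hT μ u f ψ t)
  simp only [LinearIsometry.coe_toContinuousLinearMap, groupₗᵢ_apply] at h
  simp only [duhamelIntegrand_eq]
  exact h

/-- The integrability clause is automatic, since the source is square integrable in time and the
group is isometric. -/
theorem isWeakSolution_iff {T : ℝ} (hT : 0 < T) (μ : Sobolev ℝ 3) (ψ₀ : H0 3)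
    (f : L2Time T H3H10) (u : L2Time T ℝ) (ψ : C(Icc (0 : ℝ) T, H0 3)) :
    IsWeakSolution hT μ ψ₀ f u ψ ↔ ∀ t : Icc (0 : ℝ) T, (ψ t).toL2 =
      group t (ψ₀.toL2 + Complex.I • ∫ τ in (0 : ℝ)..t, group (-τ) (source hT μ u f ψ τ)) := by
  have e : ∀ t : Icc (0 : ℝ) T, group t ψ₀.toL2 +
      Complex.I • ∫ τ in (0 : ℝ)..t, duhamelIntegrand hT μ u f ψ t τ =
      group t (ψ₀.toL2 + Complex.I • ∫ τ in (0 : ℝ)..t, group (-τ) (source hT μ u f ψ τ)) := by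
    intro t
    rw [integral_duhamelIntegrand]
    simp only [← groupₗᵢ_apply, map_add, map_smul]
  constructor
  · intro h t
    rw [h.duhamel t, e t]
  · intro h
    exact ⟨fun t => intervalIntegrable_duhamelIntegrand hT μ u f ψ t, fun t => by rw [e t, h t]⟩

/-- The weighted coefficients of a continuous function with values in `H^3_{(0)}`. -/
def weightedMap {T : ℝ} : C(Icc (0 : ℝ) T, H0 3) ≃ C(Icc (0 : ℝ) T, Seq2) where
  toFun ψ := ⟨fun t => weightedEquiv 3 (ψ t), (weightedEquiv 3).continuous.comp ψ.continuous⟩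
  invFun x := ⟨fun t => (weightedEquiv 3).symm (x t),
    (weightedEquiv 3).symm.continuous.comp x.continuous⟩
  left_inv ψ := by
    refine ContinuousMap.ext fun t => ?_
    exact (weightedEquiv 3).symm_apply_apply (ψ t)
  right_inv x := by
    refine ContinuousMap.ext fun t => ?_
    exact (weightedEquiv 3).apply_symm_apply (x t)

theorem weightedMap_apply {T : ℝ} (ψ : C(Icc (0 : ℝ) T, H0 3)) (t : Icc (0 : ℝ) T) :
    weightedMap ψ t = weightedEquiv 3 (ψ t) := rfl

theorem coeff_real_smul (k : ℕ+) (r : ℝ) (φ : L2 ℂ) : coeff k (r • φ) = r * coeff k φ := by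
  have := (coeffL k).map_smul_of_tower r φ
  rwa [Complex.real_smul] at this

/-- Coefficients separate points of `L²` and commute with Bochner integrals there. The two equations
are therefore equivalent although the integrand has no `H^3_{(0)}` norm in general. -/
theorem isWeakSolution_iff_isSeqSolution {T : ℝ} (hT : 0 < T) (μ : Sobolev ℝ 3)
    {B : L2 ℂ →L[ℂ] L2 ℂ} {M : Seq2 →L[ℂ] Expansion}
    (hB : ∀ φ, mul (Sobolev.toL2 ℝ 3 μ) φ = B φ)
    (hM : ∀ (x : Seq2) (k : ℕ+), (k : ℂ) ^ 3 * coeff k (B (seqToL2 3 x)) = term k (M x))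
    (ψ₀ : H0 3) (f : L2Time T H3H10) (u : L2Time T ℝ) (ψ : C(Icc (0 : ℝ) T, H0 3)) :
    IsWeakSolution hT μ ψ₀ f u ψ ↔
      IsSeqSolution hT M u (fun τ => H3H10.expand (f τ)) (weightedEquiv 3 ψ₀)
        (weightedMap ψ) := by
  rw [isWeakSolution_iff]
  refine forall_congr' fun t => ?_
  have hsrc : ∀ (k : ℕ+) (τ : ℝ), (k : ℂ) ^ 3 * coeff k (group (-τ) (source hT μ u f ψ τ)) =
      phase k (-τ) * term k (force hT M u (fun τ => H3H10.expand (f τ)) (weightedMap ψ) τ) := by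
    intro k τ
    have e1 : (IccExtend hT.le ψ τ).toL2 = seqToL2 3 (IccExtend hT.le (weightedMap ψ) τ) :=
      (seqToL2_weightedEquiv 3 _).symm
    rw [coeff_group, force, map_add, map_smul, ← hM, ← H3H10.mul_coeff_eq, source, hB, e1,
      ← coeffL_apply k (_ + _), map_add, coeffL_apply, coeffL_apply, smul_eq_mul,
      coeff_real_smul]
    ring
  have hint : ∀ k : ℕ+, (k : ℂ) ^ 3 *
      coeff k (∫ τ in (0 : ℝ)..t, group (-τ) (source hT μ u f ψ τ)) =
      ∫ τ in (0 : ℝ)..t, phase k (-τ) *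
        term k (force hT M u (fun τ => H3H10.expand (f τ)) (weightedMap ψ) τ) := by
    intro k
    have h := (coeffL k).intervalIntegral_comp_comm
      (intervalIntegrable_group_source hT μ u f ψ t)
    simp only [coeffL_apply] at h
    rw [← h, ← intervalIntegral.integral_const_mul]
    simp only [hsrc]
  have hk : ∀ k : ℕ+, (k : ℂ) ^ 3 * coeff k (group t (ψ₀.toL2 +
      Complex.I • ∫ τ in (0 : ℝ)..t, group (-τ) (source hT μ u f ψ τ))) = phase k t *
      (weightedEquiv 3 ψ₀ k + Complex.I * ∫ τ in (0 : ℝ)..t, phase k (-τ) *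
        term k (force hT M u (fun τ => H3H10.expand (f τ)) (weightedMap ψ) τ)) := by
    intro k
    rw [← hint, weightedEquiv_apply, coeff_group, ← coeffL_apply, map_add, map_smul, coeffL_apply,
      coeffL_apply, smul_eq_mul]
    ring
  constructor
  · intro h k
    rw [weightedMap_apply, weightedEquiv_apply, h, hk]
  · intro h
    refine coeff_ext fun k => mul_left_cancel₀ (natCast_pnat_pow_ne_zero k 3) ?_
    rw [hk, ← h k]
    rfl

theorem norm_sq_L2Time {𝕜 : Type} [RCLike 𝕜] {T : ℝ} (hT : 0 < T) {V : Type}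
    [NormedAddCommGroup V] [InnerProductSpace 𝕜 V] (f : L2Time T V) :
    ‖f‖ ^ 2 = ∫ τ in (0 : ℝ)..T, ‖f τ‖ ^ 2 := by
  have h1 := norm_sq_eq_re_inner (𝕜 := 𝕜) f
  rw [h1, L2.inner_def, intervalIntegral.integral_of_le hT.le, integral_Ioc_eq_integral_Ioo]
  rw [← integral_re (L2.integrable_inner f f)]
  simp only [← norm_sq_eq_re_inner]

/-! ### Conservation of the norm -/

/-- Serves twice below: a vector primitive is dominated by the primitive of the norm, and the
squared norm of a bounded function by the function itself. -/
theorem absolutelyContinuousOnInterval_of_dist_le {X Y : Type*} [PseudoMetricSpace X]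
    [PseudoMetricSpace Y] {f : ℝ → X} {g : ℝ → Y} {a b C : ℝ}
    (hg : AbsolutelyContinuousOnInterval g a b)
    (h : ∀ s ∈ uIcc a b, ∀ t ∈ uIcc a b, dist (f s) (f t) ≤ C * dist (g s) (g t)) :
    AbsolutelyContinuousOnInterval f a b := by
  have hlim := Filter.Tendsto.const_mul C hg
  rw [mul_zero] at hlim
  refine squeeze_zero' (Filter.Eventually.of_forall fun E =>
    Finset.sum_nonneg fun i _ => dist_nonneg) ?_ hlim
  filter_upwards [Filter.mem_inf_of_right (Filter.mem_principal_self _)] with E hE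
  rw [Finset.mul_sum]
  exact Finset.sum_le_sum fun i hi => h _ (hE.1 i hi).1 _ (hE.1 i hi).2

/-- The derivative of `‖χ‖²` is `2⟨χ, W⟩ = 0`, but only almost everywhere since `W` is merely
integrable; absolute continuity of `‖χ‖²` makes it constant. -/
theorem norm_add_integral_eq {V : Type*} [NormedAddCommGroup V] [InnerProductSpace ℝ V]
    [CompleteSpace V] {T : ℝ} (hT : 0 < T) (χ₀ : V) {W : ℝ → V}
    (hW : IntervalIntegrable W volume 0 T)
    (horth : ∀ᵐ τ ∂volume.restrict (Ioo 0 T), inner ℝ (χ₀ + ∫ σ in (0 : ℝ)..τ, W σ) (W τ) = 0)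
    {t : ℝ} (ht : t ∈ Icc 0 T) : ‖χ₀ + ∫ σ in (0 : ℝ)..t, W σ‖ = ‖χ₀‖ := by
  set χ : ℝ → V := fun τ => χ₀ + ∫ σ in (0 : ℝ)..τ, W σ with hχ
  have huIcc : uIcc 0 T = Icc 0 T := uIcc_of_le hT.le
  have hsub : ∀ s ∈ uIcc 0 T, ∀ t ∈ uIcc 0 T, IntervalIntegrable W volume s t := fun s hs t ht =>
    hW.mono_set (uIcc_subset_uIcc hs ht)
  have h0 : (0 : ℝ) ∈ uIcc 0 T := by simp
  have hχac : AbsolutelyContinuousOnInterval χ 0 T := by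
    refine absolutelyContinuousOnInterval_of_dist_le (C := 1)
      (hW.norm.absolutelyContinuousOnInterval_intervalIntegral h0) fun s hs t ht => ?_
    rw [one_mul, dist_eq_norm, dist_eq_norm]
    have e1 := intervalIntegral.integral_interval_sub_left (hsub 0 h0 s hs) (hsub 0 h0 t ht)
    have e2 := intervalIntegral.integral_interval_sub_left (hsub 0 h0 s hs).norm
      (hsub 0 h0 t ht).norm
    rw [e2]
    simp only [hχ, add_sub_add_left_eq_sub]
    rw [e1]
    exact intervalIntegral.norm_integral_le_abs_integral_norm
  obtain ⟨C, hC⟩ := hχac.exists_bound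
  have hNac : AbsolutelyContinuousOnInterval (fun τ => ‖χ τ‖ ^ 2) 0 T := by
    refine absolutelyContinuousOnInterval_of_dist_le (C := 2 * C) hχac fun s hs t ht => ?_
    have h1 := hC s hs
    have h2 := hC t ht
    have h3 := abs_norm_sub_norm_le (χ s) (χ t)
    rw [Real.dist_eq, dist_eq_norm, sq_sub_sq, abs_mul, abs_of_nonneg (by positivity)]
    have h4 := norm_nonneg (χ s)
    exact mul_le_mul (by linarith) h3 (abs_nonneg _) (by linarith)
  have hder : ∀ᵐ τ, τ ∈ uIcc 0 T → HasDerivAt (fun τ => ‖χ τ‖ ^ 2) 0 τ := by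
    rw [Measure.restrict_congr_set Ioo_ae_eq_Icc, ae_restrict_iff' measurableSet_Icc] at horth
    filter_upwards [hW.ae_hasDerivAt_integral, horth] with τ h1 h2 hτ
    have h3 := ((h1 hτ 0 h0).const_add χ₀).norm_sq
    rw [h2 (huIcc ▸ hτ), mul_zero] at h3
    exact h3
  obtain ⟨D, hD⟩ := hNac.const_of_ae_hasDerivAt_zero hder
  have e1 := hD t (huIcc ▸ ht)
  have e2 := hD 0 h0
  have e3 : χ 0 = χ₀ := by simp [hχ]
  rw [e3] at e2
  exact (sq_eq_sq₀ (norm_nonneg _) (norm_nonneg _)).1 (e1.trans e2.symm)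

/-- For real `r` and `m`, the number `i r m |φ|²` has zero real part at every point. -/
theorem real_inner_I_smul_mul_eq_zero {m : ℝ → ℝ} {φ φ' : L2 ℂ} (r : ℝ)
    (h : φ' =ᵐ[unitMeasure] fun x => (m x : ℂ) * φ x) :
    inner ℝ φ (Complex.I • r • φ') = 0 := by
  rw [L2.inner_def]
  refine integral_eq_zero_of_ae ?_
  filter_upwards [h, Lp.coeFn_smul Complex.I (r • φ'), Lp.coeFn_smul r φ'] with x h1 h2 h3
  rw [h2, Pi.smul_apply, h3, Pi.smul_apply, h1, Complex.inner]
  simp only [smul_eq_mul, Complex.real_smul, Pi.zero_apply, Complex.mul_re, Complex.mul_im,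
    Complex.conj_re, Complex.conj_im, Complex.I_re, Complex.I_im, Complex.ofReal_re,
    Complex.ofReal_im]
  ring

theorem real_inner_group (t : ℝ) (φ φ' : L2 ℂ) :
    inner ℝ (group t φ) (group t φ') = inner ℝ φ φ' := by
  rw [real_inner_eq_norm_mul_self_add_norm_mul_self_sub_norm_sub_mul_self_div_two,
    real_inner_eq_norm_mul_self_add_norm_mul_self_sub_norm_sub_mul_self_div_two,
    ← groupₗᵢ_apply, ← groupₗᵢ_apply, ← map_sub, LinearIsometry.norm_map, LinearIsometry.norm_map,
    LinearIsometry.norm_map]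

/-- The argument is applied to `e^{iAt}ψ(t)`, which has the same norm as `ψ(t)` and in whose
evolution the unbounded operator `A` no longer appears. -/
theorem norm_eq_of_isWeakSolution {T : ℝ} (hT : 0 < T) {μ : Sobolev ℝ 3} {ψ₀ : H0 3}
    {u : L2Time T ℝ} {ψ : C(Icc (0 : ℝ) T, H0 3)} (h : IsWeakSolution hT μ ψ₀ 0 u ψ)
    (t : Icc (0 : ℝ) T) : ‖(ψ t).toL2‖ = ‖ψ₀.toL2‖ := by
  obtain ⟨B, M, hB, hBφ, -⟩ := exists_mul_operator μ
  rw [isWeakSolution_iff] at h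
  have hint := intervalIntegrable_group_source hT μ u 0 ψ ⟨T, hT.le, le_rfl⟩
  set W : ℝ → L2 ℂ := fun τ => Complex.I • group (-τ) (source hT μ u 0 ψ τ) with hW
  have hWi : IntervalIntegrable W volume 0 T := by
    rw [intervalIntegrable_iff_integrableOn_Ioc_of_le hT.le] at hint ⊢
    exact Integrable.smul Complex.I hint
  have hχ : ∀ τ : ℝ, ψ₀.toL2 + ∫ σ in (0 : ℝ)..τ, W σ = ψ₀.toL2 +
      Complex.I • ∫ σ in (0 : ℝ)..τ, group (-σ) (source hT μ u 0 ψ σ) := fun τ => by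
    rw [hW, intervalIntegral.integral_smul]
  rw [h t, norm_group, ← hχ]
  refine norm_add_integral_eq hT _ hWi ?_ t.2
  filter_upwards [Lp.coeFn_zero H3H10 2 (volume.restrict (Ioo (0 : ℝ) T)),
    ae_restrict_mem measurableSet_Ioo] with τ h1 h2
  have hτ : τ ∈ Icc 0 T := Ioo_subset_Icc_self h2
  have e1 := h ⟨τ, hτ⟩
  rw [← hχ] at e1
  have e2 : ψ₀.toL2 + ∫ σ in (0 : ℝ)..τ, W σ = group (-τ) (ψ ⟨τ, hτ⟩).toL2 := by
    rw [e1, ← group_add, neg_add_cancel, group_zero]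
  have e3 : source hT μ u 0 ψ τ = u τ • B (ψ ⟨τ, hτ⟩).toL2 := by
    have hz : Sobolev.toL2 ℂ 3 (H3H10.toSobolev 0) = 0 := rfl
    rw [source, h1, Pi.zero_apply, hz, add_zero, hB, IccExtend_of_mem _ _ hτ]
  have e4 : W τ = group (-τ) (Complex.I • u τ • B (ψ ⟨τ, hτ⟩).toL2) := by
    rw [hW, ← groupₗᵢ_apply, map_smul, groupₗᵢ_apply, ← e3]
  rw [e2, e4, real_inner_group]
  exact real_inner_I_smul_mul_eq_zero _ (hBφ _)

end Schrodinger

end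

/-! ### The theorem -/

open Schrodinger in
theorem mainTheorem2 (T : ℝ) (hT : 0 < T) (μ : Schrodinger.Sobolev ℝ 3) :
    (∀ (ψ₀ : Schrodinger.H0 3) (f : Schrodinger.L2Time T Schrodinger.H3H10)
      (u : Schrodinger.L2Time T ℝ),
      ∃! ψ : C(Set.Icc (0 : ℝ) T, Schrodinger.H0 3),
        Schrodinger.IsWeakSolution hT μ ψ₀ f u ψ) ∧
    (∀ R : ℝ, 0 < R → ∃ C : ℝ, 0 < C ∧
      ∀ (ψ₀ : Schrodinger.H0 3) (f : Schrodinger.L2Time T Schrodinger.H3H10)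
        (u : Schrodinger.L2Time T ℝ) (ψ : C(Set.Icc (0 : ℝ) T, Schrodinger.H0 3)),
        ‖u‖ < R → Schrodinger.IsWeakSolution hT μ ψ₀ f u ψ → ‖ψ‖ ≤ C * (‖ψ₀‖ + ‖f‖)) ∧
    (∀ (ψ₀ : Schrodinger.H0 3) (u : Schrodinger.L2Time T ℝ)
      (ψ : C(Set.Icc (0 : ℝ) T, Schrodinger.H0 3)),
      Schrodinger.IsWeakSolution hT μ ψ₀ 0 u ψ →
        ∀ t : Set.Icc (0 : ℝ) T, ‖(ψ t).toL2‖ = ‖ψ₀.toL2‖) := by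
  obtain ⟨B, M, hB, -, hM⟩ := exists_mul_operator μ
  obtain ⟨K, c, hK, hc, hsol⟩ := exists_seqSolution hT M
  have hiff := isWeakSolution_iff_isSeqSolution hT μ hB hM
  have hg : ∀ f : L2Time T H3H10,
      MemLp (fun τ => H3H10.expand (f τ)) 2 (volume.restrict (Ioo 0 T)) := fun f =>
    H3H10.expand.comp_memLp' (Lp.memLp f)
  refine ⟨fun ψ₀ f u => ?_, fun R hR => ?_, fun ψ₀ u ψ h t => norm_eq_of_isWeakSolution hT h t⟩
  · simp only [hiff]
    exact (weightedMap.existsUnique_congr_left (p := fun ψ => IsSeqSolution hT M u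
      (fun τ => H3H10.expand (f τ)) (weightedEquiv 3 ψ₀) (weightedMap ψ))).2 (by
        simpa using (hsol u _ (weightedEquiv 3 ψ₀) (Lp.memLp u) (hg f)).1)
  -- The bound of `exists_seqSolution`, with `∫ u² ≤ R²` in the exponent and the norm of
  -- `H3H10.expand` to pass from expansions to `f`.
  · refine ⟨2 * (1 + K * ‖H3H10.expand‖) * Real.exp (c * R ^ 2), by positivity,
      fun ψ₀ f u ψ hu h => ?_⟩
    rw [hiff] at h
    have hb := (hsol u _ (weightedEquiv 3 ψ₀) (Lp.memLp u) (hg f)).2 _ h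
    have hu2 : ∫ τ in (0 : ℝ)..T, u τ ^ 2 ≤ R ^ 2 := by
      have := norm_sq_L2Time (𝕜 := ℝ) hT u
      simp only [Real.norm_eq_abs, sq_abs] at this
      rw [← this]
      exact pow_le_pow_left₀ (norm_nonneg _) hu.le 2
    have hfi : IntervalIntegrable (fun τ => ‖f τ‖ ^ 2) volume 0 T := by
      rw [intervalIntegrable_iff_integrableOn_Ioo_of_le hT.le]
      exact (memLp_two_iff_integrable_sq_norm (Lp.memLp f).1).1 (Lp.memLp f)
    have hgi : IntervalIntegrable (fun τ => ‖H3H10.expand (f τ)‖ ^ 2) volume 0 T := by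
      rw [intervalIntegrable_iff_integrableOn_Ioo_of_le hT.le]
      exact (memLp_two_iff_integrable_sq_norm (hg f).1).1 (hg f)
    have hf2 : Real.sqrt (∫ τ in (0 : ℝ)..T, ‖H3H10.expand (f τ)‖ ^ 2) ≤
        ‖H3H10.expand‖ * ‖f‖ := by
      refine Real.sqrt_le_iff.2 ⟨by positivity, ?_⟩
      rw [mul_pow, norm_sq_L2Time (𝕜 := ℂ) hT f, ← intervalIntegral.integral_const_mul]
      refine intervalIntegral.integral_mono_on hT.le hgi (hfi.const_mul _) fun τ _ => ?_
      rw [← mul_pow]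
      exact pow_le_pow_left₀ (norm_nonneg _) (H3H10.expand.le_opNorm _) 2
    refine (ContinuousMap.norm_le _ (by positivity)).2 fun t => ?_
    have ht := hb t
    rw [weightedMap_apply, LinearIsometryEquiv.norm_map, LinearIsometryEquiv.norm_map] at ht
    refine ht.trans ?_
    have h1 : ‖ψ₀‖ + K * Real.sqrt (∫ τ in (0 : ℝ)..T, ‖H3H10.expand (f τ)‖ ^ 2) ≤
        (1 + K * ‖H3H10.expand‖) * (‖ψ₀‖ + ‖f‖) := by
      have h2 := mul_le_mul_of_nonneg_left hf2 hK
      have h3 : 0 ≤ K * ‖H3H10.expand‖ * ‖ψ₀‖ := by positivity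
      have h4 := norm_nonneg f
      nlinarith
    calc _ ≤ 2 * ((1 + K * ‖H3H10.expand‖) * (‖ψ₀‖ + ‖f‖)) * Real.exp (c * R ^ 2) := by gcongr
      _ = _ := by ring
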